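/- Let $S$ be an inverse semigroup with unit $1$, with $s\le t$ meaning $s=te$ for some idempotent $e$. A *Fell bundle* $\mathcal A=(A_s)_{s\in S}$ over $S$ consists of complex Banach spaces $A_s$, bilinear products $A_s\times A_t\to A_{st}$, conjugate-linear involutions $A_s\to A_{s^*}$ and linear isometric inclusions $A_s\hookrightarrow A_t$ for $s\le t$ such that the product is associative, $a^{**}=a$, $(ab)^*=b^*a^*$, the inclusions are functorial and compatible with products and involutions, $\|ab\|\le\|a\|\|b\|$, $\|a^*\|=\|a\|$, $\|a^*a\|=\|a\|^2$, and $a^*a$ is a positive element of the $C^*$-algebra $A_1$ for all $a\in A_s$, $s\in S$. (No saturation is assumed.) Let $A_s''$ denote the weak closure of $A_s$ in the universal representation of $\mathcal A$, so that $A_1''$ is the enveloping von Neumann algebra of $A_1$. For $s\in S$ let $I_{s,1}$ be the closed two-sided ideal of $A_1$ generated by the subspaces $A_{v^*v}$ with $v\le s$ and $v\le 1$, and let $1_s\in I_{s,1}''\subseteq A_1''$ be the unit of $I_{s,1}''$. The bundle $\mathcal A$ has the *approximation property* if there is a net $(\xi_i)_{i\in I}$ of finitely supported functions $\xi_i\colon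 S\to A_1$ with $\xi_i(s)\in A_{ss^*}$ for all $s\in S$ such that (i) $\displaystyle\sup_{i\in I}\Bigl\|\sum_{p,t\in S}\xi_i(p)^*\,\xi_i(t)\,1_{pt^*}\Bigr\|<\infty$, and (ii) for all $s\in S$ and $a\in A_s$, $\displaystyle\sum_{p,t\in S}1_{p(st)^*}\,\xi_i(p)^*\,a\,\xi_i(t)\longrightarrow a$ in norm (in $A_s''$). For a $C^*$-algebra $B$, let $\mathcal A\otimes_{\min}B$ (respectively $\mathcal A\otimes_{\max}B$) be the Fell bundle over $S$ whose fibre at $s$ is the completion of the algebraic tensor product $A_s\odot B$ in the norm $\|x\|=\|x^*x\|^{1/2}$, where the norm of $x^*x\in A_1\odot B$ is taken in $A_1\otimes_{\min}B$ (respectively $A_1\otimes_{\max}B$), with products, involutions and inclusions extending $(a\otimes b)(a'\otimes b')=aa'\otimes bb'$, $(a\otimes b)^*=a^*\otimes b^*$ and $a\otimes b\mapsto a\otimes b$. **Proposition.** If $\mathcal A$ is a Fell bundle over an inverse semigroup $S$ with unit and $\mathcal A$ has the approximation property, then, for every $C^*$-algebra $B$, both $\mathcal A\otimes_{\min}B$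 and $\mathcal A\otimes_{\max}B$ have the approximation property. -/

import Mathlib

universe u v

noncomputable section

open scoped TensorProduct InnerProductSpace ComplexConjugate

/-- An inverse semigroup with unit: a monoid in which every element `s` has exactly one
generalised inverse `s⁻¹`. -/
class InverseMonoid (S : Type u) extends Monoid S, Inv S where
  mul_inv_mul : ∀ s : S, s * s⁻¹ * s = s
  inv_mul_inv : ∀ s : S, s⁻¹ * s * s⁻¹ = s⁻¹
  inv_unique : ∀ s t : S, s * t * s = s → t * s * t = t → t = s⁻¹

namespace InverseMonoid

variable {S : Type u} [InverseMonoid S]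

/-- The natural partial order: `s ≤ t` iff `s = t e` for some idempotent `e`. -/
instance : LE S := ⟨fun s t => ∃ e : S, e * e = e ∧ t * e = s⟩

theorem le_of_eq {s t : S} (h : s = t) : s ≤ t := ⟨1, by simp, by simp [h]⟩

theorem idem_inv {e : S} (h : e * e = e) : e⁻¹ = e :=
  (inv_unique e e (by simp [h]) (by simp [h])).symm

protected theorem inv_inv (s : S) : s⁻¹⁻¹ = s :=
  (inv_unique s⁻¹ s (inv_mul_inv s) (mul_inv_mul s)).symm

protected theorem one_inv : (1 : S)⁻¹ = 1 := idem_inv (by simp)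

theorem idem_mul {e f : S} (he : e * e = e) (hf : f * f = f) : (e * f) * (e * f) = e * f := by
  have h1 := mul_inv_mul (e * f)
  have h2 := inv_mul_inv (e * f)
  set x := (e * f)⁻¹ with hx
  have hfx : f * x * e = x := by
    apply inv_unique
    · calc e * f * (f * x * e) * (e * f) = e * (f * f) * x * (e * e) * f := by
            simp only [mul_assoc]
        _ = e * f := by rw [hf, he]; simpa only [mul_assoc] using h1
    · calc f * x * e * (e * f) * (f * x * e) = f * (x * ((e * e) * (f * f)) * x) * e := by
            simp only [mul_assoc]
        _ = f * x * e := by rw [hf, he, h2]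
  have hxx : x * x = x := by
    conv_lhs => rw [← hfx]
    calc f * x * e * (f * x * e) = f * (x * (e * f) * x) * e := by simp only [mul_assoc]
      _ = x := by rw [h2, hfx]
  have h3 : e * f = x := by
    rw [← InverseMonoid.inv_inv (e * f), ← hx, idem_inv hxx]
  rw [h3, hxx]

theorem idem_comm {e f : S} (he : e * e = e) (hf : f * f = f) : e * f = f * e := by
  have h1 := idem_mul he hf
  have h2 := idem_mul hf he
  have : f * e = (e * f)⁻¹ := by
    apply inv_unique
    · calc e * f * (f * e) * (e * f) = e * (f * f) * (e * e) * f := by simp only [mul_assoc]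
        _ = e * f := by rw [hf, he]; simpa only [mul_assoc] using h1
    · calc f * e * (e * f) * (f * e) = f * (e * e) * (f * f) * e := by simp only [mul_assoc]
        _ = f * e := by rw [hf, he]; simpa only [mul_assoc] using h2
  rw [this, idem_inv h1]

theorem inv_mul_idem (s : S) : s⁻¹ * s * (s⁻¹ * s) = s⁻¹ * s := by
  rw [← mul_assoc, inv_mul_inv]

theorem mul_inv_idem (s : S) : s * s⁻¹ * (s * s⁻¹) = s * s⁻¹ := by
  rw [← mul_assoc, mul_inv_mul]

protected theorem mul_inv_rev (s t : S) : (s * t)⁻¹ = t⁻¹ * s⁻¹ := by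
  have hc := idem_comm (inv_mul_idem s) (mul_inv_idem t)
  symm
  apply inv_unique
  · calc s * t * (t⁻¹ * s⁻¹) * (s * t) = s * ((t * t⁻¹) * (s⁻¹ * s)) * t := by
          simp only [mul_assoc]
      _ = (s * s⁻¹ * s) * (t * t⁻¹ * t) := by rw [← hc]; simp only [mul_assoc]
      _ = s * t := by rw [mul_inv_mul, mul_inv_mul]
  · calc t⁻¹ * s⁻¹ * (s * t) * (t⁻¹ * s⁻¹) = t⁻¹ * ((s⁻¹ * s) * (t * t⁻¹)) * s⁻¹ := by
          simp only [mul_assoc]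
      _ = (t⁻¹ * t * t⁻¹) * (s⁻¹ * s * s⁻¹) := by rw [hc]; simp only [mul_assoc]
      _ = t⁻¹ * s⁻¹ := by rw [inv_mul_inv, inv_mul_inv]

theorem le_trans' {r s t : S} (h₁ : r ≤ s) (h₂ : s ≤ t) : r ≤ t := by
  obtain ⟨e, he, rfl⟩ := h₁
  obtain ⟨f, hf, rfl⟩ := h₂
  exact ⟨f * e, idem_mul hf he, by rw [mul_assoc]⟩

theorem mul_le_mul {s₁ s₂ t₁ t₂ : S} (h₁ : s₁ ≤ t₁) (h₂ : s₂ ≤ t₂) : s₁ * s₂ ≤ t₁ * t₂ := by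
  obtain ⟨e, he, rfl⟩ := h₁
  obtain ⟨f, hf, rfl⟩ := h₂
  have hc := idem_comm he (mul_inv_idem t₂)
  refine ⟨t₂⁻¹ * e * t₂ * f, idem_mul ?_ hf, ?_⟩
  · calc t₂⁻¹ * e * t₂ * (t₂⁻¹ * e * t₂) = t₂⁻¹ * (e * (t₂ * t₂⁻¹)) * e * t₂ := by
          simp only [mul_assoc]
      _ = (t₂⁻¹ * t₂ * t₂⁻¹) * (e * e) * t₂ := by rw [hc]; simp only [mul_assoc]
      _ = _ := by rw [inv_mul_inv, he]
  · calc t₁ * t₂ * (t₂⁻¹ * e * t₂ * f) = t₁ * ((t₂ * t₂⁻¹) * e) * t₂ * f := by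
          simp only [mul_assoc]
      _ = t₁ * e * (t₂ * t₂⁻¹ * t₂) * f := by rw [← hc]; simp only [mul_assoc]
      _ = _ := by rw [mul_inv_mul]; simp only [mul_assoc]

theorem inv_le_inv {s t : S} (h : s ≤ t) : s⁻¹ ≤ t⁻¹ := by
  obtain ⟨e, he, rfl⟩ := h
  have hc := idem_comm he (mul_inv_idem t⁻¹)
  rw [InverseMonoid.inv_inv] at hc
  refine ⟨t * e * t⁻¹, ?_, ?_⟩
  · calc t * e * t⁻¹ * (t * e * t⁻¹) = t * (e * (t⁻¹ * t)) * e * t⁻¹ := by simp only [mul_assoc]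
      _ = (t * t⁻¹ * t) * (e * e) * t⁻¹ := by rw [hc]; simp only [mul_assoc]
      _ = _ := by rw [mul_inv_mul, he]
  · calc t⁻¹ * (t * e * t⁻¹) = ((t⁻¹ * t) * e) * t⁻¹ := by simp only [mul_assoc]
      _ = e * (t⁻¹ * t * t⁻¹) := by rw [← hc]; simp only [mul_assoc]
      _ = _ := by rw [inv_mul_inv, InverseMonoid.mul_inv_rev, idem_inv he]

theorem inv_mul_le_one (s : S) : s⁻¹ * s ≤ 1 := ⟨s⁻¹ * s, inv_mul_idem s, one_mul _⟩

theorem mul_inv_le_one (s : S) : s * s⁻¹ ≤ 1 := ⟨s * s⁻¹, mul_inv_idem s, one_mul _⟩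

end InverseMonoid

open InverseMonoid

/-- An (algebraic) `*`-bundle over the inverse monoid `S`: complex vector spaces `A s` with bilinear
multiplications `A s × A t → A (s t)`, conjugate-linear involutions `A s → A s⁻¹` and inclusions
`A s → A t` for `s ≤ t`, subject to associativity, `a** = a`, `(ab)* = b* a*`, and the
compatibility of the inclusions with each other, with products and with involutions.
The inclusion attached to an equality `s = t` is the transport `A s = A t`, and it is used to
compare elements of fibres with equal indices. -/
structure AlgBundle {S : Type u} [InverseMonoid S] (A : S → Type v)
    [∀ s, AddCommGroup (A s)] [∀ s, Module ℂ (A s)] where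
  mul : ∀ s t : S, A s →ₗ[ℂ] A t →ₗ[ℂ] A (s * t)
  star : ∀ s : S, A s →ₗ⋆[ℂ] A s⁻¹
  incl : ∀ {s t : S}, s ≤ t → (A s →ₗ[ℂ] A t)
  incl_refl : ∀ {s : S} (h : s ≤ s) (a : A s), incl h a = a
  incl_incl : ∀ {r s t : S} (h₁ : r ≤ s) (h₂ : s ≤ t) (h : r ≤ t) (a : A r),
    incl h₂ (incl h₁ a) = incl h a
  incl_mul : ∀ {s₁ s₂ t₁ t₂ : S} (h₁ : s₁ ≤ t₁) (h₂ : s₂ ≤ t₂) (h : s₁ * s₂ ≤ t₁ * t₂)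
    (a : A s₁) (b : A s₂), incl h (mul s₁ s₂ a b) = mul t₁ t₂ (incl h₁ a) (incl h₂ b)
  incl_star : ∀ {s t : S} (h : s ≤ t) (h' : s⁻¹ ≤ t⁻¹) (a : A s),
    incl h' (star s a) = star t (incl h a)
  mul_assoc : ∀ (r s t : S) (h : r * s * t ≤ r * (s * t)) (a : A r) (b : A s) (c : A t),
    incl h (mul (r * s) t (mul r s a b) c) = mul r (s * t) a (mul s t b c)
  star_star : ∀ (s : S) (h : s⁻¹⁻¹ ≤ s) (a : A s), incl h (star s⁻¹ (star s a)) = a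
  star_mul : ∀ (s t : S) (h : (s * t)⁻¹ ≤ t⁻¹ * s⁻¹) (a : A s) (b : A t),
    incl h (star (s * t) (mul s t a b)) = mul t⁻¹ s⁻¹ (star t b) (star s a)

/-- A normed `*`-bundle: a `*`-bundle with seminormed fibres, isometric inclusions and involutions,
submultiplicative products, and the `C*`-identity `‖a* a‖ = ‖a‖²`. -/
structure StarBundle {S : Type u} [InverseMonoid S] (A : S → Type v)
    [∀ s, SeminormedAddCommGroup (A s)] [∀ s, NormedSpace ℂ (A s)] extends AlgBundle A where
  norm_incl : ∀ {s t : S} (h : s ≤ t) (a : A s), ‖incl h a‖ = ‖a‖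
  norm_mul_le : ∀ (s t : S) (a : A s) (b : A t), ‖mul s t a b‖ ≤ ‖a‖ * ‖b‖
  norm_star : ∀ (s : S) (a : A s), ‖star s a‖ = ‖a‖
  norm_star_mul_self : ∀ (s : S) (a : A s), ‖mul s⁻¹ s (star s a) a‖ = ‖a‖ ^ 2

namespace AlgBundle

variable {S : Type u} [InverseMonoid S] {A : S → Type v}
  [∀ s, AddCommGroup (A s)] [∀ s, Module ℂ (A s)] (𝓐 : AlgBundle A)

/-- The product `a b`, regarded as an element of a fibre `A r` with `s t ≤ r`. -/
def mulTo {s t r : S} (h : s * t ≤ r) (a : A s) (b : A t) : A r := 𝓐.incl h (𝓐.mul s t a b)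

/-- The adjoint `a*`, regarded as an element of a fibre `A r` with `s⁻¹ ≤ r`. -/
def starTo {s r : S} (h : s⁻¹ ≤ r) (a : A s) : A r := 𝓐.incl h (𝓐.star s a)

/-- The element `a* b` of the unit fibre, for `a`, `b` in the same fibre. -/
def ip {s : S} (a b : A s) : A 1 := 𝓐.mulTo (inv_mul_le_one s) (𝓐.star s a) b

/-- The left action of the unit fibre on the fibre at `s`. -/
def lact {s : S} (c : A 1) (a : A s) : A s := 𝓐.mulTo (le_of_eq (one_mul s)) c a

/-- The product of the unit fibre. -/
def mulOne (c d : A 1) : A 1 := 𝓐.mulTo (le_of_eq (one_mul 1)) c d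

/-- The involution of the unit fibre. -/
def starOne (c : A 1) : A 1 := 𝓐.starTo (le_of_eq InverseMonoid.one_inv) c

theorem mulTo_incl {s t s' t' r : S} (hs : s ≤ s') (ht : t ≤ t') (h : s' * t' ≤ r)
    (a : A s) (b : A t) : 𝓐.mulTo h (𝓐.incl hs a) (𝓐.incl ht b) =
      𝓐.mulTo (le_trans' (mul_le_mul hs ht) h) a b := by
  rw [mulTo, ← 𝓐.incl_mul hs ht (mul_le_mul hs ht), 𝓐.incl_incl _ _ (le_trans' (mul_le_mul hs ht) h)]
  rfl

theorem mulTo_incl_left {s t s' r : S} (hs : s ≤ s') (h : s' * t ≤ r)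
    (a : A s) (b : A t) : 𝓐.mulTo h (𝓐.incl hs a) b =
      𝓐.mulTo (le_trans' (mul_le_mul hs (le_of_eq rfl)) h) a b := by
  conv_lhs => rw [← 𝓐.incl_refl (le_of_eq rfl) b]
  exact 𝓐.mulTo_incl hs (le_of_eq rfl) h a b

theorem mulTo_incl_right {s t t' r : S} (ht : t ≤ t') (h : s * t' ≤ r)
    (a : A s) (b : A t) : 𝓐.mulTo h a (𝓐.incl ht b) =
      𝓐.mulTo (le_trans' (mul_le_mul (le_of_eq rfl) ht) h) a b := by
  conv_lhs => rw [← 𝓐.incl_refl (le_of_eq rfl) a]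
  exact 𝓐.mulTo_incl (le_of_eq rfl) ht h a b

theorem incl_mulTo {s t r r' : S} (h : s * t ≤ r) (hr : r ≤ r') (a : A s) (b : A t) :
    𝓐.incl hr (𝓐.mulTo h a b) = 𝓐.mulTo (le_trans' h hr) a b :=
  𝓐.incl_incl _ _ _ _

theorem starTo_incl {s s' r : S} (hs : s ≤ s') (h : s'⁻¹ ≤ r) (a : A s) :
    𝓐.starTo h (𝓐.incl hs a) = 𝓐.starTo (le_trans' (inv_le_inv hs) h) a := by
  rw [starTo, ← 𝓐.incl_star hs (inv_le_inv hs), 𝓐.incl_incl _ _ (le_trans' (inv_le_inv hs) h)]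
  rfl

theorem incl_starTo {s r r' : S} (h : s⁻¹ ≤ r) (hr : r ≤ r') (a : A s) :
    𝓐.incl hr (𝓐.starTo h a) = 𝓐.starTo (le_trans' h hr) a :=
  𝓐.incl_incl _ _ _ _

theorem mulTo_assoc {r s t p q z : S} (h₁ : r * s ≤ p) (h₂ : p * t ≤ z) (h₃ : s * t ≤ q)
    (h₄ : r * q ≤ z) (a : A r) (b : A s) (c : A t) :
    𝓐.mulTo h₂ (𝓐.mulTo h₁ a b) c = 𝓐.mulTo h₄ a (𝓐.mulTo h₃ b c) := by
  have hl : 𝓐.mulTo h₂ (𝓐.mulTo h₁ a b) c = _ := 𝓐.mulTo_incl_left h₁ h₂ (𝓐.mul r s a b) c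
  have hr : 𝓐.mulTo h₄ a (𝓐.mulTo h₃ b c) = _ := 𝓐.mulTo_incl_right h₃ h₄ a (𝓐.mul s t b c)
  rw [hl, hr, mulTo, mulTo, ← 𝓐.mul_assoc r s t (le_of_eq (_root_.mul_assoc _ _ _)),
    𝓐.incl_incl]

theorem starTo_mulTo {s t p q q' r : S} (h₁ : s * t ≤ p) (h₂ : p⁻¹ ≤ r) (h₃ : t⁻¹ ≤ q)
    (h₄ : s⁻¹ ≤ q') (h₅ : q * q' ≤ r) (a : A s) (b : A t) :
    𝓐.starTo h₂ (𝓐.mulTo h₁ a b) = 𝓐.mulTo h₅ (𝓐.starTo h₃ b) (𝓐.starTo h₄ a) := by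
  rw [mulTo, starTo_incl]
  conv_rhs => rw [starTo, starTo, mulTo_incl]
  rw [mulTo, ← 𝓐.star_mul s t (le_of_eq (InverseMonoid.mul_inv_rev s t)), 𝓐.incl_incl]
  rfl

theorem starTo_starTo {s p r : S} (h₁ : s⁻¹ ≤ p) (h₂ : p⁻¹ ≤ r) (h : s ≤ r) (a : A s) :
    𝓐.starTo h₂ (𝓐.starTo h₁ a) = 𝓐.incl h a := by
  conv_lhs => enter [3]; rw [starTo]
  rw [starTo_incl, starTo, ← 𝓐.incl_incl (le_of_eq (InverseMonoid.inv_inv s)) h, 𝓐.star_star]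

theorem star_eq_starTo {s : S} (a : A s) : 𝓐.star s a = 𝓐.starTo (le_of_eq rfl) a :=
  (𝓐.incl_refl _ _).symm

theorem ip_eq_mulOne (c d : A 1) : 𝓐.ip c d = 𝓐.mulOne (𝓐.starOne c) d := by
  rw [mulOne, starOne, starTo, mulTo_incl_left]; rfl

theorem ip_incl {s t : S} (h : s ≤ t) (a b : A s) :
    𝓐.ip (𝓐.incl h a) (𝓐.incl h b) = 𝓐.ip a b := by
  rw [ip, ← 𝓐.incl_star h (inv_le_inv h), mulTo_incl]; rfl

theorem ip_mul {s t : S} (a a' : A s) (b b' : A t) :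
    𝓐.ip (𝓐.mul s t a b) (𝓐.mul s t a' b') = 𝓐.ip b (𝓐.lact (𝓐.ip a a') b') := by
  have h1 : 𝓐.star (s * t) (𝓐.mul s t a b) =
      𝓐.mulTo (le_of_eq (InverseMonoid.mul_inv_rev s t).symm) (𝓐.star t b) (𝓐.star s a) := by
    rw [mulTo, ← 𝓐.star_mul s t (le_of_eq (InverseMonoid.mul_inv_rev s t)),
      𝓐.incl_incl _ _ (le_of_eq rfl), 𝓐.incl_refl]
  have h2 : 𝓐.mul s t a' b' = 𝓐.mulTo (le_of_eq rfl) a' b' := (𝓐.incl_refl _ _).symm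
  have hle : s⁻¹ * (s * t) ≤ t := by
    rw [← _root_.mul_assoc]
    simpa using mul_le_mul (inv_mul_le_one s) (le_of_eq (rfl : t = t))
  rw [ip, ip, ip, lact, h1, 𝓐.mulTo_assoc _ _ hle (inv_mul_le_one t), h2]
  congr 1
  exact (𝓐.mulTo_assoc _ _ _ _ _ _ _).symm

theorem ip_star {s : S} (a : A s) :
    𝓐.ip (𝓐.star s a) (𝓐.star s a) = 𝓐.mulTo (mul_inv_le_one s) a (𝓐.star s a) := by
  conv_rhs => rw [← 𝓐.star_star s (le_of_eq (InverseMonoid.inv_inv s)) a]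
  rw [mulTo_incl_left, 𝓐.star_star s (le_of_eq (InverseMonoid.inv_inv s)) a]; rfl

theorem ip_lact {s : S} (c : A 1) (a b : A s) :
    𝓐.ip (𝓐.lact c a) b = 𝓐.ip a (𝓐.lact (𝓐.starOne c) b) := by
  rw [ip, star_eq_starTo, lact, 𝓐.starTo_mulTo _ _ (le_of_eq rfl)
    (le_of_eq InverseMonoid.one_inv) (le_of_eq (by simp)), ← star_eq_starTo,
    𝓐.mulTo_assoc _ _ (le_of_eq (one_mul s)) (inv_mul_le_one s)]
  rfl

theorem starOne_ip {s : S} (a b : A s) : 𝓐.starOne (𝓐.ip a b) = 𝓐.ip b a := by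
  rw [starOne, ip, 𝓐.starTo_mulTo _ _ (le_of_eq rfl) (le_of_eq (InverseMonoid.inv_inv s))
    (inv_mul_le_one s), ← star_eq_starTo, star_eq_starTo _ a,
    𝓐.starTo_starTo _ _ (le_of_eq rfl), 𝓐.incl_refl]
  rfl

theorem lact_lact {s : S} (c d : A 1) (a : A s) :
    𝓐.lact c (𝓐.lact d a) = 𝓐.lact (𝓐.mulOne c d) a :=
  (𝓐.mulTo_assoc _ _ _ _ _ _ _).symm

theorem ip_add_left {s : S} (a a' b : A s) : 𝓐.ip (a + a') b = 𝓐.ip a b + 𝓐.ip a' b := by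
  simp [ip, mulTo]

theorem ip_add_right {s : S} (a b b' : A s) : 𝓐.ip a (b + b') = 𝓐.ip a b + 𝓐.ip a b' := by
  simp [ip, mulTo]

theorem ip_smul_left {s : S} (z : ℂ) (a b : A s) : 𝓐.ip (z • a) b = conj z • 𝓐.ip a b := by
  simp [ip, mulTo]

theorem ip_smul_right {s : S} (z : ℂ) (a b : A s) : 𝓐.ip a (z • b) = z • 𝓐.ip a b := by
  simp [ip, mulTo]

end AlgBundle

namespace StarBundle

open AlgBundle

variable {S : Type u} [InverseMonoid S] {A : S → Type v}
  [∀ s, SeminormedAddCommGroup (A s)] [∀ s, NormedSpace ℂ (A s)] (𝓐 : StarBundle A)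

theorem norm_mulTo_le {s t r : S} (h : s * t ≤ r) (a : A s) (b : A t) :
    ‖𝓐.mulTo h a b‖ ≤ ‖a‖ * ‖b‖ := by
  rw [mulTo, 𝓐.norm_incl]
  exact 𝓐.norm_mul_le s t a b

theorem norm_ip_self {s : S} (a : A s) : ‖𝓐.ip a a‖ = ‖a‖ ^ 2 := by
  rw [ip, mulTo, 𝓐.norm_incl, 𝓐.norm_star_mul_self]

/-- The unit fibre of a bundle with complete fibres, as a `C*`-algebra. -/
@[reducible]
def cstarAlgebraOne {A : S → Type v} [∀ s, NormedAddCommGroup (A s)] [∀ s, NormedSpace ℂ (A s)]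
    [∀ s, CompleteSpace (A s)] (𝓐 : StarBundle A) : NonUnitalCStarAlgebra (A 1) where
  __ := (inferInstance : NormedAddCommGroup (A 1))
  __ := (inferInstance : NormedSpace ℂ (A 1))
  __ := (inferInstance : CompleteSpace (A 1))
  mul := 𝓐.mulOne
  star := 𝓐.starOne
  left_distrib c d e := by
    change 𝓐.mulTo _ _ _ = 𝓐.mulTo _ _ _ + 𝓐.mulTo _ _ _
    simp [mulTo]
  right_distrib c d e := by
    change 𝓐.mulTo _ _ _ = 𝓐.mulTo _ _ _ + 𝓐.mulTo _ _ _
    simp [mulTo]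
  zero_mul c := by
    change 𝓐.mulTo _ _ _ = _
    simp [mulTo]
  mul_zero c := by
    change 𝓐.mulTo _ _ _ = _
    simp [mulTo]
  mul_assoc c d e := 𝓐.mulTo_assoc _ _ _ _ c d e
  norm_mul_le c d := 𝓐.norm_mulTo_le _ c d
  star_involutive c := by
    change 𝓐.starTo _ (𝓐.starTo _ c) = c
    rw [𝓐.starTo_starTo _ _ (le_of_eq rfl), 𝓐.incl_refl]
  star_mul c d := 𝓐.starTo_mulTo _ _ _ _ _ c d
  star_add c d := by
    change 𝓐.starTo _ _ = 𝓐.starTo _ _ + 𝓐.starTo _ _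
    simp [starTo]
  norm_mul_self_le c := by
    change _ ≤ ‖𝓐.mulOne (𝓐.starOne c) c‖
    rw [← ip_eq_mulOne, norm_ip_self, sq]
  smul_assoc z c d := by
    change 𝓐.mulTo _ _ _ = z • 𝓐.mulTo _ _ _
    simp [mulTo]
  smul_comm z c d := by
    change z • 𝓐.mulTo _ _ _ = 𝓐.mulTo _ _ _
    simp [mulTo]
  star_smul z c := by
    change 𝓐.starTo _ _ = _ • 𝓐.starTo _ _
    simp [starTo]

end StarBundle

/-- A Fell bundle over the inverse monoid `S`: Banach spaces `A s` with products, involutions and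
inclusions as above, such that `a* a` is a positive element of the `C*`-algebra `A 1` for every
`a ∈ A s`, that is, `a* a = c* c` for some `c ∈ A 1`. -/
structure FellBundle (S : Type u) [InverseMonoid S] where
  fibre : S → Type u
  [normed : ∀ s, NormedAddCommGroup (fibre s)]
  [space : ∀ s, NormedSpace ℂ (fibre s)]
  [complete : ∀ s, CompleteSpace (fibre s)]
  bundle : StarBundle fibre
  pos : ∀ (s : S) (a : fibre s), ∃ c : fibre 1, bundle.ip a a = bundle.ip c c

namespace FellBundle

variable {S : Type u} [InverseMonoid S] (𝒜 : FellBundle S)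

instance (s : S) : NormedAddCommGroup (𝒜.fibre s) := 𝒜.normed s
instance (s : S) : NormedSpace ℂ (𝒜.fibre s) := 𝒜.space s
instance (s : S) : CompleteSpace (𝒜.fibre s) := 𝒜.complete s
instance : NonUnitalCStarAlgebra (𝒜.fibre 1) := 𝒜.bundle.cstarAlgebraOne

theorem mul_def (c d : 𝒜.fibre 1) : c * d = 𝒜.bundle.mulOne c d := rfl

theorem star_def (c : 𝒜.fibre 1) : star c = 𝒜.bundle.starOne c := rfl

/-- The closed two-sided ideal `I_{s,1}` of the unit fibre generated by the fibres at `v⁻¹ v`, where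
`v` runs over the elements with `v ≤ s` and `v ≤ 1`. -/
def ideal (s : S) : Submodule ℂ (𝒜.fibre 1) :=
  sInf {J | IsClosed (J : Set (𝒜.fibre 1)) ∧ (∀ x ∈ J, ∀ c : 𝒜.fibre 1, c * x ∈ J ∧ x * c ∈ J) ∧
    ∀ v : S, v ≤ s → v ≤ 1 → ∀ a : 𝒜.fibre (v⁻¹ * v), 𝒜.bundle.incl (inv_mul_le_one v) a ∈ J}

/-- A nondegenerate representation of a Fell bundle on a Hilbert space. -/
structure Rep where
  H : Type u
  [normed : NormedAddCommGroup H]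
  [inner : InnerProductSpace ℂ H]
  [complete : CompleteSpace H]
  π : ∀ s : S, 𝒜.fibre s →ₗ[ℂ] (H →L[ℂ] H)
  map_mul : ∀ (s t : S) (a : 𝒜.fibre s) (b : 𝒜.fibre t),
    π (s * t) (𝒜.bundle.mul s t a b) = π s a * π t b
  map_star : ∀ (s : S) (a : 𝒜.fibre s), π s⁻¹ (𝒜.bundle.star s a) = star (π s a)
  map_incl : ∀ (s t : S) (h : s ≤ t) (a : 𝒜.fibre s), π t (𝒜.bundle.incl h a) = π s a
  nondegenerate :
    (Submodule.span ℂ {w : H | ∃ (c : 𝒜.fibre 1) (v : H), w = π 1 c v}).topologicalClosure = ⊤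

namespace Rep

variable {𝒜}

instance (ρ : 𝒜.Rep) : NormedAddCommGroup ρ.H := ρ.normed
instance (ρ : 𝒜.Rep) : InnerProductSpace ℂ ρ.H := ρ.inner
instance (ρ : 𝒜.Rep) : CompleteSpace ρ.H := ρ.complete

/-- The restriction of a representation to the unit fibre. -/
def one (ρ : 𝒜.Rep) : 𝒜.fibre 1 →⋆ₙₐ[ℂ] (ρ.H →L[ℂ] ρ.H) where
  __ := ρ.π 1
  map_zero' := map_zero (ρ.π 1)
  map_mul' c d := (ρ.map_incl _ _ _ _).trans (ρ.map_mul 1 1 c d)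
  map_star' c := (ρ.map_incl _ _ _ _).trans (ρ.map_star 1 c)

theorem norm_le (ρ : 𝒜.Rep) (s : S) (a : 𝒜.fibre s) : ‖ρ.π s a‖ ≤ ‖a‖ := by
  have h : star (ρ.π s a) * ρ.π s a = ρ.one (𝒜.bundle.ip a a) := by
    rw [← ρ.map_star, ← ρ.map_mul]
    exact (ρ.map_incl _ _ _ _).symm
  have h1 : ‖ρ.π s a‖ * ‖ρ.π s a‖ ≤ ‖a‖ * ‖a‖ := by
    rw [← CStarRing.norm_star_mul_self, h, ← sq, ← 𝒜.bundle.norm_ip_self]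
    exact NonUnitalStarAlgHom.norm_apply_le _ _
  exact le_of_sq_le_sq (by simpa only [sq] using h1) (norm_nonneg _)

end Rep

/-- The Hilbert space of the universal representation, which is the direct sum of all nondegenerate
representations on Hilbert spaces of the universe of the fibres. -/
abbrev univSpace : Type (u + 1) := lp (fun ρ : 𝒜.Rep => ρ.H) 2

/-- The universal representation of a Fell bundle on the fibre at `s`. The enveloping von Neumann
bundle consists of the weak closures `A s''` of the ranges of these maps. -/
def univ (s : S) (a : 𝒜.fibre s) : 𝒜.univSpace →L[ℂ] 𝒜.univSpace :=
  lp.mapCLM 2 (fun ρ => ρ.π s a) (norm_nonneg a) (fun ρ => ρ.norm_le s a)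

/-- The unit of the von Neumann algebra `I_{s,1}'' ⊆ A 1''`, that is, the orthogonal projection
onto the closed linear span of `I_{s,1}` applied to the universal Hilbert space. -/
def unit (s : S) : 𝒜.univSpace →L[ℂ] 𝒜.univSpace :=
  (Submodule.span ℂ {w : 𝒜.univSpace |
    ∃ c ∈ 𝒜.ideal s, ∃ v : 𝒜.univSpace, w = 𝒜.univ 1 c v}).topologicalClosure.starProjection

/-- Finitely supported functions `ξ : S → A 1` with `ξ s` in the fibre at `s s⁻¹` for every `s`. -/
def IsSection (ξ : S →₀ 𝒜.fibre 1) : Prop :=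
  ∀ s : S, ∃ a : 𝒜.fibre (s * s⁻¹), ξ s = 𝒜.bundle.incl (mul_inv_le_one s) a

/-- The approximation property of a Fell bundle over an inverse monoid. -/
def ApproximationProperty : Prop :=
  ∃ (ι : Type u) (_ : Preorder ι) (_ : IsDirectedOrder ι) (_ : Nonempty ι)
    (ξ : ι → S →₀ 𝒜.fibre 1),
    (∀ i, 𝒜.IsSection (ξ i)) ∧
    (∃ C : ℝ, ∀ i, ‖∑ p ∈ (ξ i).support, ∑ t ∈ (ξ i).support,
      star (𝒜.univ 1 (ξ i p)) * 𝒜.univ 1 (ξ i t) * 𝒜.unit (p * t⁻¹)‖ ≤ C) ∧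
    ∀ (s : S) (a : 𝒜.fibre s), Filter.Tendsto
      (fun i => ∑ p ∈ (ξ i).support, ∑ t ∈ (ξ i).support,
        𝒜.unit (p * (s * t)⁻¹) * star (𝒜.univ 1 (ξ i p)) * 𝒜.univ s a * 𝒜.univ 1 (ξ i t))
      Filter.atTop (nhds (𝒜.univ s a))

end FellBundle

namespace StarBundle

open UniformSpace Completion

variable {S : Type u} [InverseMonoid S] {A : S → Type v}
  [∀ s, SeminormedAddCommGroup (A s)] [∀ s, NormedSpace ℂ (A s)] (𝓐 : StarBundle A)

/-- The multiplication as a bounded bilinear map. -/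
def mulL (s t : S) : A s →L[ℂ] A t →L[ℂ] A (s * t) :=
  LinearMap.mkContinuous₂ (𝓐.mul s t) 1 fun a b => by simpa using 𝓐.norm_mul_le s t a b

/-- The multiplication of the completions. -/
def mulC (s t : S) :
    Completion (A s) →L[ℂ] Completion (A t) →L[ℂ] Completion (A (s * t)) :=
  ((ContinuousLinearMap.compL ℂ (A t) (A (s * t)) (Completion (A (s * t))) toComplL).comp
    (𝓐.mulL s t)).fromCompletion.flip.fromCompletion.flip

theorem mulC_coe (s t : S) (a : A s) (b : A t) :
    𝓐.mulC s t a b = (𝓐.mul s t a b : Completion (A (s * t))) := by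
  rw [mulC, ContinuousLinearMap.flip_apply, ContinuousLinearMap.fromCompletion_apply_coe,
    ContinuousLinearMap.flip_apply, ContinuousLinearMap.fromCompletion_apply_coe]
  rfl

/-- The involution of the completions. -/
def starC (s : S) : Completion (A s) →L⋆[ℂ] Completion (A s⁻¹) :=
  ((𝓐.star s).mkContinuous 1 fun a => by simp [𝓐.norm_star]).completion

theorem starC_coe (s : S) (a : A s) : 𝓐.starC s a = (𝓐.star s a : Completion (A s⁻¹)) := by
  simp [starC]

/-- The inclusions of the completions. -/
def inclC {s t : S} (h : s ≤ t) : Completion (A s) →L[ℂ] Completion (A t) :=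
  ((𝓐.incl h).mkContinuous 1 fun a => by simp [𝓐.norm_incl]).completion

theorem inclC_coe {s t : S} (h : s ≤ t) (a : A s) :
    𝓐.inclC h a = (𝓐.incl h a : Completion (A t)) := by
  simp [inclC]

/-- The fibrewise (Hausdorff) completion of a normed `*`-bundle, with the continuous extensions of
the products, involutions and inclusions. -/
def completion : StarBundle (fun s => Completion (A s)) where
  mul s t := (ContinuousLinearMap.coeLM ℂ).comp (𝓐.mulC s t).toLinearMap
  star s := (𝓐.starC s).toLinearMap
  incl h := (𝓐.inclC h).toLinearMap
  incl_refl h a := by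
    change 𝓐.inclC h a = a
    induction a using induction_on with
    | hp => exact isClosed_eq (by fun_prop) (by fun_prop)
    | ih a => rw [inclC_coe, 𝓐.incl_refl]
  incl_incl h₁ h₂ h a := by
    change 𝓐.inclC h₂ (𝓐.inclC h₁ a) = 𝓐.inclC h a
    induction a using induction_on with
    | hp => exact isClosed_eq (by fun_prop) (by fun_prop)
    | ih a => rw [inclC_coe, inclC_coe, inclC_coe, 𝓐.incl_incl]
  incl_mul {s₁ s₂ t₁ t₂} h₁ h₂ h a b := by
    change 𝓐.inclC h (𝓐.mulC s₁ s₂ a b) = 𝓐.mulC t₁ t₂ (𝓐.inclC h₁ a) (𝓐.inclC h₂ b)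
    induction a, b using induction_on₂ with
    | hp => exact isClosed_eq (by fun_prop) (by fun_prop)
    | ih a b => simp only [inclC_coe, mulC_coe, 𝓐.incl_mul h₁ h₂ h]
  incl_star {s t} h h' a := by
    change 𝓐.inclC h' (𝓐.starC s a) = 𝓐.starC t (𝓐.inclC h a)
    induction a using induction_on with
    | hp => exact isClosed_eq (by fun_prop) (by fun_prop)
    | ih a => simp only [inclC_coe, starC_coe, 𝓐.incl_star h h']
  mul_assoc r s t h a b c := by
    change 𝓐.inclC h (𝓐.mulC (r * s) t (𝓐.mulC r s a b) c) =
      𝓐.mulC r (s * t) a (𝓐.mulC s t b c)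
    induction a, b, c using induction_on₃ with
    | hp => exact isClosed_eq (by fun_prop) (by fun_prop)
    | ih a b c => simp only [inclC_coe, mulC_coe, 𝓐.mul_assoc r s t h]
  star_star s h a := by
    change 𝓐.inclC h (𝓐.starC s⁻¹ (𝓐.starC s a)) = a
    induction a using induction_on with
    | hp => exact isClosed_eq (by fun_prop) (by fun_prop)
    | ih a => simp only [inclC_coe, starC_coe, 𝓐.star_star s h]
  star_mul s t h a b := by
    change 𝓐.inclC h (𝓐.starC (s * t) (𝓐.mulC s t a b)) =
      𝓐.mulC t⁻¹ s⁻¹ (𝓐.starC t b) (𝓐.starC s a)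
    induction a, b using induction_on₂ with
    | hp => exact isClosed_eq (by fun_prop) (by fun_prop)
    | ih a b => simp only [inclC_coe, mulC_coe, starC_coe, 𝓐.star_mul s t h]
  norm_incl h a := by
    change ‖𝓐.inclC h a‖ = _
    induction a using induction_on with
    | hp => exact isClosed_eq (by fun_prop) (by fun_prop)
    | ih a => rw [inclC_coe, norm_coe, norm_coe, 𝓐.norm_incl]
  norm_mul_le s t a b := by
    change ‖𝓐.mulC s t a b‖ ≤ _
    induction a, b using induction_on₂ with
    | hp => exact isClosed_le (by fun_prop) (by fun_prop)
    | ih a b => rw [mulC_coe]; simpa only [norm_coe] using 𝓐.norm_mul_le s t a b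
  norm_star s a := by
    change ‖𝓐.starC s a‖ = _
    induction a using induction_on with
    | hp => exact isClosed_eq (by fun_prop) (by fun_prop)
    | ih a => rw [starC_coe, norm_coe, norm_coe, 𝓐.norm_star]
  norm_star_mul_self s a := by
    change ‖𝓐.mulC s⁻¹ s (𝓐.starC s a) a‖ = _
    induction a using induction_on with
    | hp => exact isClosed_eq (by fun_prop) (by fun_prop)
    | ih a => rw [starC_coe, mulC_coe, norm_coe, norm_coe, 𝓐.norm_star_mul_self]

theorem completion_ip_coe {s : S} (a b : A s) :
    𝓐.completion.ip (a : Completion (A s)) (b : Completion (A s)) =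
      (𝓐.ip a b : Completion (A 1)) := by
  change 𝓐.inclC _ (𝓐.mulC s⁻¹ s (𝓐.starC s a) b) = _
  rw [starC_coe, mulC_coe, inclC_coe]
  rfl

theorem continuous_completion_ip {s : S} :
    Continuous fun a : Completion (A s) => 𝓐.completion.ip a a := by
  change Continuous fun a => 𝓐.inclC _ (𝓐.mulC s⁻¹ s (𝓐.starC s a) a)
  fun_prop

end StarBundle

namespace AlgBundle

variable {S : Type u} [InverseMonoid S] {A : S → Type v}
  [∀ s, AddCommGroup (A s)] [∀ s, Module ℂ (A s)] (𝓐 : AlgBundle A)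

/-- The algebraic tensor product of a `*`-bundle with a `C*`-algebra `B`: the fibres are
`A s ⊗ B`, with `(a ⊗ b) (a' ⊗ b') = a a' ⊗ b b'` and `(a ⊗ b)* = a* ⊗ b*`. -/
def tensor (B : Type v) [NonUnitalCStarAlgebra B] : AlgBundle (fun s => A s ⊗[ℂ] B) where
  mul s t := TensorProduct.map₂ (𝓐.mul s t) (LinearMap.mul ℂ B)
  star s := TensorProduct.map (𝓐.star s) (starLinearEquiv ℂ (A := B)).toLinearMap
  incl h := TensorProduct.map (𝓐.incl h) LinearMap.id
  incl_refl h x := by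
    induction x with
    | zero => simp
    | tmul a b => simp [𝓐.incl_refl]
    | add x y hx hy => rw [map_add, hx, hy]
  incl_incl h₁ h₂ h x := by
    induction x with
    | zero => simp
    | tmul a b => simp [𝓐.incl_incl h₁ h₂ h]
    | add x y hx hy => simp only [map_add, hx, hy]
  incl_mul h₁ h₂ h x y := by
    induction x with
    | zero => simp
    | add x x' hx hx' => simp only [map_add, LinearMap.add_apply, hx, hx']
    | tmul a b =>
      induction y with
      | zero => simp
      | add y y' hy hy' => simp only [map_add, hy, hy']
      | tmul a' b' => simp [𝓐.incl_mul h₁ h₂ h]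
  incl_star h h' x := by
    induction x with
    | zero => simp
    | tmul a b => simp [𝓐.incl_star h h']
    | add x y hx hy => simp only [map_add, hx, hy]
  mul_assoc r s t h x y z := by
    induction x with
    | zero => simp
    | add x x' hx hx' => simp only [map_add, LinearMap.add_apply, hx, hx']
    | tmul a b =>
      induction y with
      | zero => simp
      | add y y' hy hy' => simp only [map_add, LinearMap.add_apply, hy, hy']
      | tmul a' b' =>
        induction z with
        | zero => simp
        | add z z' hz hz' => simp only [map_add, hz, hz']
        | tmul a'' b'' => simp [𝓐.mul_assoc r s t h, _root_.mul_assoc]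
  star_star s h x := by
    induction x with
    | zero => simp
    | tmul a b => simp [𝓐.star_star s h]
    | add x y hx hy => simp only [map_add, hx, hy]
  star_mul s t h x y := by
    induction x with
    | zero => simp
    | add x x' hx hx' => simp only [map_add, LinearMap.add_apply, hx, hx']
    | tmul a b =>
      induction y with
      | zero => simp
      | add y y' hy hy' => simp only [map_add, LinearMap.add_apply, hy, hy']
      | tmul a' b' => simp [𝓐.star_mul s t h]

variable {B : Type v} [NonUnitalCStarAlgebra B]

theorem tensor_ip_tmul {s : S} (a a' : A s) (b b' : B) :
    (𝓐.tensor B).ip (a ⊗ₜ b) (a' ⊗ₜ b') = 𝓐.ip a a' ⊗ₜ (Star.star b * b') := by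
  simp [ip, mulTo, tensor]

theorem tensor_lact_tmul {s : S} (c : A 1) (a : A s) (b b' : B) :
    (𝓐.tensor B).lact (c ⊗ₜ b) (a ⊗ₜ b') = 𝓐.lact c a ⊗ₜ (b * b') := by
  simp [lact, mulTo, tensor]

end AlgBundle

namespace FellBundle

variable {S : Type u} [InverseMonoid S] (𝒜 : FellBundle S)

/-- The algebraic tensor product bundle, with fibres `A s ⊗ B`. -/
abbrev alg (B : Type u) [NonUnitalCStarAlgebra B] :
    AlgBundle (fun s => 𝒜.fibre s ⊗[ℂ] B) :=
  𝒜.bundle.toAlgBundle.tensor B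

/-- The properties of a function `p` on the algebraic tensor product `A 1 ⊗ B` under which
`x ↦ p (x* x) ^ (1 / 2)` makes the fibres `A s ⊗ B` a normed `*`-bundle. -/
structure IsBundleNorm (B : Type u) [NonUnitalCStarAlgebra B] (p : 𝒜.fibre 1 ⊗[ℂ] B → ℝ) :
    Prop where
  nonneg : ∀ c, 0 ≤ p c
  add_le : ∀ (s : S) (x y : 𝒜.fibre s ⊗[ℂ] B), √(p ((𝒜.alg B).ip (x + y) (x + y))) ≤
    √(p ((𝒜.alg B).ip x x)) + √(p ((𝒜.alg B).ip y y))
  smul : ∀ (s : S) (z : ℂ) (x : 𝒜.fibre s ⊗[ℂ] B),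
    p ((𝒜.alg B).ip (z • x) (z • x)) = ‖z‖ ^ 2 * p ((𝒜.alg B).ip x x)
  mul_le : ∀ (s t : S) (x : 𝒜.fibre s ⊗[ℂ] B) (y : 𝒜.fibre t ⊗[ℂ] B),
    p ((𝒜.alg B).ip ((𝒜.alg B).mul s t x y) ((𝒜.alg B).mul s t x y)) ≤
      p ((𝒜.alg B).ip x x) * p ((𝒜.alg B).ip y y)
  ip_self : ∀ c : 𝒜.fibre 1 ⊗[ℂ] B, p ((𝒜.alg B).ip c c) = p c ^ 2
  tmul_le : ∀ (c : 𝒜.fibre 1) (b : B), p (c ⊗ₜ b) ≤ ‖c‖ * ‖b‖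

variable {𝒜}
variable {B : Type u} [NonUnitalCStarAlgebra B] {p : 𝒜.fibre 1 ⊗[ℂ] B → ℝ}

/-- The fibre `A s ⊗ B`, with the seminorm `x ↦ p (x* x) ^ (1 / 2)`. -/
@[nolint unusedArguments]
def TensorFibre (_ : 𝒜.IsBundleNorm B p) (s : S) : Type u := 𝒜.fibre s ⊗[ℂ] B

namespace IsBundleNorm

variable (hp : 𝒜.IsBundleNorm B p)

instance (s : S) : AddCommGroup (TensorFibre hp s) :=
  inferInstanceAs (AddCommGroup (𝒜.fibre s ⊗[ℂ] B))

instance (s : S) : Module ℂ (TensorFibre hp s) :=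
  inferInstanceAs (Module ℂ (𝒜.fibre s ⊗[ℂ] B))

instance (s : S) : Norm (TensorFibre hp s) := ⟨fun x => √(p ((𝒜.alg B).ip x x))⟩

/-- The function `p` on the unit fibre. -/
def pOne : TensorFibre hp 1 → ℝ := p

/-- The algebraic tensor product bundle, on the seminormed fibres. -/
def algT : AlgBundle (TensorFibre hp) := 𝒜.alg B

theorem norm_def {s : S} (x : TensorFibre hp s) : ‖x‖ = √(hp.pOne (hp.algT.ip x x)) := rfl

theorem pOne_nonneg (c : TensorFibre hp 1) : 0 ≤ hp.pOne c := hp.nonneg c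

theorem pOne_smul {s : S} (z : ℂ) (x : TensorFibre hp s) :
    hp.pOne (hp.algT.ip (z • x) (z • x)) = ‖z‖ ^ 2 * hp.pOne (hp.algT.ip x x) := hp.smul s z x

theorem pOne_mul_le {s t : S} (x : TensorFibre hp s) (y : TensorFibre hp t) :
    hp.pOne (hp.algT.ip (hp.algT.mul s t x y) (hp.algT.mul s t x y)) ≤
      hp.pOne (hp.algT.ip x x) * hp.pOne (hp.algT.ip y y) := hp.mul_le s t x y

theorem pOne_ip_self (c : TensorFibre hp 1) : hp.pOne (hp.algT.ip c c) = hp.pOne c ^ 2 :=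
  hp.ip_self c

theorem core (s : S) : SeminormedSpace.Core ℂ (TensorFibre hp s) where
  norm_nonneg _ := Real.sqrt_nonneg _
  norm_smul z x := by
    rw [norm_def, norm_def, hp.pOne_smul, Real.sqrt_mul (by positivity),
      Real.sqrt_sq (norm_nonneg _)]
  norm_triangle := hp.add_le s

instance (s : S) : SeminormedAddCommGroup (TensorFibre hp s) :=
  SeminormedAddCommGroup.ofCore (hp.core s)

instance (s : S) : NormedSpace ℂ (TensorFibre hp s) where
  norm_smul_le z x := ((hp.core s).norm_smul z x).le

theorem norm_sq {s : S} (x : TensorFibre hp s) : ‖x‖ ^ 2 = hp.pOne (hp.algT.ip x x) :=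
  Real.sq_sqrt (hp.pOne_nonneg _)

theorem norm_one (c : TensorFibre hp 1) : ‖c‖ = hp.pOne c :=
  (congrArg Real.sqrt (hp.pOne_ip_self c)).trans (Real.sqrt_sq (hp.pOne_nonneg c))

theorem norm_star_le {s : S} (x : TensorFibre hp s) : ‖hp.algT.star s x‖ ≤ ‖x‖ := by
  have h1 := hp.pOne_mul_le x (hp.algT.star s x)
  rw [← hp.algT.ip_incl (mul_inv_le_one s), hp.pOne_ip_self, ← AlgBundle.mulTo,
    ← hp.algT.ip_star, ← hp.norm_sq, ← hp.norm_sq] at h1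
  by_contra! h
  have h0 := norm_nonneg x
  have h2 : ‖x‖ ^ 2 < ‖hp.algT.star s x‖ ^ 2 := by gcongr
  have h3 : 0 < ‖hp.algT.star s x‖ ^ 2 := lt_of_le_of_lt (by positivity) h2
  nlinarith

/-- The normed `*`-bundle with fibres `A s ⊗ B`. -/
def preBundle : StarBundle (TensorFibre hp) where
  toAlgBundle := hp.algT
  norm_incl h x := by
    rw [hp.norm_def, hp.norm_def, hp.algT.ip_incl]
  norm_mul_le s t x y := by
    rw [hp.norm_def, hp.norm_def, hp.norm_def, ← Real.sqrt_mul (hp.pOne_nonneg _)]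
    exact Real.sqrt_le_sqrt (hp.pOne_mul_le x y)
  norm_star s x := by
    refine le_antisymm (hp.norm_star_le x) ?_
    have h := hp.norm_star_le (hp.algT.star s x)
    rwa [hp.norm_def (hp.algT.star s⁻¹ _),
      ← hp.algT.ip_incl (le_of_eq (InverseMonoid.inv_inv s)), hp.algT.star_star,
      ← hp.norm_def] at h
  norm_star_mul_self s x := by
    rw [hp.norm_def, ← hp.algT.ip_incl (inv_mul_le_one s), hp.pOne_ip_self, hp.norm_sq]
    exact Real.sqrt_sq (hp.pOne_nonneg _)

end IsBundleNorm
end FellBundle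

/-- A quantitative approximate unit for a positive element. -/
theorem exists_approx_unit {A : Type u} [NonUnitalCStarAlgebra A] [PartialOrder A]
    [StarOrderedRing A] (h : A) (hh : 0 ≤ h) {ε : ℝ} (hε : 0 < ε) :
    ∃ r : A, star r = r ∧ ‖r * h * r‖ ≤ 1 ∧
      ‖h - r * h * r * h - h * (r * h * r) + r * h * r * h * (r * h * r)‖ ≤ 4 * ε := by
  set f : ℝ → ℝ := fun t => √t / (|t| + ε) with hf
  have hpos : ∀ t : ℝ, 0 < |t| + ε := fun t => by positivity
  have hfc : Continuous f := Continuous.div (by fun_prop) (by fun_prop) fun t => (hpos t).ne'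
  have hf0 : f 0 = 0 := by simp [hf]
  have hsa : IsSelfAdjoint h := hh.isSelfAdjoint
  have hid : cfcₙ (fun t : ℝ => t) h = h := cfcₙ_id' ℝ h
  have hw : cfcₙ f h * h * cfcₙ f h = cfcₙ (fun t => f t * t * f t) h := by
    rw [cfcₙ_mul _ _ h (by fun_prop) (by simp [hf0]) (by fun_prop) hf0,
      cfcₙ_mul _ _ h (by fun_prop) hf0 (by fun_prop) rfl, hid]
  refine ⟨cfcₙ f h, cfcₙ_predicate f h, ?_, ?_⟩
  · rw [hw]
    refine norm_cfcₙ_le fun t ht => ?_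
    have ht0 : 0 ≤ t := quasispectrum_nonneg_of_nonneg h hh t ht
    have e : f t * t * f t = (t / (t + ε)) ^ 2 := by
      simp only [hf, abs_of_nonneg ht0]
      rw [div_mul_eq_mul_div, div_mul_div_comm, div_pow]
      congr 1
      · calc √t * t * √t = (√t * √t) * t := by ring
          _ = _ := by rw [Real.mul_self_sqrt ht0]; ring
      · ring
    have h1 : t / (t + ε) ≤ 1 := by rw [div_le_one (by positivity)]; linarith
    have h2 : 0 ≤ t / (t + ε) := by positivity
    rw [e, Real.norm_of_nonneg (by positivity)]
    exact pow_le_one₀ h2 h1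
  · have e : h - cfcₙ f h * h * cfcₙ f h * h - h * (cfcₙ f h * h * cfcₙ f h) +
        cfcₙ f h * h * cfcₙ f h * h * (cfcₙ f h * h * cfcₙ f h) =
        cfcₙ (fun t => t - f t * t * f t * t - t * (f t * t * f t) +
          f t * t * f t * t * (f t * t * f t)) h := by
      rw [cfcₙ_add (a := h) _ _ (by fun_prop) (by simp [hf0]) (by fun_prop) (by simp [hf0]),
        cfcₙ_sub (a := h) _ _ (by fun_prop) (by simp [hf0]) (by fun_prop) (by simp [hf0]),
        cfcₙ_sub (a := h) _ _ (by fun_prop) (by simp [hf0]) (by fun_prop) (by simp [hf0]),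
        cfcₙ_mul (fun t => f t * t * f t * t) (fun t => f t * t * f t) h (by fun_prop)
          (by simp) (by fun_prop) (by simp [hf0]),
        cfcₙ_mul (fun t => f t * t * f t) (fun t => t) h (by fun_prop)
          (by simp) (by fun_prop) (by simp [hf0]),
        cfcₙ_mul (fun t => t) (fun t => f t * t * f t) h (by fun_prop)
          (by simp) (by fun_prop) (by simp [hf0]), hid, ← hw]
    rw [e]
    refine norm_cfcₙ_le fun t ht => ?_
    have ht0 : 0 ≤ t := quasispectrum_nonneg_of_nonneg h hh t ht
    have e : f t * t * f t = (t / (t + ε)) ^ 2 := by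
      simp only [hf, abs_of_nonneg ht0]
      rw [div_mul_eq_mul_div, div_mul_div_comm, div_pow]
      congr 1
      · calc √t * t * √t = (√t * √t) * t := by ring
          _ = _ := by rw [Real.mul_self_sqrt ht0]; ring
      · ring
    rw [e]
    have hp : 0 < t + ε := by positivity
    set q := t / (t + ε) with hq
    have h1 : q ≤ 1 := by rw [hq, div_le_one (by positivity)]; linarith
    have h2 : 0 ≤ q := by positivity
    have h3 : t * (1 - q) ≤ ε := by
      have : 1 - q = ε / (t + ε) := by rw [hq]; field_simp; ring
      rw [this, ← mul_div_assoc, div_le_iff₀ hp]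
      nlinarith
    have h4 : t - q ^ 2 * t - t * q ^ 2 + q ^ 2 * t * q ^ 2 =
        t * (1 - q) * ((1 - q) * (1 + q) ^ 2) := by ring
    have h5 : (1 - q) * (1 + q) ^ 2 ≤ 4 := by nlinarith [mul_nonneg h2 h2]
    have h6 : 0 ≤ (1 - q) * (1 + q) ^ 2 := mul_nonneg (by linarith) (by positivity)
    rw [h4, Real.norm_of_nonneg (mul_nonneg (mul_nonneg ht0 (by linarith)) h6)]
    calc _ ≤ ε * 4 := mul_le_mul h3 h5 h6 hε.le
      _ = _ := mul_comm _ _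

namespace FellBundle

variable {S : Type u} [InverseMonoid S] (𝒜 : FellBundle S)

theorem ip_nonneg [PartialOrder (𝒜.fibre 1)] [StarOrderedRing (𝒜.fibre 1)] {s : S}
    (a : 𝒜.fibre s) : 0 ≤ 𝒜.bundle.ip a a := by
  obtain ⟨c, hc⟩ := 𝒜.pos s a
  rw [hc, 𝒜.bundle.ip_eq_mulOne]
  exact star_mul_self_nonneg c

theorem ip_lact_rankOne {s : S} (u x y : 𝒜.fibre s) :
    𝒜.bundle.ip x (𝒜.bundle.lact (𝒜.bundle.ip (𝒜.bundle.star s u) (𝒜.bundle.star s u)) y) =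
      𝒜.bundle.ip (𝒜.bundle.ip u x) (𝒜.bundle.ip u y) := by
  have h : 𝒜.bundle.lact (𝒜.bundle.ip (𝒜.bundle.star s u) (𝒜.bundle.star s u)) y =
      𝒜.bundle.mulTo (le_of_eq (mul_one s)) u (𝒜.bundle.ip u y) := by
    rw [𝒜.bundle.ip_star]
    exact 𝒜.bundle.mulTo_assoc _ _ _ _ _ _ _
  rw [h, 𝒜.bundle.ip_eq_mulOne (𝒜.bundle.ip u x), 𝒜.bundle.starOne_ip]
  exact (𝒜.bundle.mulTo_assoc _ _ _ _ _ _ _).symm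

/-- The element `a b*` of the unit fibre. -/
def rk {s : S} (a b : 𝒜.fibre s) : 𝒜.fibre 1 :=
  𝒜.bundle.mulTo (mul_inv_le_one s) a (𝒜.bundle.star s b)

theorem rk_self {s : S} (a : 𝒜.fibre s) :
    𝒜.rk a a = 𝒜.bundle.ip (𝒜.bundle.star s a) (𝒜.bundle.star s a) :=
  (𝒜.bundle.ip_star a).symm

theorem rk_lact_left {s : S} (c : 𝒜.fibre 1) (a b : 𝒜.fibre s) :
    𝒜.rk (𝒜.bundle.lact c a) b = c * 𝒜.rk a b :=
  𝒜.bundle.mulTo_assoc _ _ _ _ _ _ _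

theorem rk_lact_right {s : S} (c : 𝒜.fibre 1) (a b : 𝒜.fibre s) :
    𝒜.rk a (𝒜.bundle.lact c b) = 𝒜.rk a b * star c := by
  rw [rk, 𝒜.bundle.star_eq_starTo, AlgBundle.lact, 𝒜.bundle.starTo_mulTo _ _ (le_of_eq rfl)
    (le_of_eq InverseMonoid.one_inv) (le_of_eq (mul_one _)), ← 𝒜.bundle.star_eq_starTo]
  exact (𝒜.bundle.mulTo_assoc _ _ _ _ _ _ _).symm

theorem rk_sub_left {s : S} (a a' b : 𝒜.fibre s) : 𝒜.rk (a - a') b = 𝒜.rk a b - 𝒜.rk a' b := by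
  simp [rk, AlgBundle.mulTo]

theorem rk_sub_right {s : S} (a b b' : 𝒜.fibre s) : 𝒜.rk a (b - b') = 𝒜.rk a b - 𝒜.rk a b' := by
  simp [rk, AlgBundle.mulTo]

theorem lact_sum {s : S} {n : Type*} [Fintype n] (c : n → 𝒜.fibre 1) (a : 𝒜.fibre s) :
    𝒜.bundle.lact (∑ i, c i) a = ∑ i, 𝒜.bundle.lact (c i) a := by
  simp [AlgBundle.lact, AlgBundle.mulTo]

theorem ip_sum_right {s : S} {n : Type*} [Fintype n] (a : 𝒜.fibre s) (b : n → 𝒜.fibre s) :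
    𝒜.bundle.ip a (∑ i, b i) = ∑ i, 𝒜.bundle.ip a (b i) := by
  simp [AlgBundle.ip, AlgBundle.mulTo]

/-- Finitely many elements of a fibre are approximately fixed by an element of the form
`w = ∑ uₖ uₖ*` of the unit fibre. -/
theorem exists_factorization {s : S} {n : Type*} [Fintype n] (a : n → 𝒜.fibre s) {δ : ℝ}
    (hδ : 0 < δ) : ∃ (w : 𝒜.fibre 1) (u : n → 𝒜.fibre s), ‖w‖ ≤ 1 ∧
      (∀ i, ‖a i - 𝒜.bundle.lact w (a i)‖ ≤ δ) ∧
      ∀ x y : 𝒜.fibre s, 𝒜.bundle.ip x (𝒜.bundle.lact w y) =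
        ∑ k, 𝒜.bundle.ip (𝒜.bundle.ip (u k) x) (𝒜.bundle.ip (u k) y) := by
  let _ := CStarAlgebra.spectralOrder (𝒜.fibre 1)
  have := CStarAlgebra.spectralOrderedRing (𝒜.fibre 1)
  set h : 𝒜.fibre 1 := ∑ i, 𝒜.rk (a i) (a i) with hh
  have hk : ∀ b : 𝒜.fibre s, 0 ≤ 𝒜.rk b b := fun b => by
    rw [rk_self]; exact 𝒜.ip_nonneg _
  have h0 : 0 ≤ h := Finset.sum_nonneg fun i _ => hk _
  obtain ⟨r, hr, hw, hb⟩ := exists_approx_unit h h0 (ε := δ ^ 2 / 4) (by positivity)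
  set w := r * h * r with hwdef
  have hsw : star w = w := by
    rw [hwdef, star_mul, star_mul, hr, h0.isSelfAdjoint.star_eq, mul_assoc]
  refine ⟨w, fun k => 𝒜.bundle.lact r (a k), hw, fun i => ?_, fun x y => ?_⟩
  · set d : n → 𝒜.fibre s := fun j => a j - 𝒜.bundle.lact w (a j) with hd
    have hdd : ∀ j, 𝒜.rk (d j) (d j) = 𝒜.rk (a j) (a j) - w * 𝒜.rk (a j) (a j) -
        𝒜.rk (a j) (a j) * w + w * 𝒜.rk (a j) (a j) * w := fun j => by
      simp only [hd, rk_sub_left, rk_sub_right, rk_lact_left, rk_lact_right, hsw, mul_assoc, sub_mul]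
      abel
    have hsum : ∑ j, 𝒜.rk (d j) (d j) = h - w * h - h * w + w * h * w := by
      simp only [hdd, Finset.sum_add_distrib, Finset.sum_sub_distrib, hh, Finset.mul_sum,
        Finset.sum_mul]
    have hle : 𝒜.rk (d i) (d i) ≤ ∑ j, 𝒜.rk (d j) (d j) :=
      Finset.single_le_sum (f := fun j => 𝒜.rk (d j) (d j)) (fun j _ => hk _) (Finset.mem_univ i)
    have hn := CStarAlgebra.norm_le_norm_of_nonneg_of_le (hk (d i)) hle
    rw [rk_self, 𝒜.bundle.norm_ip_self, 𝒜.bundle.norm_star, hsum] at hn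
    have hb' : ‖h - w * h - h * w + w * h * w‖ ≤ δ ^ 2 := hb.trans_eq (by ring)
    exact le_of_sq_le_sq (hn.trans hb') hδ.le
  · have e : w = ∑ k, 𝒜.rk (𝒜.bundle.lact r (a k)) (𝒜.bundle.lact r (a k)) := by
      simp only [rk_lact_left, rk_lact_right, hr, hwdef, hh, Finset.mul_sum, Finset.sum_mul,
        mul_assoc]
    rw [e, lact_sum, ip_sum_right]
    refine Finset.sum_congr rfl fun k _ => ?_
    rw [rk_self, ip_lact_rankOne]

end FellBundle

namespace FellBundle.IsBundleNorm

variable {S : Type u} [InverseMonoid S] {𝒜 : FellBundle S}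
variable {B : Type u} [NonUnitalCStarAlgebra B] {p : 𝒜.fibre 1 ⊗[ℂ] B → ℝ}
variable (hp : 𝒜.IsBundleNorm B p)

/-- Elementary tensors. -/
def tm {s : S} : 𝒜.fibre s →ₗ[ℂ] B →ₗ[ℂ] TensorFibre hp s := TensorProduct.mk ℂ _ _

theorem ip_tm {s : S} (a a' : 𝒜.fibre s) (b b' : B) :
    hp.algT.ip (hp.tm a b) (hp.tm a' b') = hp.tm (𝒜.bundle.ip a a') (star b * b') :=
  𝒜.bundle.toAlgBundle.tensor_ip_tmul a a' b b'

theorem norm_tm_one (c : 𝒜.fibre 1) (b : B) : ‖hp.tm c b‖ ≤ ‖c‖ * ‖b‖ :=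
  (hp.norm_one _).trans_le (hp.tmul_le c b)

theorem exists_sum_tm {s : S} (x : TensorFibre hp s) :
    ∃ (n : ℕ) (a : Fin n → 𝒜.fibre s) (b : Fin n → B), x = ∑ i, hp.tm (a i) (b i) :=
  TensorProduct.exists_sum_tmul_eq (M := 𝒜.fibre s) (N := B) x

theorem ip_sum_sum {s : S} {n : ℕ} (x y : Fin n → TensorFibre hp s) :
    hp.algT.ip (∑ i, x i) (∑ i, y i) = ∑ i, ∑ j, hp.algT.ip (x i) (y j) := by
  simp only [AlgBundle.ip, AlgBundle.mulTo, map_sum, LinearMap.sum_apply]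
  exact Finset.sum_comm

theorem ip_approx {s : S} (x : TensorFibre hp s) {ε : ℝ} (hε : 0 < ε) :
    ∃ (n : ℕ) (c : Fin n → TensorFibre hp 1),
      ‖hp.algT.ip x x - ∑ k, hp.algT.ip (c k) (c k)‖ < ε := by
  obtain ⟨n, a, b, rfl⟩ := hp.exists_sum_tm x
  set M : ℝ := ∑ i, ∑ j, ‖a i‖ * (‖b i‖ * ‖b j‖) with hM
  have hM0 : 0 ≤ M := by positivity
  obtain ⟨w, u, -, hwa, hw⟩ := 𝒜.exists_factorization a (δ := ε / (M + 1)) (by positivity)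
  refine ⟨n, fun k => ∑ i, hp.tm (𝒜.bundle.ip (u k) (a i)) (b i), ?_⟩
  have e : ∑ k, hp.algT.ip (∑ i, hp.tm (𝒜.bundle.ip (u k) (a i)) (b i))
      (∑ i, hp.tm (𝒜.bundle.ip (u k) (a i)) (b i)) =
      ∑ i, ∑ j, hp.tm (𝒜.bundle.ip (a i) (𝒜.bundle.lact w (a j))) (star (b i) * b j) := by
    simp only [ip_sum_sum, ip_tm, hw]
    rw [Finset.sum_comm]
    refine Finset.sum_congr rfl fun i _ => ?_
    rw [Finset.sum_comm]
    refine Finset.sum_congr rfl fun j _ => ?_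
    simp
  rw [e, ip_sum_sum, ← Finset.sum_sub_distrib]
  simp only [← Finset.sum_sub_distrib, ip_tm]
  calc _ ≤ ∑ i, ∑ j, ‖a i‖ * (‖b i‖ * ‖b j‖) * (ε / (M + 1)) := by
        refine norm_sum_le_of_le _ fun i _ => norm_sum_le_of_le _ fun j _ => ?_
        have e2 : 𝒜.bundle.ip (a i) (a j) - 𝒜.bundle.ip (a i) (𝒜.bundle.lact w (a j)) =
            𝒜.bundle.ip (a i) (a j - 𝒜.bundle.lact w (a j)) := by
          simp [AlgBundle.ip, AlgBundle.mulTo]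
        rw [← LinearMap.sub_apply, ← map_sub, e2]
        refine (hp.norm_tm_one _ _).trans ?_
        have h1 : ‖𝒜.bundle.ip (a i) (a j - 𝒜.bundle.lact w (a j))‖ ≤ ‖a i‖ * (ε / (M + 1)) := by
          refine (𝒜.bundle.norm_mulTo_le _ _ _).trans ?_
          rw [𝒜.bundle.norm_star]
          gcongr
          exact hwa j
        have h2 : ‖star (b i) * b j‖ ≤ ‖b i‖ * ‖b j‖ := by
          simpa using norm_mul_le (star (b i)) (b j)
        calc _ ≤ ‖a i‖ * (ε / (M + 1)) * (‖b i‖ * ‖b j‖) := by gcongr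
          _ = _ := by ring
    _ = M * (ε / (M + 1)) := by simp only [hM, Finset.sum_mul]
    _ < ε := by
        rw [← mul_div_assoc, div_lt_iff₀ (by positivity)]
        nlinarith

/-- The tensor product bundle: its fibres are the completions of `A s ⊗ B` in the norm
`x ↦ p (x* x) ^ (1 / 2)`. -/
def tensor : FellBundle S where
  fibre s := UniformSpace.Completion (TensorFibre hp s)
  bundle := hp.preBundle.completion
  pos s x := by
    let _ : NonUnitalCStarAlgebra (UniformSpace.Completion (TensorFibre hp 1)) :=
      hp.preBundle.completion.cstarAlgebraOne
    let _ := CStarAlgebra.spectralOrder (UniformSpace.Completion (TensorFibre hp 1))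
    have := CStarAlgebra.spectralOrderedRing (UniformSpace.Completion (TensorFibre hp 1))
    have hip : ∀ c : UniformSpace.Completion (TensorFibre hp 1),
        hp.preBundle.completion.ip c c = star c * c := fun c =>
      hp.preBundle.completion.ip_eq_mulOne c c
    suffices h : 0 ≤ hp.preBundle.completion.ip x x by
      obtain ⟨c, hc⟩ := CStarAlgebra.nonneg_iff_eq_star_mul_self.mp h
      exact ⟨c, hc.trans (hip c).symm⟩
    induction x using UniformSpace.Completion.induction_on with
    | hp => exact (CStarAlgebra.isClosed_nonneg
      (A := UniformSpace.Completion (TensorFibre hp 1))).preimage hp.preBundle.continuous_completion_ip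
    | ih x =>
      rw [hp.preBundle.completion_ip_coe]
      refine (CStarAlgebra.isClosed_nonneg
      (A := UniformSpace.Completion (TensorFibre hp 1))).closure_subset (Metric.mem_closure_iff.mpr ?_)
      intro ε hε
      obtain ⟨n, c, hc⟩ := hp.ip_approx x hε
      refine ⟨∑ k, hp.preBundle.completion.ip (c k : UniformSpace.Completion (TensorFibre hp 1))
        (c k : UniformSpace.Completion (TensorFibre hp 1)), ?_, ?_⟩
      · have h0 : ∀ k, 0 ≤ hp.preBundle.completion.ip
            (c k : UniformSpace.Completion (TensorFibre hp 1))
            (c k : UniformSpace.Completion (TensorFibre hp 1)) := fun k => by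
          rw [hip]
          exact star_mul_self_nonneg _
        exact Finset.sum_nonneg (N := UniformSpace.Completion (TensorFibre hp 1)) fun k _ => h0 k
      · have e : ∑ k, hp.preBundle.completion.ip
            (c k : UniformSpace.Completion (TensorFibre hp 1))
            (c k : UniformSpace.Completion (TensorFibre hp 1)) =
            ((∑ k, hp.preBundle.ip (c k) (c k) : TensorFibre hp 1) :
              UniformSpace.Completion (TensorFibre hp 1)) := by
          simp only [hp.preBundle.completion_ip_coe]
          exact (map_sum (UniformSpace.Completion.toComplₗᵢ (𝕜 := ℂ) (E := TensorFibre hp 1)) _ _).symm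
        rw [e, dist_eq_norm, ← UniformSpace.Completion.coe_sub, UniformSpace.Completion.norm_coe]
        exact hc

end FellBundle.IsBundleNorm

/-- The norm of a positive operator `T* T`, in terms of matrix coefficients. -/
theorem norm_eq_sq_of_inner {E F : Type*} [NormedAddCommGroup E] [InnerProductSpace ℂ E]
    [NormedAddCommGroup F] [InnerProductSpace ℂ F] (T : E →L[ℂ] F) (R : E →L[ℂ] E)
    (h : ∀ v w, inner ℂ (T v) (T w) = inner ℂ v (R w)) : ‖R‖ = ‖T‖ ^ 2 := by
  refine le_antisymm (R.opNorm_le_bound (by positivity) fun w => ?_) ?_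
  · have h1 : ‖R w‖ * ‖R w‖ ≤ ‖R w‖ * (‖T‖ ^ 2 * ‖w‖) := by
      have e : ‖R w‖ * ‖R w‖ = ‖inner ℂ (R w) (R w)‖ := by
        rw [inner_self_eq_norm_sq_to_K]; simp [sq]
      rw [e, ← h]
      refine (norm_inner_le_norm _ _).trans ?_
      calc _ ≤ (‖T‖ * ‖R w‖) * (‖T‖ * ‖w‖) := by
            gcongr <;> exact T.le_opNorm _
        _ = _ := by ring
    rcases (norm_nonneg (R w)).eq_or_lt with h0 | h0
    · rw [← h0]; positivity
    · exact le_of_mul_le_mul_left h1 h0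
  · have h1 : ‖T‖ ≤ √‖R‖ := T.opNorm_le_bound (by positivity) fun v => by
      refine le_of_sq_le_sq ?_ (by positivity)
      rw [mul_pow, Real.sq_sqrt (norm_nonneg _)]
      calc ‖T v‖ ^ 2 = ‖inner ℂ (T v) (T v)‖ := by
            rw [inner_self_eq_norm_sq_to_K]; simp
        _ ≤ ‖v‖ * ‖R v‖ := by rw [h]; exact norm_inner_le_norm _ _
        _ ≤ ‖v‖ * (‖R‖ * ‖v‖) := by gcongr; exact R.le_opNorm v
        _ = _ := by ring
    calc ‖T‖ ^ 2 ≤ √‖R‖ ^ 2 := by gcongr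
      _ = _ := Real.sq_sqrt (norm_nonneg _)

/-- Conditions on a family of representations `Φ i` of the algebraic tensor product `A 1 ⊗ B` under
which the supremum of the operator norms extends to all fibres `A t ⊗ B`. -/
theorem FellBundle.IsBundleNorm.of_family {S : Type u} [InverseMonoid S] {𝒜 : FellBundle S}
    {B : Type u} [NonUnitalCStarAlgebra B] {I : Type*} {E : I → Type*}
    [∀ i, NormedAddCommGroup (E i)] [∀ i, InnerProductSpace ℂ (E i)]
    (Φ : ∀ i, 𝒜.fibre 1 ⊗[ℂ] B →ₗ[ℂ] (E i →L[ℂ] E i))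
    (hΦ : ∀ i c b, ‖Φ i (c ⊗ₜ b)‖ ≤ ‖c‖ * ‖b‖)
    (hip : ∀ i c v w, inner ℂ (Φ i c v) (Φ i c w) = inner ℂ v (Φ i ((𝒜.alg B).ip c c) w))
    (hY : ∀ (t : S) (i : I), ∃ (j : I) (Y : 𝒜.fibre t ⊗[ℂ] B →ₗ[ℂ] (E i →L[ℂ] E j)),
      (∀ x y v w, inner ℂ (Y x v) (Y y w) = inner ℂ v (Φ i ((𝒜.alg B).ip x y) w)) ∧
      ∀ c x v, Y ((𝒜.alg B).lact c x) v = Φ j c (Y x v)) :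
    𝒜.IsBundleNorm B fun c => ⨆ i, ‖Φ i c‖ := by
  have hbdd : ∀ c, BddAbove (Set.range fun i => ‖Φ i c‖) := fun c => by
    obtain ⟨n, a, b, rfl⟩ := TensorProduct.exists_sum_tmul_eq c
    refine ⟨∑ k, ‖a k‖ * ‖b k‖, ?_⟩
    rintro _ ⟨i, rfl⟩
    simp only [map_sum]
    exact norm_sum_le_of_le _ fun k _ => hΦ i _ _
  have hle : ∀ i c, ‖Φ i c‖ ≤ ⨆ i, ‖Φ i c‖ := fun i c => le_ciSup (hbdd c) i
  have hnn : ∀ c, 0 ≤ ⨆ i, ‖Φ i c‖ := fun c => Real.iSup_nonneg fun i => norm_nonneg _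
  refine ⟨hnn, fun s x y => ?_, fun s z x => ?_, fun s t x y => ?_, fun c => ?_, fun c b => ?_⟩
  · refine Real.sqrt_le_left (by positivity) |>.mpr (Real.iSup_le (fun i => ?_) (by positivity))
    obtain ⟨j, Y, hY1, -⟩ := hY s i
    have h : ∀ x, ‖Y x‖ ≤ √(⨆ i, ‖Φ i ((𝒜.alg B).ip x x)‖) := fun x => by
      refine Real.le_sqrt_of_sq_le ?_
      rw [← norm_eq_sq_of_inner (Y x) _ (hY1 x x)]
      exact hle i _
    rw [norm_eq_sq_of_inner (Y (x + y)) _ (hY1 _ _), map_add]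
    gcongr
    exact (norm_add_le _ _).trans (add_le_add (h x) (h y))
  · have e : (𝒜.alg B).ip (z • x) (z • x) = (conj z * z) • (𝒜.alg B).ip x x := by
      rw [AlgBundle.ip_smul_left, AlgBundle.ip_smul_right, smul_smul]
    simp only [e, map_smul, norm_smul, norm_mul, RCLike.norm_conj]
    rw [← Real.mul_iSup_of_nonneg (by positivity), sq]
  · refine Real.iSup_le (fun i => ?_) (mul_nonneg (hnn _) (hnn _))
    obtain ⟨j, Y, hY1, hY2⟩ := hY t i
    have h1 : ‖Φ i ((𝒜.alg B).ip y ((𝒜.alg B).lact ((𝒜.alg B).ip x x) y))‖ ≤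
        ‖Y y‖ ^ 2 * ‖Φ j ((𝒜.alg B).ip x x)‖ := by
      obtain ⟨k, Z, hZ1, hZ2⟩ := hY s j
      rw [norm_eq_sq_of_inner ((Z x).comp (Y y)) _ fun v w => ?_,
        norm_eq_sq_of_inner (Z x) _ (hZ1 x x), ← mul_pow, mul_comm]
      · gcongr
        exact ContinuousLinearMap.opNorm_comp_le _ _
      · rw [← hY1, hY2, ← hZ1]; rfl
    rw [AlgBundle.ip_mul]
    refine h1.trans ?_
    rw [← norm_eq_sq_of_inner (Y y) _ (hY1 y y), mul_comm]
    exact mul_le_mul (hle _ _) (hle _ _) (norm_nonneg _) (hnn _)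
  · have h : ∀ i, ‖Φ i ((𝒜.alg B).ip c c)‖ = ‖Φ i c‖ ^ 2 := fun i =>
      norm_eq_sq_of_inner _ _ (hip i c)
    refine le_antisymm (Real.iSup_le (fun i => ?_) (sq_nonneg _)) ?_
    · rw [h]
      exact pow_le_pow_left₀ (norm_nonneg _) (hle i c) 2
    · have h1 : ⨆ i, ‖Φ i c‖ ≤ √(⨆ i, ‖Φ i ((𝒜.alg B).ip c c)‖) :=
        Real.iSup_le (fun i => Real.le_sqrt_of_sq_le (by rw [← h]; exact hle i _)) (by positivity)
      calc _ ≤ √(⨆ i, ‖Φ i ((𝒜.alg B).ip c c)‖) ^ 2 := pow_le_pow_left₀ (hnn _) h1 2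
        _ = _ := Real.sq_sqrt (hnn _)
  · exact Real.iSup_le (fun i => hΦ i c b) (by positivity)

/-- The same conditions, on elementary tensors. -/
theorem FellBundle.IsBundleNorm.of_family_tmul {S : Type u} [InverseMonoid S] {𝒜 : FellBundle S}
    {B : Type u} [NonUnitalCStarAlgebra B] {I : Type*} {E : I → Type*}
    [∀ i, NormedAddCommGroup (E i)] [∀ i, InnerProductSpace ℂ (E i)]
    (Φ : ∀ i, 𝒜.fibre 1 ⊗[ℂ] B →ₗ[ℂ] (E i →L[ℂ] E i))
    (hΦ : ∀ i c b, ‖Φ i (c ⊗ₜ b)‖ ≤ ‖c‖ * ‖b‖)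
    (hip : ∀ i c c' b b' v w, inner ℂ (Φ i (c ⊗ₜ b) v) (Φ i (c' ⊗ₜ b') w) =
      inner ℂ v (Φ i (𝒜.bundle.ip c c' ⊗ₜ (star b * b')) w))
    (hY : ∀ (t : S) (i : I), ∃ (j : I) (Y : 𝒜.fibre t ⊗[ℂ] B →ₗ[ℂ] (E i →L[ℂ] E j)),
      (∀ a a' b b' v w, inner ℂ (Y (a ⊗ₜ b) v) (Y (a' ⊗ₜ b') w) =
        inner ℂ v (Φ i (𝒜.bundle.ip a a' ⊗ₜ (star b * b')) w)) ∧
      ∀ c b a b' v, Y (𝒜.bundle.lact c a ⊗ₜ (b * b')) v = Φ j (c ⊗ₜ b) (Y (a ⊗ₜ b') v)) :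
    𝒜.IsBundleNorm B fun c => ⨆ i, ‖Φ i c‖ := by
  have aux : ∀ (t : S) (i j : I) (Y : 𝒜.fibre t ⊗[ℂ] B →ₗ[ℂ] (E i →L[ℂ] E j)),
      (∀ a a' b b' v w, inner ℂ (Y (a ⊗ₜ b) v) (Y (a' ⊗ₜ b') w) =
        inner ℂ v (Φ i (𝒜.bundle.ip a a' ⊗ₜ (star b * b')) w)) →
      ∀ x y v w, inner ℂ (Y x v) (Y y w) = inner ℂ v (Φ i ((𝒜.alg B).ip x y) w) := by
    intro t i j Y h x y v w
    induction x with
    | zero => simp [AlgBundle.ip, AlgBundle.mulTo]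
    | add x x' hx hx' =>
      rw [AlgBundle.ip_add_left, map_add, map_add, _root_.add_apply, _root_.add_apply,
        inner_add_left, inner_add_right, hx, hx']
    | tmul a b =>
      induction y with
      | zero => simp [AlgBundle.ip, AlgBundle.mulTo]
      | add y y' hy hy' =>
        rw [AlgBundle.ip_add_right, map_add, map_add, _root_.add_apply, _root_.add_apply,
          inner_add_right, inner_add_right, hy, hy']
      | tmul a' b' => rw [h, AlgBundle.tensor_ip_tmul]
  refine of_family Φ hΦ (fun i c v w => aux 1 i i (Φ i) (hip i) c c v w) fun t i => ?_
  obtain ⟨j, Y, h1, h2⟩ := hY t i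
  refine ⟨j, Y, aux t i j Y h1, fun c x v => ?_⟩
  induction c with
  | zero => simp [AlgBundle.lact, AlgBundle.mulTo]
  | add c c' hc hc' =>
    have e : (𝒜.alg B).lact (c + c') x = (𝒜.alg B).lact c x + (𝒜.alg B).lact c' x := by
      simp [AlgBundle.lact, AlgBundle.mulTo]
    rw [e, map_add, map_add, _root_.add_apply, _root_.add_apply, hc, hc']
  | tmul c b =>
    induction x with
    | zero => simp [AlgBundle.lact, AlgBundle.mulTo]
    | add x x' hx hx' =>
      have e : (𝒜.alg B).lact (c ⊗ₜ b) (x + x') =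
          (𝒜.alg B).lact (c ⊗ₜ b) x + (𝒜.alg B).lact (c ⊗ₜ b) x' := by
        simp [AlgBundle.lact, AlgBundle.mulTo]
      rw [e, map_add, map_add, _root_.add_apply, _root_.add_apply, map_add, hx, hx']
    | tmul a b' => rw [AlgBundle.tensor_lact_tmul, h2]

/-- The element `g = ‖c‖ - (‖c‖² - c* c) ^ (1 / 2)`. -/
theorem exists_defect {C : Type*} [NonUnitalCStarAlgebra C] (c : C) :
    ∃ g : C, star g = g ∧ star c * c = (2 * ‖c‖ : ℝ) • g - g * g := by
  let _ := CStarAlgebra.spectralOrder C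
  have := CStarAlgebra.spectralOrderedRing C
  set d := star c * c with hd
  have hd0 : 0 ≤ d := star_mul_self_nonneg c
  have hsa : IsSelfAdjoint d := hd0.isSelfAdjoint
  set f : ℝ → ℝ := fun t => ‖c‖ - √(‖c‖ ^ 2 - t) with hf
  have hfc : Continuous f := by fun_prop
  have hf0 : f 0 = 0 := by simp [hf]
  refine ⟨cfcₙ f d, cfcₙ_predicate f d, ?_⟩
  rw [← cfcₙ_mul f f d, ← cfcₙ_smul (R := ℝ) (2 * ‖c‖) f d, ← cfcₙ_sub ..]
  conv_lhs => rw [← cfcₙ_id' ℝ d]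
  refine cfcₙ_congr fun t ht => ?_
  have ht1 : t ≤ ‖c‖ ^ 2 := by
    have h := NonUnitalIsometricContinuousFunctionalCalculus.norm_quasispectrum_le (𝕜 := ℝ) d ht
    rw [hd, CStarRing.norm_star_mul_self, ← sq] at h
    exact (le_abs_self t).trans h
  have h2 := Real.sq_sqrt (sub_nonneg.mpr ht1)
  simp only [hf, smul_eq_mul]
  nlinarith

/-- A `*`-representation of a `C*`-algebra by linear maps on a semi-inner product space. -/
structure PreRep (C : Type*) [NonUnitalCStarAlgebra C] (X : Type*) [SeminormedAddCommGroup X]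
    [InnerProductSpace ℂ X] where
  θ : C →ₗ[ℂ] (X →ₗ[ℂ] X)
  map_mul : ∀ c d x, θ (c * d) x = θ c (θ d x)
  map_star : ∀ c x y, inner ℂ (θ c x) y = inner ℂ x (θ (star c) y)

namespace PreRep

open UniformSpace Completion ContinuousLinearMap

variable {C : Type*} [NonUnitalCStarAlgebra C] {X : Type*} [SeminormedAddCommGroup X]
  [InnerProductSpace ℂ X] (r : PreRep C X)

theorem norm_le (c : C) (x : X) : ‖r.θ c x‖ ≤ ‖c‖ * ‖x‖ := by
  obtain ⟨g, hg, h⟩ := exists_defect c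
  refine le_of_sq_le_sq ?_ (by positivity)
  have h1 : ‖r.θ c x‖ ^ 2 = (inner ℂ x (r.θ (star c * c) x)).re := by
    rw [r.map_mul, ← r.map_star]
    exact (inner_self_eq_norm_sq (𝕜 := ℂ) _).symm
  have h2 : ‖r.θ g x‖ ^ 2 = (inner ℂ x (r.θ (g * g) x)).re := by
    conv_rhs => rw [r.map_mul, ← hg, ← r.map_star, hg]
    exact (inner_self_eq_norm_sq (𝕜 := ℂ) _).symm
  have h3 : r.θ (star c * c) x = (2 * ‖c‖ : ℝ) • r.θ g x - r.θ (g * g) x := by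
    rw [h, map_sub, LinearMap.sub_apply, LinearMap.map_smul_of_tower, LinearMap.smul_apply]
  have h4 : ‖(‖c‖ : ℂ) • x - r.θ g x‖ ^ 2 =
      ‖c‖ ^ 2 * ‖x‖ ^ 2 - 2 * ‖c‖ * (inner ℂ x (r.θ g x)).re + ‖r.θ g x‖ ^ 2 := by
    rw [norm_sub_sq (𝕜 := ℂ), norm_smul, inner_smul_left]
    simp
    ring
  have h5 : (inner ℂ x ((2 * ‖c‖ : ℝ) • r.θ g x)).re = 2 * ‖c‖ * (inner ℂ x (r.θ g x)).re := by
    rw [RCLike.real_smul_eq_coe_smul (K := ℂ), inner_smul_right]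
    simp
  rw [h1, h3, inner_sub_right, Complex.sub_re, h5]
  nlinarith [sq_nonneg ‖(‖c‖ : ℂ) • x - r.θ g x‖]

/-- The operators of the representation as bounded operators. -/
def op (c : C) : X →L[ℂ] X := (r.θ c).mkContinuous ‖c‖ (r.norm_le c)

theorem op_apply (c : C) (x : X) : r.op c x = r.θ c x := rfl

theorem op_completion_coe (c : C) (x : X) :
    (r.op c).completion (x : Completion X) = (r.θ c x : Completion X) := by
  rw [ContinuousLinearMap.completion_apply_coe, op_apply]

/-- The operators of the representation on the completion. -/
def extOp (c : C) : Completion X →L[ℂ] Completion X := (r.op c).completion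

theorem extOp_coe (c : C) (x : X) : r.extOp c (x : Completion X) = (r.θ c x : Completion X) :=
  r.op_completion_coe c x

theorem extOp_smul (z : ℂ) (c : C) : r.extOp (z • c) = z • r.extOp c := by
  ext x
  rw [_root_.smul_apply]
  induction x using induction_on with
  | hp => exact isClosed_eq (map_continuous _) ((map_continuous (r.extOp c)).const_smul z)
  | ih x => rw [extOp_coe, extOp_coe, map_smul, LinearMap.smul_apply, Completion.coe_smul]

theorem extOp_add (c d : C) : r.extOp (c + d) = r.extOp c + r.extOp d := by
  ext x
  rw [_root_.add_apply]
  induction x using induction_on with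
  | hp =>
    exact isClosed_eq (map_continuous _)
      ((map_continuous (r.extOp c)).add (map_continuous (r.extOp d)))
  | ih x => rw [extOp_coe, extOp_coe, extOp_coe, map_add, LinearMap.add_apply, Completion.coe_add]

theorem extOp_mul (c d : C) : r.extOp (c * d) = r.extOp c * r.extOp d := by
  ext x
  rw [mul_apply_eq_comp]
  induction x using induction_on with
  | hp =>
    exact isClosed_eq (map_continuous _)
      ((map_continuous (r.extOp c)).comp (map_continuous (r.extOp d)))
  | ih x => rw [extOp_coe, extOp_coe, extOp_coe, r.map_mul]

theorem extOp_star (c : C) : r.extOp (star c) = star (r.extOp c) := by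
  rw [star_eq_adjoint, eq_adjoint_iff]
  intro x y
  induction x, y using induction_on₂ with
  | hp => exact isClosed_eq (((map_continuous (r.extOp (star c))).comp continuous_fst).inner
      continuous_snd) (continuous_fst.inner ((map_continuous (r.extOp c)).comp continuous_snd))
  | ih x y =>
    rw [extOp_coe, extOp_coe, Completion.inner_coe, Completion.inner_coe, r.map_star, star_star]

/-- The extension to the Hilbert space completion. -/
def ext : C →⋆ₙₐ[ℂ] (Completion X →L[ℂ] Completion X) where
  toFun := r.extOp
  map_smul' := r.extOp_smul
  map_zero' := by simpa using r.extOp_smul 0 0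
  map_add' := r.extOp_add
  map_mul' := r.extOp_mul
  map_star' := r.extOp_star

theorem ext_coe (c : C) (x : X) : r.ext c (x : Completion X) = (r.θ c x : Completion X) :=
  r.extOp_coe c x

end PreRep

namespace FellBundle

section Induced

variable {S : Type u} [InverseMonoid S] {𝒜 : FellBundle S} {H : Type u} [NormedAddCommGroup H]
  [InnerProductSpace ℂ H] [CompleteSpace H]

theorem inner_rep {C : Type*} [NonUnitalCStarAlgebra C] (π : C →⋆ₙₐ[ℂ] (H →L[ℂ] H)) (c : C)
    (v w : H) : inner ℂ (π c v) w = inner ℂ v (π (star c) w) := by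
  rw [map_star, ContinuousLinearMap.star_eq_adjoint, ContinuousLinearMap.adjoint_inner_right]

variable (π : 𝒜.fibre 1 →⋆ₙₐ[ℂ] (H →L[ℂ] H))

/-- The algebraic tensor product `A t ⊗ H`, on which a semi-inner product is defined from a
representation of the unit fibre on `H`. -/
@[nolint unusedArguments]
def IndPre (_ : 𝒜.fibre 1 →⋆ₙₐ[ℂ] (H →L[ℂ] H)) (t : S) : Type u := 𝒜.fibre t ⊗[ℂ] H

namespace IndPre

instance (t : S) : AddCommGroup (IndPre π t) := inferInstanceAs (AddCommGroup (𝒜.fibre t ⊗[ℂ] H))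

instance (t : S) : Module ℂ (IndPre π t) := inferInstanceAs (Module ℂ (𝒜.fibre t ⊗[ℂ] H))

/-- Elementary tensors. -/
def tm {t : S} : 𝒜.fibre t →ₗ[ℂ] H →ₗ[ℂ] IndPre π t := TensorProduct.mk ℂ _ _

theorem exists_sum_tm {t : S} (x : IndPre π t) :
    ∃ (n : ℕ) (a : Fin n → 𝒜.fibre t) (v : Fin n → H), x = ∑ i, tm π (a i) (v i) :=
  TensorProduct.exists_sum_tmul_eq (M := 𝒜.fibre t) (N := H) x

/-- The map `a' ⊗ v' ↦ π (a* a') v'`. -/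
def act {t : S} (a : 𝒜.fibre t) : IndPre π t →ₗ[ℂ] H :=
  TensorProduct.lift (LinearMap.mk₂ ℂ (fun (a' : 𝒜.fibre t) v' => π (𝒜.bundle.ip a a') v')
    (by simp [AlgBundle.ip_add_right]) (by simp [AlgBundle.ip_smul_right]) (by simp) (by simp))

theorem act_tm {t : S} (a a' : 𝒜.fibre t) (v : H) :
    act π a (tm π a' v) = π (𝒜.bundle.ip a a') v := rfl

theorem act_add {t : S} (a a' : 𝒜.fibre t) (x : IndPre π t) :
    act π (a + a') x = act π a x + act π a' x := by
  obtain ⟨n, b, v, rfl⟩ := exists_sum_tm π x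
  simp [act_tm, AlgBundle.ip_add_left, Finset.sum_add_distrib]

theorem act_smul {t : S} (z : ℂ) (a : 𝒜.fibre t) (x : IndPre π t) :
    act π (z • a) x = conj z • act π a x := by
  obtain ⟨n, b, v, rfl⟩ := exists_sum_tm π x
  simp [act_tm, AlgBundle.ip_smul_left, Finset.smul_sum]

/-- The sesquilinear form `⟨a ⊗ v, a' ⊗ v'⟩ = ⟨v, π (a* a') v'⟩`. -/
def form {t : S} (y : IndPre π t) : IndPre π t →ₗ⋆[ℂ] ℂ :=
  TensorProduct.lift (LinearMap.mk₂'ₛₗ (starRingEnd ℂ) (starRingEnd ℂ)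
    (fun (a : 𝒜.fibre t) (v : H) => inner ℂ v (act π a y))
    (fun a a' v => by rw [act_add, inner_add_right])
    (fun z a v => by rw [act_smul, inner_smul_right]; rfl)
    (fun a v v' => inner_add_left _ _ _)
    (fun z a v => inner_smul_left _ _ _))

theorem form_tm {t : S} (y : IndPre π t) (a : 𝒜.fibre t) (v : H) :
    form π y (tm π a v) = inner ℂ v (act π a y) := rfl

theorem form_sum_sum {t : S} {n : ℕ} (a : Fin n → 𝒜.fibre t) (v : Fin n → H) {m : ℕ}
    (a' : Fin m → 𝒜.fibre t) (v' : Fin m → H) :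
    form π (∑ j, tm π (a' j) (v' j)) (∑ i, tm π (a i) (v i)) =
      ∑ i, ∑ j, inner ℂ (v i) (π (𝒜.bundle.ip (a i) (a' j)) (v' j)) := by
  simp [form_tm, act_tm]

theorem form_symm {t : S} (x y : IndPre π t) : conj (form π x y) = form π y x := by
  obtain ⟨n, a, v, rfl⟩ := exists_sum_tm π x
  obtain ⟨m, a', v', rfl⟩ := exists_sum_tm π y
  rw [form_sum_sum, form_sum_sum, Finset.sum_comm]
  simp only [map_sum]
  refine Finset.sum_congr rfl fun i _ => Finset.sum_congr rfl fun j _ => ?_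
  rw [inner_conj_symm, inner_rep, star_def, 𝒜.bundle.starOne_ip]

theorem form_nonneg {t : S} (x : IndPre π t) : 0 ≤ (form π x x).re := by
  obtain ⟨n, a, v, rfl⟩ := exists_sum_tm π x
  set M : ℝ := ∑ i, ∑ j, ‖v i‖ * (‖a i‖ * ‖v j‖) with hM
  have hM0 : 0 ≤ M := by positivity
  refine le_of_forall_pos_le_add fun ε hε => ?_
  obtain ⟨w, u, -, hwa, hw⟩ := 𝒜.exists_factorization a (δ := ε / (M + 1)) (by positivity)
  have h : ∀ k i j, inner ℂ (π (𝒜.bundle.ip (u k) (a i)) (v i))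
      (π (𝒜.bundle.ip (u k) (a j)) (v j)) = inner ℂ (v i)
        (π (𝒜.bundle.ip (𝒜.bundle.ip (u k) (a i)) (𝒜.bundle.ip (u k) (a j))) (v j)) := by
    intro k i j
    rw [inner_rep, 𝒜.bundle.ip_eq_mulOne, ← star_def, ← mul_def, map_mul]
    rfl
  have e : ∑ k, inner ℂ (∑ i, π (𝒜.bundle.ip (u k) (a i)) (v i))
      (∑ i, π (𝒜.bundle.ip (u k) (a i)) (v i)) =
      ∑ i, ∑ j, inner ℂ (v i) (π (𝒜.bundle.ip (a i) (𝒜.bundle.lact w (a j))) (v j)) := by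
    refine (Finset.sum_congr rfl fun k _ => (sum_inner _ _ _).trans
      (Finset.sum_congr rfl fun i _ => inner_sum _ _ _)).trans ?_
    simp only [hw, map_sum, _root_.sum_apply, h]
    rw [Finset.sum_comm]
    refine Finset.sum_congr rfl fun i _ => ?_
    rw [Finset.sum_comm]
    exact Finset.sum_congr rfl fun j _ => (inner_sum _ _ _).symm
  have hre : 0 ≤ (∑ k, inner ℂ (∑ i, π (𝒜.bundle.ip (u k) (a i)) (v i))
      (∑ i, π (𝒜.bundle.ip (u k) (a i)) (v i))).re := by
    rw [Complex.re_sum]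
    exact Finset.sum_nonneg fun k _ => inner_self_nonneg (𝕜 := ℂ)
  have hd : ‖(∑ i, ∑ j, inner ℂ (v i) (π (𝒜.bundle.ip (a i)
      (𝒜.bundle.lact w (a j))) (v j))) - form π (∑ i, tm π (a i) (v i)) (∑ i, tm π (a i) (v i))‖ ≤
      ε := by
    rw [form_sum_sum, ← Finset.sum_sub_distrib]
    simp only [← Finset.sum_sub_distrib]
    calc _ ≤ ∑ i, ∑ j, ‖v i‖ * (‖a i‖ * ‖v j‖) * (ε / (M + 1)) := by
          refine norm_sum_le_of_le _ fun i _ => norm_sum_le_of_le _ fun j _ => ?_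
          have e2 : 𝒜.bundle.ip (a i) (𝒜.bundle.lact w (a j)) - 𝒜.bundle.ip (a i) (a j) =
              𝒜.bundle.ip (a i) (𝒜.bundle.lact w (a j) - a j) := by
            simp [AlgBundle.ip, AlgBundle.mulTo]
          rw [← inner_sub_right, ← _root_.sub_apply, ← map_sub, e2]
          have h1 : ‖𝒜.bundle.ip (a i) (𝒜.bundle.lact w (a j) - a j)‖ ≤
              ‖a i‖ * (ε / (M + 1)) := by
            refine (𝒜.bundle.norm_mulTo_le _ _ _).trans ?_
            rw [𝒜.bundle.norm_star, norm_sub_rev]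
            gcongr
            exact hwa j
          calc _ ≤ ‖v i‖ * (‖π (𝒜.bundle.ip (a i) (𝒜.bundle.lact w (a j) - a j))‖ * ‖v j‖) :=
                (norm_inner_le_norm _ _).trans
                  (mul_le_mul_of_nonneg_left (ContinuousLinearMap.le_opNorm _ _) (norm_nonneg _))
            _ ≤ ‖v i‖ * (‖a i‖ * (ε / (M + 1)) * ‖v j‖) := by
                gcongr
                exact (NonUnitalStarAlgHom.norm_apply_le π _).trans h1
            _ = _ := by ring
      _ = M * (ε / (M + 1)) := by simp only [hM, Finset.sum_mul]
      _ ≤ ε := by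
          rw [← mul_div_assoc, div_le_iff₀ (by positivity)]
          nlinarith
  rw [e] at hre
  have h2 := (Complex.re_le_norm _).trans hd
  rw [Complex.sub_re] at h2
  linarith

/-- The semi-inner product on `A t ⊗ H`. -/
abbrev core (t : S) : PreInnerProductSpace.Core ℂ (IndPre π t) where
  inner x y := form π y x
  conj_inner_symm x y := form_symm π x y
  re_inner_nonneg x := form_nonneg π x
  add_left _ _ z := map_add (form π z) _ _
  smul_left x y r := (form π y).map_smulₛₗ r x

instance (t : S) : SeminormedAddCommGroup (IndPre π t) :=
  InnerProductSpace.Core.toSeminormedAddCommGroup (c := core π t)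

instance (t : S) : InnerProductSpace ℂ (IndPre π t) := InnerProductSpace.ofCore (core π t)

theorem inner_eq {t : S} (x y : IndPre π t) : inner ℂ x y = form π y x := rfl

end IndPre
end Induced
end FellBundle

namespace FellBundle.IndPre

variable {S : Type u} [InverseMonoid S] {𝒜 : FellBundle S} {H : Type u} [NormedAddCommGroup H]
  [InnerProductSpace ℂ H] [CompleteSpace H] (π : 𝒜.fibre 1 →⋆ₙₐ[ℂ] (H →L[ℂ] H))

theorem inner_sum_sum {t : S} {n : ℕ} (a : Fin n → 𝒜.fibre t) (v : Fin n → H) {m : ℕ}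
    (a' : Fin m → 𝒜.fibre t) (v' : Fin m → H) :
    inner ℂ (∑ i, tm π (a i) (v i)) (∑ j, tm π (a' j) (v' j)) =
      ∑ i, ∑ j, inner ℂ (v i) (π (𝒜.bundle.ip (a i) (a' j)) (v' j)) :=
  form_sum_sum π a v a' v'

/-- The left action of the unit fibre on `A t ⊗ H`, as a bilinear map. -/
def leftMap (t : S) : 𝒜.fibre 1 →ₗ[ℂ] IndPre π t →ₗ[ℂ] IndPre π t :=
  LinearMap.mk₂ ℂ
    (fun c (x : IndPre π t) => TensorProduct.map
      (𝒜.bundle.incl (le_of_eq (one_mul t)) ∘ₗ 𝒜.bundle.mul 1 t c) LinearMap.id x)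
    (fun c c' x => by
      rw [map_add, LinearMap.comp_add, TensorProduct.map_add_left]; rfl)
    (fun z c x => by
      rw [map_smul, LinearMap.comp_smul, TensorProduct.map_smul_left]; rfl)
    (fun c x x' => map_add _ _ _) (fun z c x => map_smul _ _ _)

theorem leftMap_tm {t : S} (c : 𝒜.fibre 1) (a : 𝒜.fibre t) (v : H) :
    leftMap π t c (tm π a v) = tm π (𝒜.bundle.lact c a) v := rfl

/-- The left action of the unit fibre on `A t ⊗ H`. -/
def leftRep (t : S) : PreRep (𝒜.fibre 1) (IndPre π t) where
  θ := leftMap π t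
  map_mul c d x := by
    obtain ⟨n, a, v, rfl⟩ := exists_sum_tm π x
    simp only [map_sum, leftMap_tm, 𝒜.bundle.lact_lact, mul_def]
  map_star c x y := by
    obtain ⟨n, a, v, rfl⟩ := exists_sum_tm π x
    obtain ⟨m, a', v', rfl⟩ := exists_sum_tm π y
    simp only [map_sum, leftMap_tm, inner_sum_sum, 𝒜.bundle.ip_lact, star_def]

section Right

variable {B : Type u} [NonUnitalCStarAlgebra B] (ρ : B →⋆ₙₐ[ℂ] (H →L[ℂ] H))

/-- The operators `1 ⊗ ρ b` on `A t ⊗ H`, as a bilinear map. -/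
def rightMap (t : S) : B →ₗ[ℂ] IndPre π t →ₗ[ℂ] IndPre π t :=
  LinearMap.mk₂ ℂ
    (fun b (x : IndPre π t) => TensorProduct.map LinearMap.id (ρ b).toLinearMap x)
    (fun b b' x => by
      rw [map_add, ContinuousLinearMap.toLinearMap_add, TensorProduct.map_add_right]; rfl)
    (fun z b x => by
      rw [map_smul, ContinuousLinearMap.toLinearMap_smul, TensorProduct.map_smul_right]; rfl)
    (fun c x x' => map_add _ _ _) (fun z c x => map_smul _ _ _)

theorem rightMap_tm {t : S} (b : B) (a : 𝒜.fibre t) (v : H) :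
    rightMap π ρ t b (tm π a v) = tm π a (ρ b v) := rfl

/-- The representation `b ↦ 1 ⊗ ρ b` on `A t ⊗ H`. -/
def rightRep (h : ∀ c b, π c * ρ b = ρ b * π c) (t : S) : PreRep B (IndPre π t) where
  θ := rightMap π ρ t
  map_mul c d x := by
    obtain ⟨n, a, v, rfl⟩ := exists_sum_tm π x
    simp only [map_sum, rightMap_tm, map_mul, mul_apply_eq_comp]
  map_star b x y := by
    obtain ⟨n, a, v, rfl⟩ := exists_sum_tm π x
    obtain ⟨m, a', v', rfl⟩ := exists_sum_tm π y
    simp only [map_sum, rightMap_tm, inner_sum_sum, inner_rep, ← mul_apply_eq_comp, h]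

theorem ext_commute (h : ∀ c b, π c * ρ b = ρ b * π c) (t : S) (c : 𝒜.fibre 1) (b : B) :
    (leftRep π t).ext c * (rightRep π ρ h t).ext b =
      (rightRep π ρ h t).ext b * (leftRep π t).ext c := by
  ext x
  rw [mul_apply_eq_comp, mul_apply_eq_comp]
  induction x using UniformSpace.Completion.induction_on with
  | hp =>
    exact isClosed_eq
      ((map_continuous ((leftRep π t).ext c)).comp (map_continuous ((rightRep π ρ h t).ext b)))
      ((map_continuous ((rightRep π ρ h t).ext b)).comp (map_continuous ((leftRep π t).ext c)))
  | ih x =>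
    rw [PreRep.ext_coe, PreRep.ext_coe, PreRep.ext_coe, PreRep.ext_coe]
    congr 1
    obtain ⟨n, a, v, rfl⟩ := exists_sum_tm π x
    change leftMap π t c (rightMap π ρ t b _) = rightMap π ρ t b (leftMap π t c _)
    simp only [map_sum, leftMap_tm, rightMap_tm]

end Right

/-- The norm of an elementary tensor. -/
theorem norm_tm_le {t : S} (a : 𝒜.fibre t) (v : H) : ‖tm π a v‖ ≤ ‖a‖ * ‖v‖ := by
  refine le_of_sq_le_sq ?_ (by positivity)
  rw [← inner_self_eq_norm_sq (𝕜 := ℂ)]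
  change (inner ℂ v (π (𝒜.bundle.ip a a) v)).re ≤ _
  calc _ ≤ ‖v‖ * (‖π (𝒜.bundle.ip a a)‖ * ‖v‖) :=
        (Complex.re_le_norm _).trans ((norm_inner_le_norm _ _).trans
          (mul_le_mul_of_nonneg_left (ContinuousLinearMap.le_opNorm _ _) (norm_nonneg _)))
    _ ≤ ‖v‖ * (‖a‖ ^ 2 * ‖v‖) := by
        gcongr
        rw [← 𝒜.bundle.norm_ip_self]
        exact NonUnitalStarAlgHom.norm_apply_le π _
    _ = _ := by ring

/-- The creation operators `v ↦ a ⊗ v`. -/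
def create (t : S) : 𝒜.fibre t →ₗ[ℂ] (H →L[ℂ] UniformSpace.Completion (IndPre π t)) where
  toFun a := UniformSpace.Completion.toComplL.comp
    ((tm π a).mkContinuous ‖a‖ (norm_tm_le π a))
  map_add' a a' := by
    ext v
    change ((tm π (a + a') v : IndPre π t) : UniformSpace.Completion (IndPre π t)) =
      (tm π a v : IndPre π t) + (tm π a' v : IndPre π t)
    rw [map_add, LinearMap.add_apply, UniformSpace.Completion.coe_add]
  map_smul' z a := by
    ext v
    change ((tm π (z • a) v : IndPre π t) : UniformSpace.Completion (IndPre π t)) =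
      z • ((tm π a v : IndPre π t) : UniformSpace.Completion (IndPre π t))
    rw [map_smul, LinearMap.smul_apply, UniformSpace.Completion.coe_smul]

theorem create_apply {t : S} (a : 𝒜.fibre t) (v : H) :
    create π t a v = ((tm π a v : IndPre π t) : UniformSpace.Completion (IndPre π t)) := rfl

theorem inner_create {t : S} (a a' : 𝒜.fibre t) (v v' : H) :
    inner ℂ (create π t a v) (create π t a' v') = inner ℂ v (π (𝒜.bundle.ip a a') v') := by
  rw [create_apply, create_apply, UniformSpace.Completion.inner_coe]
  rfl

theorem ext_create {t : S} (c : 𝒜.fibre 1) (a : 𝒜.fibre t) (v : H) :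
    (leftRep π t).ext c (create π t a v) = create π t (𝒜.bundle.lact c a) v := by
  rw [create_apply, PreRep.ext_coe]
  rfl

theorem ext_right_create {B : Type u} [NonUnitalCStarAlgebra B] (ρ : B →⋆ₙₐ[ℂ] (H →L[ℂ] H))
    (h : ∀ c b, π c * ρ b = ρ b * π c) {t : S} (b : B) (a : 𝒜.fibre t) (v : H) :
    (rightRep π ρ h t).ext b (create π t a v) = create π t a (ρ b v) := by
  rw [create_apply, PreRep.ext_coe]
  rfl

end FellBundle.IndPre

section TensorNorms

variable (A B : Type u) [NonUnitalCStarAlgebra A] [NonUnitalCStarAlgebra B]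

/-- A pair of commuting representations of two `C*`-algebras on one Hilbert space. -/
structure CommRep where
  H : Type u
  [normed : NormedAddCommGroup H]
  [inner : InnerProductSpace ℂ H]
  [complete : CompleteSpace H]
  π : A →⋆ₙₐ[ℂ] (H →L[ℂ] H)
  ρ : B →⋆ₙₐ[ℂ] (H →L[ℂ] H)
  comm : ∀ a b, π a * ρ b = ρ b * π a

/-- A pair of representations of two `C*`-algebras on two Hilbert spaces. -/
structure PairRep where
  H : Type u
  K : Type u
  [normedH : NormedAddCommGroup H]
  [innerH : InnerProductSpace ℂ H]
  [completeH : CompleteSpace H]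
  [normedK : NormedAddCommGroup K]
  [innerK : InnerProductSpace ℂ K]
  [completeK : CompleteSpace K]
  π : A →⋆ₙₐ[ℂ] (H →L[ℂ] H)
  ρ : B →⋆ₙₐ[ℂ] (K →L[ℂ] K)

variable {A B}

namespace CommRep

instance (r : CommRep A B) : NormedAddCommGroup r.H := r.normed
instance (r : CommRep A B) : InnerProductSpace ℂ r.H := r.inner
instance (r : CommRep A B) : CompleteSpace r.H := r.complete

/-- The representation `a ⊗ b ↦ π a ρ b` of the algebraic tensor product. -/
def prodMap (r : CommRep A B) : A ⊗[ℂ] B →ₗ[ℂ] (r.H →L[ℂ] r.H) :=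
  TensorProduct.lift (LinearMap.mk₂ ℂ (fun a b => r.π a * r.ρ b)
    (by simp [add_mul]) (by simp) (by simp [mul_add]) (by simp))

end CommRep

namespace PairRep

instance (r : PairRep A B) : NormedAddCommGroup r.H := r.normedH
instance (r : PairRep A B) : InnerProductSpace ℂ r.H := r.innerH
instance (r : PairRep A B) : CompleteSpace r.H := r.completeH
instance (r : PairRep A B) : NormedAddCommGroup r.K := r.normedK
instance (r : PairRep A B) : InnerProductSpace ℂ r.K := r.innerK
instance (r : PairRep A B) : CompleteSpace r.K := r.completeK

/-- The representation `a ⊗ b ↦ π a ⊗ ρ b` of the algebraic tensor product, by bounded operators on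
the (not completed) inner product space `H ⊗ K`. -/
def prodMap (r : PairRep A B) : A ⊗[ℂ] B →ₗ[ℂ] (r.H ⊗[ℂ] r.K →L[ℂ] r.H ⊗[ℂ] r.K) :=
  TensorProduct.lift (LinearMap.mk₂ ℂ (fun a b => TensorProduct.mapL (r.π a) (r.ρ b))
    (by simp [TensorProduct.mapL_add_left]) (by simp [TensorProduct.mapL_smul_left])
    (by simp [TensorProduct.mapL_add_right]) (by simp [TensorProduct.mapL_smul_right]))

end PairRep

/-- The maximal `C*`-norm on the algebraic tensor product of two `C*`-algebras: the supremum of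
`‖∑ π (aᵢ) ρ (bᵢ)‖` over all pairs of commuting representations. -/
def maxTensorNorm (x : A ⊗[ℂ] B) : ℝ := ⨆ r : CommRep A B, ‖r.prodMap x‖

/-- The minimal (spatial) `C*`-norm on the algebraic tensor product of two `C*`-algebras: the
supremum of `‖∑ π (aᵢ) ⊗ ρ (bᵢ)‖` over all pairs of representations. -/
def minTensorNorm (x : A ⊗[ℂ] B) : ℝ := ⨆ r : PairRep A B, ‖r.prodMap x‖

end TensorNorms

namespace FellBundle

variable {S : Type u} [InverseMonoid S] {𝒜 : FellBundle S} {B : Type u} [NonUnitalCStarAlgebra B]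

theorem prodMap_comm_tmul (r : CommRep (𝒜.fibre 1) B) (c : 𝒜.fibre 1) (b : B) (v : r.H) :
    r.prodMap (c ⊗ₜ b) v = r.π c (r.ρ b v) := rfl

theorem prodMap_pair_tmul (r : PairRep (𝒜.fibre 1) B) (c : 𝒜.fibre 1) (b : B) :
    r.prodMap (c ⊗ₜ b) = TensorProduct.mapL (r.π c) (r.ρ b) := rfl

/-- The pair of commuting representations induced by the fibre at `t`. -/
def indComm (r : CommRep (𝒜.fibre 1) B) (t : S) : CommRep (𝒜.fibre 1) B where
  H := UniformSpace.Completion (IndPre r.π t)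
  π := (IndPre.leftRep r.π t).ext
  ρ := (IndPre.rightRep r.π r.ρ r.comm t).ext
  comm := IndPre.ext_commute r.π r.ρ r.comm t

/-- The pair of representations induced by the fibre at `t`. -/
def indPair (r : PairRep (𝒜.fibre 1) B) (t : S) : PairRep (𝒜.fibre 1) B where
  H := UniformSpace.Completion (IndPre r.π t)
  K := r.K
  π := (IndPre.leftRep r.π t).ext
  ρ := r.ρ

/-- The operators `v ↦ a ⊗ ρ b v`. -/
def createComm (r : CommRep (𝒜.fibre 1) B) (t : S) :
    𝒜.fibre t ⊗[ℂ] B →ₗ[ℂ] (r.H →L[ℂ] UniformSpace.Completion (IndPre r.π t)) :=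
  TensorProduct.lift (LinearMap.mk₂ ℂ (fun a b => (IndPre.create r.π t a).comp (r.ρ b))
    (fun a a' b => by rw [map_add, ContinuousLinearMap.add_comp])
    (fun z a b => by rw [map_smul, ContinuousLinearMap.smul_comp])
    (fun a b b' => by rw [map_add, ContinuousLinearMap.comp_add])
    (fun z a b => by rw [map_smul, ContinuousLinearMap.comp_smul]))

theorem createComm_tmul (r : CommRep (𝒜.fibre 1) B) (t : S) (a : 𝒜.fibre t) (b : B) (v : r.H) :
    createComm r t (a ⊗ₜ b) v = IndPre.create r.π t a (r.ρ b v) := rfl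

/-- The operators `v ⊗ w ↦ (a ⊗ v) ⊗ ρ b w`. -/
def createPair (r : PairRep (𝒜.fibre 1) B) (t : S) : 𝒜.fibre t ⊗[ℂ] B →ₗ[ℂ]
    (r.H ⊗[ℂ] r.K →L[ℂ] UniformSpace.Completion (IndPre r.π t) ⊗[ℂ] r.K) :=
  TensorProduct.lift (LinearMap.mk₂ ℂ
    (fun a b => TensorProduct.mapL (IndPre.create r.π t a) (r.ρ b))
    (fun a a' b => by rw [map_add, TensorProduct.mapL_add_left])
    (fun z a b => by rw [map_smul, TensorProduct.mapL_smul_left])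
    (fun a b b' => by rw [map_add, TensorProduct.mapL_add_right])
    (fun z a b => by rw [map_smul, TensorProduct.mapL_smul_right]))

theorem createPair_tmul (r : PairRep (𝒜.fibre 1) B) (t : S) (a : 𝒜.fibre t) (b : B) :
    createPair r t (a ⊗ₜ b) = TensorProduct.mapL (IndPre.create r.π t a) (r.ρ b) := rfl

theorem ip_eq (c d : 𝒜.fibre 1) : 𝒜.bundle.ip c d = star c * d := 𝒜.bundle.ip_eq_mulOne c d

theorem comm_apply (r : CommRep (𝒜.fibre 1) B) (c : 𝒜.fibre 1) (b : B) (v : r.H) :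
    r.ρ b (r.π c v) = r.π c (r.ρ b v) := (DFunLike.congr_fun (r.comm c b) v).symm

theorem inner_comm_one (r : CommRep (𝒜.fibre 1) B) (c c' : 𝒜.fibre 1) (b b' : B) (v w : r.H) :
    inner ℂ (r.prodMap (c ⊗ₜ b) v) (r.prodMap (c' ⊗ₜ b') w) =
      inner ℂ v (r.prodMap (𝒜.bundle.ip c c' ⊗ₜ (star b * b')) w) := by
  simp only [prodMap_comm_tmul, inner_rep, ip_eq, map_mul, mul_apply_eq_comp, comm_apply]

theorem isBundleNorm_max :
    𝒜.IsBundleNorm B (maxTensorNorm (A := 𝒜.fibre 1) (B := B)) := by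
  refine IsBundleNorm.of_family_tmul (fun r : CommRep (𝒜.fibre 1) B => r.prodMap) (fun r c b => ?_)
    inner_comm_one fun t r => ⟨indComm r t, createComm r t, ?_, ?_⟩
  · refine (norm_mul_le (r.π c) (r.ρ b)).trans ?_
    gcongr <;> exact NonUnitalStarAlgHom.norm_apply_le _ _
  · intro a a' b b' v w
    have h : inner ℂ (createComm r t (a ⊗ₜ b) v) (createComm r t (a' ⊗ₜ b') w) =
        inner ℂ v (r.prodMap (𝒜.bundle.ip a a' ⊗ₜ (star b * b')) w) := by
      simp only [prodMap_comm_tmul, createComm_tmul, IndPre.inner_create, inner_rep, map_mul,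
        mul_apply_eq_comp, comm_apply]
    exact h
  · intro c b a b' v
    change createComm r t (𝒜.bundle.lact c a ⊗ₜ (b * b')) v = (IndPre.leftRep r.π t).ext c
      ((IndPre.rightRep r.π r.ρ r.comm t).ext b (createComm r t (a ⊗ₜ b') v))
    simp only [createComm_tmul, IndPre.ext_right_create, IndPre.ext_create, map_mul,
      mul_apply_eq_comp]

theorem inner_mapL {E F G K : Type*} [NormedAddCommGroup E] [InnerProductSpace ℂ E]
    [NormedAddCommGroup F] [InnerProductSpace ℂ F] [NormedAddCommGroup G] [InnerProductSpace ℂ G]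
    [NormedAddCommGroup K] [InnerProductSpace ℂ K] (f f' : E →L[ℂ] F) (g g' : G →L[ℂ] K)
    (h : E →L[ℂ] E) (k : G →L[ℂ] G) (hf : ∀ v w, inner ℂ (f v) (f' w) = inner ℂ v (h w))
    (hg : ∀ v w, inner ℂ (g v) (g' w) = inner ℂ v (k w)) (x y : E ⊗[ℂ] G) :
    inner ℂ (TensorProduct.mapL f g x) (TensorProduct.mapL f' g' y) =
      inner ℂ x (TensorProduct.mapL h k y) := by
  induction x with
  | zero => simp
  | add x x' hx hx' => rw [map_add, inner_add_left, inner_add_left, hx, hx']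
  | tmul v w =>
    induction y with
    | zero => simp
    | add y y' hy hy' => rw [map_add, map_add, inner_add_right, inner_add_right, hy, hy']
    | tmul v' w' => simp [hf, hg]

theorem inner_rep_rep {C H : Type*} [NonUnitalCStarAlgebra C] [NormedAddCommGroup H]
    [InnerProductSpace ℂ H] [CompleteSpace H] (π : C →⋆ₙₐ[ℂ] (H →L[ℂ] H)) (c c' : C) (v w : H) :
    inner ℂ (π c v) (π c' w) = inner ℂ v (π (star c * c') w) := by
  rw [map_mul, mul_apply_eq_comp, map_star, ContinuousLinearMap.star_eq_adjoint,
    ContinuousLinearMap.adjoint_inner_right]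

theorem isBundleNorm_min :
    𝒜.IsBundleNorm B (minTensorNorm (A := 𝒜.fibre 1) (B := B)) := by
  refine IsBundleNorm.of_family_tmul (fun r : PairRep (𝒜.fibre 1) B => r.prodMap) (fun r c b => ?_)
    (fun r c c' b b' => ?_) fun t r => ⟨indPair r t, createPair r t, ?_, ?_⟩
  · refine (TensorProduct.norm_mapL_le (r.π c) (r.ρ b)).trans ?_
    gcongr <;> exact NonUnitalStarAlgHom.norm_apply_le _ _
  · rw [ip_eq]
    exact inner_mapL _ _ _ _ _ _ (inner_rep_rep r.π c c') (inner_rep_rep r.ρ b b')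
  · intro a a' b b'
    exact inner_mapL _ _ _ _ _ _ (IndPre.inner_create r.π a a') (inner_rep_rep r.ρ b b')
  · intro c b a b' v
    change TensorProduct.mapL (IndPre.create r.π t (𝒜.bundle.lact c a)) (r.ρ (b * b')) v =
      TensorProduct.mapL ((IndPre.leftRep r.π t).ext c) (r.ρ b)
        (TensorProduct.mapL (IndPre.create r.π t a) (r.ρ b') v)
    induction v with
    | zero => simp
    | add v v' hv hv' => rw [map_add, map_add, map_add, hv, hv']
    | tmul v w =>
      simp only [TensorProduct.mapL_tmul, IndPre.ext_create, map_mul, mul_apply_eq_comp]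

variable (𝒜 B)

/-- The minimal tensor product of a Fell bundle with a `C*`-algebra: its fibre at `s` is the
completion of `A s ⊗ B` in the norm `x ↦ ‖x* x‖ ^ (1 / 2)`, where `‖x* x‖` is the minimal `C*`-norm
on `A 1 ⊗ B`. -/
def minTensor : FellBundle S := IsBundleNorm.tensor (isBundleNorm_min (𝒜 := 𝒜) (B := B))

/-- The maximal tensor product of a Fell bundle with a `C*`-algebra: its fibre at `s` is the
completion of `A s ⊗ B` in the norm `x ↦ ‖x* x‖ ^ (1 / 2)`, where `‖x* x‖` is the maximal `C*`-norm
on `A 1 ⊗ B`. -/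
def maxTensor : FellBundle S := IsBundleNorm.tensor (isBundleNorm_max (𝒜 := 𝒜) (B := B))

end FellBundle

end

noncomputable section

open scoped TensorProduct InnerProductSpace ComplexConjugate

open InverseMonoid

/-! ### Order lemmas in an inverse monoid. -/

namespace InverseMonoid

variable {S : Type u} [InverseMonoid S]

/-! Let `ξ_i` be a net for the bundle and let `e_j` be an approximate unit of `B` made of
self-adjoint contractions. Over the product index set, the functions `s ↦ ξ_i(s) ⊗ e_j` witness the
approximation property of the tensor product. Only the properties in `IsBundleNorm` enter, so the
minimal and the maximal norm are two instances of `approximationProperty_tensor`.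

The operators in question act diagonally on the universal representation, so it suffices to estimate
them in each nondegenerate representation `σ` of the tensor product bundle. Such a `σ` factors as
`σ(a ⊗ b) = τ(a) R(b)`, where `τ` is a nondegenerate representation of the original bundle on the
same space and `‖R(b)‖ ≤ ‖b‖`; moreover the projections `1_r` computed in `σ` and in `τ` agree
(`exists_factor`). The agreement rests on a description of the kernel of `1_r` as the space `null r`
of vectors annihilated by the fibres at all idempotents `e ≤ r` (`orthogonal_essential`).

Consequently the sum in (i) becomes `gram_τ(ξ_i) R(e_j* e_j)`. Since `τ` is a summand of the
universal representation of the original bundle, the constant `C` survives. The average of `a ⊗ b`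
becomes `average_τ(a) R(e_j* b e_j)`, and it tends to `a ⊗ b` at a rate independent of `σ`.

Passing from elementary tensors to the whole completed fibre needs a uniform bound, `‖average a‖ ≤ C
‖a‖` (`norm_average_le`). The projections `P_pt = 1_{pt*}` commute, are symmetric and satisfy `P_ij
P_jk ≤ P_ik`: they form a Boolean-valued partial equivalence relation, and its matrix is positive
(`ProjectionRelation.sum_nonneg`). Cauchy–Schwarz for this form, applied to the elements `p` and
`st` together, bounds the average by two sums. One is the Gram sum of `ξ`; the other reduces to it
by `1_{srs*} a = a 1_r` (`unit_conj_mul`) and by the positivity of `‖a‖² - a* a`. -/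

theorem mul_mem_le_left {e s t : S} (he : e * e = e) (h : s ≤ t) : e * s ≤ t := by
  simpa using mul_le_mul (show e ≤ 1 from ⟨e, he, one_mul e⟩) h

theorem mul_mem_le_right {e s t : S} (he : e * e = e) (h : s ≤ t) : s * e ≤ t := by
  simpa using mul_le_mul h (show e ≤ 1 from ⟨e, he, one_mul e⟩)

theorem le_inv_of_idem {e r : S} (he : e * e = e) (h : e ≤ r) : e ≤ r⁻¹ := by
  simpa only [idem_inv he] using inv_le_inv h

end InverseMonoid

/-! ### Representations of a Fell bundle and the projections `1_r`. -/

namespace FellBundle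

variable {S : Type u} [InverseMonoid S]

/-- A representation of a Fell bundle on a Hilbert space, possibly degenerate. -/
structure HRep (𝒜 : FellBundle S) (H : Type*) [NormedAddCommGroup H] [InnerProductSpace ℂ H]
    [CompleteSpace H] where
  π : ∀ s : S, 𝒜.fibre s →ₗ[ℂ] (H →L[ℂ] H)
  map_mul : ∀ (s t : S) (a : 𝒜.fibre s) (b : 𝒜.fibre t),
    π (s * t) (𝒜.bundle.mul s t a b) = π s a * π t b
  map_star : ∀ (s : S) (a : 𝒜.fibre s), π s⁻¹ (𝒜.bundle.star s a) = star (π s a)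
  map_incl : ∀ (s t : S) (h : s ≤ t) (a : 𝒜.fibre s), π t (𝒜.bundle.incl h a) = π s a

namespace HRep

variable {𝒜 : FellBundle S} {H : Type*} [NormedAddCommGroup H] [InnerProductSpace ℂ H]
  [CompleteSpace H] (σ : 𝒜.HRep H)

theorem map_mulTo {s t r : S} (h : s * t ≤ r) (a : 𝒜.fibre s) (b : 𝒜.fibre t) :
    σ.π r (𝒜.bundle.mulTo h a b) = σ.π s a * σ.π t b :=
  (σ.map_incl _ _ _ _).trans (σ.map_mul s t a b)

theorem map_starTo {s r : S} (h : s⁻¹ ≤ r) (a : 𝒜.fibre s) :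
    σ.π r (𝒜.bundle.starTo h a) = star (σ.π s a) :=
  (σ.map_incl _ _ _ _).trans (σ.map_star s a)

theorem map_ip {s : S} (a b : 𝒜.fibre s) :
    σ.π 1 (𝒜.bundle.ip a b) = star (σ.π s a) * σ.π s b := by
  rw [AlgBundle.ip, map_mulTo, map_star]

theorem map_mul_one (c d : 𝒜.fibre 1) : σ.π 1 (c * d) = σ.π 1 c * σ.π 1 d :=
  σ.map_mulTo _ c d

theorem map_star_one (c : 𝒜.fibre 1) : σ.π 1 (star c) = star (σ.π 1 c) :=
  σ.map_starTo _ c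

/-- The restriction to the unit fibre. -/
def one : 𝒜.fibre 1 →⋆ₙₐ[ℂ] (H →L[ℂ] H) where
  __ := σ.π 1
  map_zero' := map_zero (σ.π 1)
  map_mul' := σ.map_mul_one
  map_star' := σ.map_star_one

theorem inner_left {s : S} (a : 𝒜.fibre s) (x y : H) :
    inner ℂ (star (σ.π s a) x) y = inner ℂ x (σ.π s a y) := by
  rw [ContinuousLinearMap.star_eq_adjoint, ContinuousLinearMap.adjoint_inner_left]

/-- The vectors annihilated by the fibres at the idempotents below `r`. -/
def null (r : S) : Submodule ℂ H where
  carrier := {y | ∀ e : S, e * e = e → e ≤ r → ∀ a : 𝒜.fibre e, σ.π e a y = 0}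
  zero_mem' := by simp
  add_mem' hx hy e he h a := by rw [map_add, hx e he h a, hy e he h a, add_zero]
  smul_mem' z x hx e he h a := by rw [map_smul, hx e he h a, smul_zero]

/-- The closed linear span of the range of the ideal `I_{r,1}`. -/
def essential (r : S) : Submodule ℂ H :=
  (Submodule.span ℂ {w : H | ∃ c ∈ 𝒜.ideal r, ∃ v : H, w = σ.π 1 c v}).topologicalClosure

instance (r : S) : CompleteSpace (σ.essential r) :=
  (Submodule.isClosed_topologicalClosure _).completeSpace_coe

/-- The projection onto the closed linear span of the range of the ideal `I_{r,1}`. -/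
def unit (r : S) : H →L[ℂ] H := (σ.essential r).starProjection

theorem null_star {r : S} {y : H} (hy : y ∈ σ.null r) {e : S} (he : e * e = e) (h : e ≤ r)
    (a : 𝒜.fibre e) : star (σ.π e a) y = 0 := by
  rw [← σ.map_starTo (le_of_eq (idem_inv he))]
  exact hy e he h _

theorem map_one_mem_null {r : S} {y : H} (hy : y ∈ σ.null r) (c : 𝒜.fibre 1) :
    σ.π 1 c y ∈ σ.null r := fun e he h a => by
  rw [← mul_apply_eq_comp, ← σ.map_mulTo (le_of_eq (mul_one e))]
  exact hy e he h _

/-- An idempotent `e` equals `e* e`, so the fibre at `e ≤ r` is one of the generators of the ideal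
once `e` is taken for `v`. -/
theorem exists_mem_ideal {r e : S} (he : e * e = e) (h : e ≤ r) (a : 𝒜.fibre e) :
    ∃ c ∈ 𝒜.ideal r, σ.π 1 c = σ.π e a := by
  have h1 : e ≤ e⁻¹ * e := le_of_eq (by rw [idem_inv he, he])
  refine ⟨𝒜.bundle.incl (inv_mul_le_one e) (𝒜.bundle.incl h1 a), ?_, ?_⟩
  · rw [ideal, Submodule.mem_sInf]
    exact fun J hJ => hJ.2.2 e h ⟨e, he, one_mul e⟩ _
  · rw [σ.map_incl, σ.map_incl]

theorem norm_le (s : S) (a : 𝒜.fibre s) : ‖σ.π s a‖ ≤ ‖a‖ := by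
  have h1 : ‖σ.π s a‖ * ‖σ.π s a‖ ≤ ‖a‖ * ‖a‖ := by
    rw [← CStarRing.norm_star_mul_self, ← σ.map_ip, ← sq, ← 𝒜.bundle.norm_ip_self]
    exact NonUnitalStarAlgHom.norm_apply_le σ.one _
  exact le_of_sq_le_sq (by simpa only [sq] using h1) (norm_nonneg _)

theorem continuous_π (s : S) : Continuous (σ.π s) :=
  AddMonoidHomClass.continuous_of_bound (σ.π s) 1 fun a => by simpa using σ.norm_le s a

/-- The elements of the unit fibre whose adjoints annihilate `null r` form a closed two-sided ideal,
because `null r` is invariant under the unit fibre. It contains the generators of `ideal r`, hence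
all of it. -/
theorem star_map_ideal {r : S} {c : 𝒜.fibre 1} (hc : c ∈ 𝒜.ideal r) {y : H}
    (hy : y ∈ σ.null r) : star (σ.π 1 c) y = 0 := by
  have hcont : ∀ w : H, Continuous fun x => star (σ.π 1 x) w := fun w =>
    (ContinuousLinearMap.apply ℂ H w).continuous.comp
      (continuous_star.comp (σ.continuous_π 1))
  let J : Submodule ℂ (𝒜.fibre 1) :=
    { carrier := {x | ∀ w ∈ σ.null r, star (σ.π 1 x) w = 0}
      zero_mem' := by simp
      add_mem' := fun hx hx' w hw => by
        rw [map_add, star_add, _root_.add_apply, hx w hw, hx' w hw, add_zero]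
      smul_mem' := fun z x hx w hw => by
        rw [map_smul, star_smul, _root_.smul_apply, hx w hw, smul_zero] }
  have hJ : c ∈ J := by
    refine Submodule.mem_sInf.mp hc J ⟨?_, fun x hx d => ⟨fun w hw => ?_, fun w hw => ?_⟩,
      fun v hv hv1 a w hw => ?_⟩
    · have : (J : Set (𝒜.fibre 1)) = ⋂ w ∈ σ.null r, {x | star (σ.π 1 x) w = 0} := by
        ext x; simp [J]
      rw [this]
      exact isClosed_biInter fun w _ => isClosed_eq (hcont w) continuous_const
    · rw [map_mul_one, star_mul, mul_apply_eq_comp, ← σ.map_star_one d]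
      exact hx _ (σ.map_one_mem_null hw _)
    · rw [map_mul_one, star_mul, mul_apply_eq_comp, hx w hw, map_zero]
    · have hvi : v * v = v := by
        obtain ⟨e, he, h⟩ := hv1
        rw [one_mul] at h
        rwa [← h]
      rw [σ.map_incl]
      refine σ.null_star hw (inv_mul_idem v) ?_ a
      rwa [idem_inv hvi, hvi]
  exact hJ y hy

/-- This replaces the generated ideal by a condition on single fibres. All later identities between
the projections `unit r` are proved by inspecting null spaces. -/
theorem orthogonal_essential (r : S) : (σ.essential r)ᗮ = σ.null r := by
  rw [essential, Submodule.orthogonal_closure]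
  ext y
  constructor
  · intro hy e he h a
    have key : ∀ b : 𝒜.fibre e, ∀ v, inner ℂ (σ.π e b v) y = 0 := fun b v => by
      obtain ⟨c, hc, hcb⟩ := σ.exists_mem_ideal he h b
      exact hy _ (Submodule.subset_span ⟨c, hc, v, by rw [hcb]⟩)
    -- Pairing `a* (a y)` with `y` gives `‖a y‖²`.
    have h2 := key (𝒜.bundle.starTo (le_of_eq (idem_inv he)) a) (σ.π e a y)
    rw [map_starTo, inner_left] at h2
    exact inner_self_eq_zero.mp h2
  · intro hy
    rw [Submodule.mem_orthogonal]
    intro w hw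
    induction hw using Submodule.span_induction with
    | mem w hw =>
      obtain ⟨c, hc, v, rfl⟩ := hw
      rw [← ContinuousLinearMap.adjoint_inner_right, ← ContinuousLinearMap.star_eq_adjoint,
        σ.star_map_ideal hc hy, inner_zero_right]
    | zero => simp
    | add w w' _ _ hw hw' => rw [inner_add_left, hw, hw', add_zero]
    | smul z w _ hw => rw [inner_smul_left, hw, mul_zero]

theorem unit_eq_zero_iff {r : S} {y : H} : σ.unit r y = 0 ↔ y ∈ σ.null r := by
  rw [unit, Submodule.starProjection_apply_eq_zero_iff, orthogonal_essential]

theorem star_unit (r : S) : star (σ.unit r) = σ.unit r :=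
  isSelfAdjoint_starProjection _

theorem unit_mul_unit (r : S) : σ.unit r * σ.unit r = σ.unit r :=
  Submodule.isIdempotentElem_starProjection _

theorem sub_unit_mem_null (r : S) (x : H) : x - σ.unit r x ∈ σ.null r := by
  rw [← orthogonal_essential]
  exact Submodule.sub_starProjection_mem_orthogonal x

theorem unit_congr {r r' : S} (h : σ.null r = σ.null r') : σ.unit r = σ.unit r' := by
  have h2 : σ.essential r = σ.essential r' := by
    rw [← Submodule.orthogonal_orthogonal (σ.essential r), orthogonal_essential, h,
      ← orthogonal_essential, Submodule.orthogonal_orthogonal]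
  simp only [unit, h2]

/-- A bounded operator that maps null vectors to null vectors, together with its adjoint,
intertwines the units. -/
theorem unit_intertwine {𝒜' : FellBundle S} {H' : Type*} [NormedAddCommGroup H']
    [InnerProductSpace ℂ H'] [CompleteSpace H'] (τ : 𝒜'.HRep H') (T : H →L[ℂ] H') {r r' : S}
    (h₁ : ∀ y ∈ σ.null r, T y ∈ τ.null r')
    (h₂ : ∀ y ∈ τ.null r', T.adjoint y ∈ σ.null r) (x : H) :
    τ.unit r' (T x) = T (σ.unit r x) := by
  have e1 : τ.unit r' (T (x - σ.unit r x)) = 0 :=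
    τ.unit_eq_zero_iff.mpr (h₁ _ (σ.sub_unit_mem_null r x))
  -- The range of `τ.unit r'` is the orthogonal complement of `τ.null r'`. It contains `T (σ.unit r
  -- x)`, since the adjoint of `T` sends `τ.null r'` into `σ.null r`, which is orthogonal to `σ.unit
  -- r x`.
  have e2 : τ.unit r' (T (σ.unit r x)) = T (σ.unit r x) := by
    rw [unit, Submodule.starProjection_eq_self_iff,
      ← Submodule.orthogonal_orthogonal (τ.essential r'), orthogonal_essential]
    intro y hy
    rw [← ContinuousLinearMap.adjoint_inner_left]
    have h3 := h₂ y hy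
    rw [← orthogonal_essential] at h3
    exact Submodule.inner_left_of_mem_orthogonal (Submodule.starProjection_apply_mem _ x) h3
  rw [map_sub, map_sub, sub_eq_zero] at e1
  rw [e1, e2]

/-- Bounded operators which intertwine two representations intertwine the units. -/
theorem unit_intertwine_of_commute {H' : Type*} [NormedAddCommGroup H']
    [InnerProductSpace ℂ H'] [CompleteSpace H'] (τ : 𝒜.HRep H') (T : H →L[ℂ] H')
    (h : ∀ s (a : 𝒜.fibre s) x, T (σ.π s a x) = τ.π s a (T x)) (r : S) (x : H) :
    τ.unit r (T x) = T (σ.unit r x) := by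
  have h' : ∀ s (a : 𝒜.fibre s) y, T.adjoint (star (τ.π s a) y) = star (σ.π s a) (T.adjoint y) := by
    intro s a y
    refine ext_inner_right ℂ fun x => ?_
    rw [ContinuousLinearMap.adjoint_inner_left, inner_left, inner_left,
      ContinuousLinearMap.adjoint_inner_left, h]
  refine σ.unit_intertwine τ T (fun y hy e he hr a => ?_) (fun y hy e he hr a => ?_) x
  · rw [← h, hy e he hr, map_zero]
  · have e1 : σ.π e a = star (σ.π e (𝒜.bundle.starTo (le_of_eq (idem_inv he)) a)) := by
      rw [map_starTo, star_star]
    rw [e1, ← h', τ.null_star hy he hr, map_zero]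

theorem commute_of_null {r : S} (T : H →L[ℂ] H) (h₁ : ∀ y ∈ σ.null r, T y ∈ σ.null r)
    (h₂ : ∀ y ∈ σ.null r, star T y ∈ σ.null r) : σ.unit r * T = T * σ.unit r :=
  ContinuousLinearMap.ext fun x => σ.unit_intertwine σ T h₁ h₂ x

/-- The unit fibre is closed under the involution and leaves `null r` invariant, so both conditions
for commuting with the projection hold. -/
theorem unit_mul_π_one (r : S) (c : 𝒜.fibre 1) : σ.unit r * σ.π 1 c = σ.π 1 c * σ.unit r :=
  σ.commute_of_null _ (fun _ hy => σ.map_one_mem_null hy c) fun _ hy => by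
    rw [← map_star_one]; exact σ.map_one_mem_null hy _

theorem unit_mul_π_idem (r : S) {e : S} (he : e * e = e) (a : 𝒜.fibre e) :
    σ.unit r * σ.π e a = σ.π e a * σ.unit r := by
  rw [← σ.map_incl e 1 ⟨e, he, one_mul e⟩ a, unit_mul_π_one]

theorem unit_mem_null {r r' : S} {y : H} (hy : y ∈ σ.null r) : σ.unit r' y ∈ σ.null r :=
  fun e he h a => by
    rw [← mul_apply_eq_comp, ← σ.unit_mul_π_idem r' he, mul_apply_eq_comp, hy e he h, map_zero]

theorem unit_commute (r r' : S) : σ.unit r * σ.unit r' = σ.unit r' * σ.unit r :=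
  σ.commute_of_null _ (fun _ hy => σ.unit_mem_null hy) fun _ hy => by
    rw [star_unit]; exact σ.unit_mem_null hy

/-- An idempotent lies below `r` exactly when it lies below `r⁻¹`, so the two null spaces agree. -/
theorem unit_inv (r : S) : σ.unit r⁻¹ = σ.unit r := by
  refine σ.unit_congr (le_antisymm (fun y hy e he h a => ?_) fun y hy e he h a => ?_)
  · exact hy e he (le_inv_of_idem he h) a
  · exact hy e he (by simpa [InverseMonoid.inv_inv] using le_inv_of_idem he h) a

/-- The conclusion means `1_r 1_{r'} ≤ 1_{r''}`. To see that `1_r 1_{r'}` kills a vector of `null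
r''`, test with `a` in the fibre at `e ≤ r` and then `b` in the fibre at `f ≤ r'`. Since `1_{r'}`
commutes with `a`, what remains is `b a`, which lies in the fibre at `fe ≤ r''`. -/
theorem unit_mul_unit_mul {r r' r'' : S}
    (h : ∀ e f : S, e * e = e → f * f = f → e ≤ r → f ≤ r' → f * e ≤ r'') :
    σ.unit r * σ.unit r' * σ.unit r'' = σ.unit r * σ.unit r' := by
  ext x
  have hy := σ.sub_unit_mem_null r'' x
  have h0 : σ.unit r (σ.unit r' (x - σ.unit r'' x)) = 0 := by
    rw [unit_eq_zero_iff]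
    intro e he hr a
    rw [← mul_apply_eq_comp, ← σ.unit_mul_π_idem r' he, mul_apply_eq_comp, unit_eq_zero_iff]
    intro f hf hr' b
    rw [← mul_apply_eq_comp, ← σ.map_mulTo (le_of_eq rfl)]
    exact hy _ (idem_mul hf he) (h e f he hf hr hr') _
  rw [map_sub, map_sub, sub_eq_zero] at h0
  exact h0.symm

/-- `‖x y‖² = ⟨x* x y, y⟩`, and `x* x` lies in the fibre at the idempotent `u* u`. This extends
annihilation from idempotent fibres to arbitrary ones. -/
theorem map_eq_zero_of_mem_null {r u : S} (hu : u⁻¹ * u ≤ r) {y : H} (hy : y ∈ σ.null r)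
    (x : 𝒜.fibre u) : σ.π u x y = 0 := by
  have h := hy _ (inv_mul_idem u) hu (𝒜.bundle.mul _ _ (𝒜.bundle.star u x) x)
  rw [σ.map_mul, σ.map_star, mul_apply_eq_comp] at h
  rw [← inner_self_eq_zero (𝕜 := ℂ), ← σ.inner_left, h, inner_zero_left]

/-- Both null-space conditions come from computing source idempotents. For `f ≤ srs*`, the fibre at
`fs` has source `s* f s ≤ r`; for `e ≤ r`, the fibre at `es*` has source `s e s* ≤ srs*`. -/
theorem unit_conj_mul (s r : S) (a : 𝒜.fibre s) :
    σ.unit (s * r * s⁻¹) * σ.π s a = σ.π s a * σ.unit r := by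
  refine ContinuousLinearMap.ext fun x => σ.unit_intertwine σ (σ.π s a)
    (fun y hy f hf hr b => ?_) (fun y hy e he hr b => ?_) x
  · rw [← mul_apply_eq_comp, ← σ.map_mul]
    refine σ.map_eq_zero_of_mem_null ?_ hy _
    have e1 : (f * s)⁻¹ * (f * s) = s⁻¹ * f * s := by
      rw [InverseMonoid.mul_inv_rev, idem_inv hf, mul_assoc, ← mul_assoc f f s, hf, mul_assoc]
    have h2 : s⁻¹ * f * s ≤ s⁻¹ * (s * r * s⁻¹) * s :=
      mul_le_mul (mul_le_mul (le_of_eq rfl) hr) (le_of_eq rfl)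
    rw [e1]
    refine le_trans' h2 ?_
    have e2 : s⁻¹ * (s * r * s⁻¹) * s = (s⁻¹ * s) * (r * (s⁻¹ * s)) := by simp only [mul_assoc]
    rw [e2]
    exact mul_mem_le_left (inv_mul_idem s) (mul_mem_le_right (inv_mul_idem s) (le_of_eq rfl))
  · rw [← ContinuousLinearMap.star_eq_adjoint, ← σ.map_star, ← mul_apply_eq_comp, ← σ.map_mul]
    refine σ.map_eq_zero_of_mem_null ?_ hy _
    have e1 : (e * s⁻¹)⁻¹ * (e * s⁻¹) = s * e * s⁻¹ := by
      rw [InverseMonoid.mul_inv_rev, idem_inv he, InverseMonoid.inv_inv, mul_assoc,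
        ← mul_assoc e e s⁻¹, he, mul_assoc]
    rw [e1]
    exact mul_le_mul (mul_le_mul (le_of_eq rfl) hr) (le_of_eq rfl)

end HRep
end FellBundle

/-! ### Positivity of a projection-valued partial equivalence relation. -/

/-- A family of projections which is a partial equivalence relation with values in a commutative
Boolean algebra of projections. -/
structure ProjectionRelation {H : Type*} [NormedAddCommGroup H] [InnerProductSpace ℂ H]
    [CompleteSpace H] {ι : Type*} (P : ι → ι → H →L[ℂ] H) : Prop where
  star_eq : ∀ i j, star (P i j) = P i j
  mul_self : ∀ i j, P i j * P i j = P i j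
  symm : ∀ i j, P i j = P j i
  commute : ∀ i j k l, P i j * P k l = P k l * P i j
  trans : ∀ i j k, P i j * P j k * P i k = P i j * P j k

namespace ProjectionRelation

variable {H : Type*} [NormedAddCommGroup H] [InnerProductSpace ℂ H] [CompleteSpace H]
  {ι : Type*} {P : ι → ι → H →L[ℂ] H} (hP : ProjectionRelation P)

include hP

/-- Transitivity along `j, i, j` gives `P i j ≤ P j j`. Diagonal projections need not be the
identity, which is why the relation is only a partial equivalence. -/
theorem mul_diag (i j : ι) : P i j * P j j = P i j := by
  have h := hP.trans i j i
  have h1 := hP.trans j i j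
  rw [hP.symm j i, hP.mul_self] at h1
  exact h1

/-- Symmetry and transitivity give `P r i * P i j = P r i * P r j = P i j * P r j`, so both cross
terms and the triple product coincide. This is the elimination step with pivot `r`. -/
theorem compress (r i j : ι) :
    (1 - P r i) * P i j * (1 - P r j) = P i j - P r i * P r j := by
  have h1 : P r i * P i j = P r i * P r j := by
    have a1 := hP.trans r i j
    have a2 := hP.trans i r j
    rw [hP.symm i r] at a2
    rw [← a1, ← a2, mul_assoc, mul_assoc, hP.commute i j r j]
  have h2 : P i j * P r j = P r i * P r j := by
    have a1 := hP.trans i j r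
    have a2 := hP.trans i r j
    rw [hP.symm j r, hP.symm i r] at a1
    rw [hP.symm i r] at a2
    rw [← a1, ← a2, mul_assoc, hP.commute r j r i, ← mul_assoc, hP.commute i j r i, mul_assoc,
      mul_assoc, hP.commute i j r j]
  have h3 : P r i * P i j * P r j = P r i * P r j := by
    rw [h1, mul_assoc, hP.mul_self]
  rw [sub_mul, one_mul, mul_sub, mul_one, sub_mul, h3, h2, h1]
  abel

theorem inner_left (i j : ι) (x y : H) : inner ℂ (P i j x) y = inner ℂ x (P i j y) := by
  rw [← ContinuousLinearMap.adjoint_inner_right, ← ContinuousLinearMap.star_eq_adjoint,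
    hP.star_eq]

/-- Induction by eliminating an index `r`. With `g i = f i - P r i (f i)`, `compress` splits the
form into `‖∑ P r i (f i)‖²` and the same form in `g`. Row and column `r` of the latter vanish,
since `P r j` kills `g j` and `P i r = P i r * P r r` kills `g r`; the induction hypothesis for `g`
on the smaller set finishes the argument. -/
theorem sum_nonneg (F : Finset ι) (f : ι → H) :
    0 ≤ (∑ i ∈ F, ∑ j ∈ F, inner ℂ (f i) (P i j (f j))).re := by
  classical
  induction F using Finset.induction_on generalizing f with
  | empty => simp
  | insert r F hr ih =>
    set g : ι → H := fun i => f i - P r i (f i) with hg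
    have e1 : ∀ i j, inner ℂ (f i) (P i j (f j)) =
        inner ℂ (P r i (f i)) (P r j (f j)) + inner ℂ (g i) (P i j (g j)) := by
      intro i j
      have e2 : inner ℂ (g i) (P i j (g j)) =
          inner ℂ (f i) (((1 - P r i) * P i j * (1 - P r j)) (f j)) := by
        have : ∀ k, g k = (1 - P r k) (f k) := fun k => rfl
        rw [this i, this j, mul_apply_eq_comp, mul_apply_eq_comp, _root_.sub_apply,
          _root_.sub_apply 1 _ (P i j _), inner_sub_left, inner_sub_right, hP.inner_left]
        rfl
      rw [e2, hP.compress, _root_.sub_apply, inner_sub_right, mul_apply_eq_comp, hP.inner_left]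
      ring
    have e3 : ∀ j, P r j (g j) = 0 := fun j => by
      rw [hg, map_sub, ← mul_apply_eq_comp, hP.mul_self, sub_self]
    have e4 : ∀ i, P i r (g r) = 0 := fun i => by
      rw [hg, map_sub, ← mul_apply_eq_comp, hP.mul_diag, sub_self]
    have e5 : ∑ i ∈ insert r F, ∑ j ∈ insert r F, inner ℂ (g i) (P i j (g j)) =
        ∑ i ∈ F, ∑ j ∈ F, inner ℂ (g i) (P i j (g j)) := by
      simp [Finset.sum_insert hr, e3, e4]
    have e6 : ∑ i ∈ insert r F, ∑ j ∈ insert r F, inner ℂ (P r i (f i)) (P r j (f j)) =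
        inner ℂ (∑ i ∈ insert r F, P r i (f i)) (∑ i ∈ insert r F, P r i (f i)) := by
      rw [sum_inner]
      exact Finset.sum_congr rfl fun i _ => (inner_sum _ _ _).symm
    simp only [e1, Finset.sum_add_distrib]
    rw [e5, e6, Complex.add_re]
    exact add_nonneg (inner_self_nonneg (𝕜 := ℂ)) (ih g)

/-- The semi-inner product defined by the relation. -/
abbrev core (F : Finset ι) : PreInnerProductSpace.Core ℂ (ι → H) where
  inner f g := ∑ i ∈ F, ∑ j ∈ F, inner ℂ (f i) (P i j (g j))
  conj_inner_symm f g := by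
    simp only [map_sum, inner_conj_symm, hP.inner_left]
    rw [Finset.sum_comm]
    simp only [hP.symm]
  re_inner_nonneg f := hP.sum_nonneg F f
  add_left f g h := by simp [Finset.sum_add_distrib]
  smul_left f g z := by
    simp only [Pi.smul_apply, inner_smul_left, Finset.mul_sum]

theorem norm_sum_sq_le (F : Finset ι) (f g : ι → H) :
    ‖∑ i ∈ F, ∑ j ∈ F, inner ℂ (f i) (P i j (g j))‖ ^ 2 ≤
      (∑ i ∈ F, ∑ j ∈ F, inner ℂ (f i) (P i j (f j))).re *
      (∑ i ∈ F, ∑ j ∈ F, inner ℂ (g i) (P i j (g j))).re := by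
  have h := @InnerProductSpace.Core.inner_mul_inner_self_le ℂ (ι → H) _ _ _ (hP.core F) f g
  rw [@InnerProductSpace.Core.norm_inner_symm ℂ (ι → H) _ _ _ (hP.core F) g f, ← sq] at h
  exact h

end ProjectionRelation

/-! ### The uniform norm bound for the averaging maps. -/

namespace FellBundle.HRep

variable {S : Type u} [InverseMonoid S] {𝒜 : FellBundle S} {H : Type*} [NormedAddCommGroup H]
  [InnerProductSpace ℂ H] [CompleteSpace H] (σ : 𝒜.HRep H)

/-- Transitivity is the inequality `u_i u_j* u_j u_k* ≤ u_i u_k*`. An arbitrary family `u` is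
allowed because two copies of `S`, carrying `p` and `st`, are used at once below. -/
theorem projectionRelation {ι : Type*} (u : ι → S) :
    ProjectionRelation fun i j => σ.unit (u i * (u j)⁻¹) where
  star_eq i j := σ.star_unit _
  mul_self i j := σ.unit_mul_unit _
  symm i j := by
    rw [← σ.unit_inv (u i * (u j)⁻¹), InverseMonoid.mul_inv_rev, InverseMonoid.inv_inv]
  commute i j k l := σ.unit_commute _ _
  trans i j k := by
    refine σ.unit_mul_unit_mul fun e f he hf h1 h2 => ?_
    rw [idem_comm hf he]
    refine le_trans' (mul_le_mul h1 h2) ?_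
    have e1 : u i * (u j)⁻¹ * (u j * (u k)⁻¹) = u i * (((u j)⁻¹ * u j) * (u k)⁻¹) := by
      simp only [mul_assoc]
    rw [e1]
    exact mul_le_mul (le_of_eq rfl) (mul_mem_le_left (inv_mul_idem _) (le_of_eq rfl))

/-- The operator `∑ ξ(p)* ξ(t) 1_{pt*}`. -/
def gram (F : Finset S) (ξ : S → 𝒜.fibre 1) : H →L[ℂ] H :=
  ∑ p ∈ F, ∑ t ∈ F, star (σ.π 1 (ξ p)) * σ.π 1 (ξ t) * σ.unit (p * t⁻¹)

/-- The linear map `a ↦ ∑ 1_{p(st)*} ξ(p)* a ξ(t)`. -/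
def average (F : Finset S) (ξ : S → 𝒜.fibre 1) (s : S) : 𝒜.fibre s →ₗ[ℂ] (H →L[ℂ] H) where
  toFun a := ∑ p ∈ F, ∑ t ∈ F,
    σ.unit (p * (s * t)⁻¹) * star (σ.π 1 (ξ p)) * σ.π s a * σ.π 1 (ξ t)
  map_add' a b := by simp only [map_add, mul_add, add_mul, Finset.sum_add_distrib]
  map_smul' z a := by
    simp only [map_smul, mul_smul_comm, smul_mul_assoc, Finset.smul_sum, RingHom.id_apply]

/-- Needed because `s ↦ ξ(s) ⊗ e` may have smaller support than `ξ`: a nonzero `ξ(s)` may give a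
vanishing tensor. -/
theorem gram_subset {F F' : Finset S} (h : F ⊆ F') {ξ : S → 𝒜.fibre 1}
    (hξ : ∀ s ∉ F, ξ s = 0) : σ.gram F ξ = σ.gram F' ξ := by
  refine (Finset.sum_congr rfl fun p _ => Finset.sum_subset h fun t _ ht => ?_).trans
    (Finset.sum_subset h fun p _ hs => Finset.sum_eq_zero fun t _ => ?_)
  · rw [hξ t ht, map_zero, mul_zero, zero_mul]
  · rw [hξ p hs, map_zero, star_zero, zero_mul, zero_mul]

theorem average_subset {F F' : Finset S} (h : F ⊆ F') {ξ : S → 𝒜.fibre 1}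
    (hξ : ∀ s ∉ F, ξ s = 0) (s : S) : σ.average F ξ s = σ.average F' ξ s := by
  ext1 a
  refine (Finset.sum_congr rfl fun p _ => Finset.sum_subset h fun t _ ht => ?_).trans
    (Finset.sum_subset h fun p _ hs => Finset.sum_eq_zero fun t _ => ?_)
  · rw [hξ t ht, map_zero, mul_zero]
  · rw [hξ p hs, map_zero, star_zero, mul_zero, zero_mul, zero_mul]

/-- Since `1_{pt*}` commutes with the unit fibre, it can be moved between `ξ(p)*` and `ξ(t)`. This
exhibits the Gram operator as the positive form of the projection relation evaluated at `p ↦ ξ(p)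
x`. -/
theorem inner_gram (F : Finset S) (ξ : S → 𝒜.fibre 1) (x : H) :
    ∑ p ∈ F, ∑ t ∈ F, inner ℂ (σ.π 1 (ξ p) x) (σ.unit (p * t⁻¹) (σ.π 1 (ξ t) x)) =
      inner ℂ x (σ.gram F ξ x) := by
  simp only [gram, _root_.sum_apply, inner_sum]
  refine Finset.sum_congr rfl fun p _ => Finset.sum_congr rfl fun t _ => ?_
  rw [mul_assoc, ← σ.unit_mul_π_one, ← σ.map_star_one, mul_apply_eq_comp, mul_apply_eq_comp,
    σ.map_star_one, ContinuousLinearMap.star_eq_adjoint, ContinuousLinearMap.adjoint_inner_right]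

theorem inner_gram_le {F : Finset S} {ξ : S → 𝒜.fibre 1} {C : ℝ} (hC : ‖σ.gram F ξ‖ ≤ C)
    (x : H) : (∑ p ∈ F, ∑ t ∈ F,
      inner ℂ (σ.π 1 (ξ p) x) (σ.unit (p * t⁻¹) (σ.π 1 (ξ t) x))).re ≤ C * ‖x‖ ^ 2 := by
  rw [inner_gram]
  calc _ ≤ ‖x‖ * ‖σ.gram F ξ x‖ := (Complex.re_le_norm _).trans (norm_inner_le_norm _ _)
    _ ≤ ‖x‖ * (C * ‖x‖) := by gcongr; exact (σ.gram F ξ).le_of_opNorm_le hC x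
    _ = _ := by ring

/-- An operator `d` commuting with the units such that `‖a‖² - a* a = d* d`. -/
theorem exists_defect {s : S} (a : 𝒜.fibre s) : ∃ d : H →L[ℂ] H,
    (∀ r, σ.unit r * d = d * σ.unit r) ∧
      ∀ x y, inner ℂ (σ.π s a x) (σ.π s a y) + inner ℂ (d x) (d y) =
        (‖a‖ : ℂ) ^ 2 * inner ℂ x y := by
  obtain ⟨c, hc⟩ := 𝒜.pos s a
  have hn : ‖c‖ = ‖a‖ := by
    have h := congrArg norm hc
    rw [𝒜.bundle.norm_ip_self, 𝒜.bundle.norm_ip_self] at h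
    exact ((sq_eq_sq₀ (norm_nonneg _) (norm_nonneg _)).mp h).symm
  obtain ⟨g, hg, hcg⟩ := _root_.exists_defect c
  have hs : star (σ.π s a) * σ.π s a = (2 * ‖a‖ : ℂ) • σ.π 1 g - σ.π 1 g * σ.π 1 g := by
    have h2 : star c * c = (2 * ‖c‖ : ℂ) • g - g * g := by
      rw [hcg, RCLike.real_smul_eq_coe_smul (K := ℂ)]; simp
    rw [← σ.map_ip, hc, 𝒜.bundle.ip_eq_mulOne, ← star_def, ← mul_def, h2, map_sub, map_smul,
      map_mul_one, hn]
  -- With `a* a = c* c = 2‖a‖ g - g²`, the self-adjoint operator `‖a‖ - g` has square `‖a‖² - a* a`.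
  -- Being a scalar minus an element of the unit fibre, it commutes with every `1_r`.
  refine ⟨(‖a‖ : ℂ) • 1 - σ.π 1 g, fun r => ?_, fun x y => ?_⟩
  · rw [mul_sub, sub_mul, σ.unit_mul_π_one, mul_smul_comm, smul_mul_assoc, mul_one, one_mul]
  · have e1 : inner ℂ (σ.π s a x) (σ.π s a y) =
        inner ℂ x ((star (σ.π s a) * σ.π s a) y) := by
      rw [mul_apply_eq_comp, ContinuousLinearMap.star_eq_adjoint,
        ContinuousLinearMap.adjoint_inner_right]
    have e2 : ∀ z, inner ℂ (σ.π 1 g x) z = inner ℂ x (σ.π 1 g z) := fun z => by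
      rw [← σ.inner_left, ← σ.map_star_one, hg]
    rw [e1, hs]
    simp only [_root_.sub_apply, _root_.smul_apply, mul_apply_eq_comp, one_apply_eq_self,
      inner_sub_left, inner_sub_right, inner_smul_left, inner_smul_right, e2,
      Complex.conj_ofReal]
    ring

theorem inner_average (F : Finset S) (ξ : S → 𝒜.fibre 1) {s : S} (a : 𝒜.fibre s) (x y : H) :
    ∑ p ∈ F, ∑ t ∈ F, inner ℂ (σ.π 1 (ξ p) x) (σ.unit (p * (s * t)⁻¹) (σ.π s a (σ.π 1 (ξ t) y))) =
      inner ℂ x (σ.average F ξ s a y) := by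
  change _ = inner ℂ x ((∑ p ∈ F, ∑ t ∈ F,
    σ.unit (p * (s * t)⁻¹) * star (σ.π 1 (ξ p)) * σ.π s a * σ.π 1 (ξ t)) y)
  simp only [_root_.sum_apply, inner_sum]
  refine Finset.sum_congr rfl fun p _ => Finset.sum_congr rfl fun t _ => ?_
  rw [← σ.map_star_one, σ.unit_mul_π_one, σ.map_star_one, mul_apply_eq_comp, mul_apply_eq_comp,
    mul_apply_eq_comp, ContinuousLinearMap.star_eq_adjoint,
    ContinuousLinearMap.adjoint_inner_right]

/-- Cauchy–Schwarz bounds `|⟨x, average(a) y⟩|²` by the product of the Gram form at `x`, at most `C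
‖x‖²`, and a form in the vectors `a ξ(t) y`, at most `‖a‖² C ‖y‖²`. -/
theorem norm_average_le {F : Finset S} {ξ : S → 𝒜.fibre 1} {C : ℝ} (hC : ‖σ.gram F ξ‖ ≤ C)
    {s : S} (a : 𝒜.fibre s) : ‖σ.average F ξ s a‖ ≤ C * ‖a‖ := by
  have hC0 : 0 ≤ C := (norm_nonneg _).trans hC
  have hbound : ∀ x y, ‖inner ℂ x (σ.average F ξ s a y)‖ ≤ C * ‖a‖ * ‖x‖ * ‖y‖ := by
    intro x y
    -- The first copy of `S` carries the elements `p`, the second the elements `st`. The two vector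
    -- families are supported on opposite copies, so their pairing consists of the mixed terms
    -- `1_{p(st)*}` only.
    have hP := σ.projectionRelation (Sum.elim id fun t => s * t : S ⊕ S → S)
    have hcs := hP.norm_sum_sq_le (F.disjSum F) (Sum.elim (fun p => σ.π 1 (ξ p) x) 0)
      (Sum.elim 0 fun t => σ.π s a (σ.π 1 (ξ t) y))
    simp only [Finset.sum_disjSum, Sum.elim_inl, Sum.elim_inr, Pi.zero_apply, map_zero,
      inner_zero_left, inner_zero_right, Finset.sum_const_zero, add_zero, zero_add, id] at hcs
    rw [inner_average] at hcs
    have h2 : (∑ p ∈ F, ∑ t ∈ F, inner ℂ (σ.π s a (σ.π 1 (ξ p) y))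
        (σ.unit (s * p * (s * t)⁻¹) (σ.π s a (σ.π 1 (ξ t) y)))).re ≤
        ‖a‖ ^ 2 * (C * ‖y‖ ^ 2) := by
      -- The projection `1_{sp(st)*} = 1_{s(pt*)s*}` passes through `a` as `1_{pt*}`. Replacing `a*
      -- a` by `‖a‖² - d* d` then leaves `‖a‖²` times the Gram form minus a form in `d ξ(p) y`,
      -- which is nonnegative because `d` commutes with the projections.
      obtain ⟨d, hd1, hd2⟩ := σ.exists_defect a
      have e1 : ∀ p t, inner ℂ (σ.π s a (σ.π 1 (ξ p) y))
          (σ.unit (s * p * (s * t)⁻¹) (σ.π s a (σ.π 1 (ξ t) y))) =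
          (‖a‖ : ℂ) ^ 2 * inner ℂ (σ.π 1 (ξ p) y) (σ.unit (p * t⁻¹) (σ.π 1 (ξ t) y)) -
            inner ℂ (d (σ.π 1 (ξ p) y)) (σ.unit (p * t⁻¹) (d (σ.π 1 (ξ t) y))) := by
        intro p t
        have e2 : s * p * (s * t)⁻¹ = s * (p * t⁻¹) * s⁻¹ := by
          rw [InverseMonoid.mul_inv_rev]; simp only [mul_assoc]
        rw [e2, ← mul_apply_eq_comp (σ.unit _) (σ.π s a), σ.unit_conj_mul, mul_apply_eq_comp,
          ← mul_apply_eq_comp (σ.unit _) d, hd1, mul_apply_eq_comp, ← hd2]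
        ring
      have hpos := (σ.projectionRelation (id : S → S)).sum_nonneg F fun p => d (σ.π 1 (ξ p) y)
      simp only [e1, Finset.sum_sub_distrib, ← Finset.mul_sum, Complex.sub_re]
      have e3 : ∀ z : ℂ, ((‖a‖ : ℂ) ^ 2 * z).re = ‖a‖ ^ 2 * z.re := fun z => by
        rw [← Complex.ofReal_pow, Complex.re_ofReal_mul]
      rw [e3]
      have h4 := mul_le_mul_of_nonneg_left (σ.inner_gram_le hC y) (sq_nonneg ‖a‖)
      simp only [id] at hpos
      linarith
    refine le_of_sq_le_sq (hcs.trans ?_) (by positivity)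
    refine (mul_le_mul_of_nonneg (σ.inner_gram_le hC x) h2 ?_ (by positivity)).trans_eq (by ring)
    exact (σ.projectionRelation (id : S → S)).sum_nonneg F fun p => σ.π 1 (ξ p) x
  refine ContinuousLinearMap.opNorm_le_bound _ (by positivity) fun y => ?_
  -- Testing against the vector `average(a) y` itself and cancelling one factor of its norm gives
  -- the operator bound.
  have h := hbound (σ.average F ξ s a y) y
  rcases (norm_nonneg (σ.average F ξ s a y)).eq_or_lt with h0 | h0
  · rw [← h0]; positivity
  · refine le_of_mul_le_mul_left ?_ h0
    calc _ = ‖inner ℂ (σ.average F ξ s a y) (σ.average F ξ s a y)‖ := by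
          rw [inner_self_eq_norm_sq_to_K]; simp [sq]
      _ ≤ _ := h
      _ = _ := by ring

end FellBundle.HRep

/-! ### Approximate units as nets, and strong limits of bounded nets. -/

/-- A `C*`-algebra has an approximate unit of self-adjoint contractions indexed by pairs of a finite
subset and a natural number. -/
theorem exists_approximate_unit (C : Type*) [NonUnitalCStarAlgebra C] :
    ∃ e : Finset C × ℕ → C, (∀ j, star (e j) = e j) ∧ (∀ j, ‖e j‖ ≤ 1) ∧
      (∀ c, Filter.Tendsto (fun j => e j * c) Filter.atTop (nhds c)) ∧
      ∀ c, Filter.Tendsto (fun j => c * e j) Filter.atTop (nhds c) := by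
  let _ := CStarAlgebra.spectralOrder C
  have := CStarAlgebra.spectralOrderedRing C
  have hl := CStarAlgebra.increasingApproximateUnit C
  have : (CStarAlgebra.approximateUnit C).NeBot := hl.neBot
  -- A filter approximate unit is turned into a net: for each finite set and tolerance `1/(n+1)` one
  -- element is chosen. The index type stays in the universe of `C`, as the approximation property
  -- requires, and no monotonicity of the chosen elements is needed.
  have hex : ∀ j : Finset C × ℕ, ∃ e : C, star e = e ∧ ‖e‖ ≤ 1 ∧
      ∀ c ∈ j.1, ‖e * c - c‖ < 1 / (j.2 + 1) ∧ ‖c * e - c‖ < 1 / (j.2 + 1) := fun j => by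
    have h3 : ∀ c ∈ j.1, ∀ᶠ e in CStarAlgebra.approximateUnit C,
        ‖e * c - c‖ < 1 / ((j.2 : ℝ) + 1) ∧ ‖c * e - c‖ < 1 / ((j.2 : ℝ) + 1) := fun c _ => by
      have hpos : (0 : ℝ) < 1 / (j.2 + 1) := by positivity
      have h1 := (hl.tendsto_mul_right c).eventually (Metric.ball_mem_nhds c hpos)
      have h2 := (hl.tendsto_mul_left c).eventually (Metric.ball_mem_nhds c hpos)
      filter_upwards [h1, h2] with e h1 h2
      exact ⟨mem_ball_iff_norm.mp h1, mem_ball_iff_norm.mp h2⟩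
    have h4 := (Filter.eventually_all_finset j.1).mpr h3
    obtain ⟨e, h1, h2, h3⟩ := (hl.eventually_star_eq.and (hl.eventually_norm.and h4)).exists
    exact ⟨e, h1, h2, h3⟩
  choose e h1 h2 h3 using hex
  have hlim : ∀ c : C, ∀ f : Finset C × ℕ → C,
      (∀ j, c ∈ j.1 → ‖f j - c‖ < 1 / (j.2 + 1)) → Filter.Tendsto f Filter.atTop (nhds c) := by
    intro c f hf
    refine Metric.tendsto_nhds.mpr fun ε hε => ?_
    obtain ⟨n, hn⟩ := exists_nat_one_div_lt hε
    filter_upwards [Filter.eventually_ge_atTop (({c}, n) : Finset C × ℕ)] with j hj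
    rw [dist_eq_norm]
    refine (hf j (Finset.singleton_subset_iff.mp hj.1)).trans (lt_of_le_of_lt ?_ hn)
    have : (n : ℝ) ≤ j.2 := by exact_mod_cast hj.2
    gcongr
  exact ⟨e, h1, h2, fun c => hlim c _ fun j hj => (h3 j c hj).1,
    fun c => hlim c _ fun j hj => (h3 j c hj).2⟩

/-- A bounded net of operators which converges pointwise on a dense subspace converges pointwise to
a bounded operator. -/
theorem exists_pointwise_limit {H K α : Type*} [NormedAddCommGroup H] [NormedSpace ℂ H]
    [NormedAddCommGroup K] [NormedSpace ℂ K] [CompleteSpace K] {l : Filter α} [l.NeBot]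
    (T : α → H →L[ℂ] K) {M : ℝ} (hT : ∀ i, ‖T i‖ ≤ M) (D : Set H)
    (hD : (Submodule.span ℂ D).topologicalClosure = ⊤)
    (hlim : ∀ x ∈ D, ∃ y, Filter.Tendsto (fun i => T i x) l (nhds y)) :
    ∃ R : H →L[ℂ] K, ‖R‖ ≤ M ∧ ∀ x, Filter.Tendsto (fun i => T i x) l (nhds (R x)) := by
  have hM : 0 ≤ M := by
    obtain ⟨i⟩ := (inferInstance : l.NeBot).nonempty
    exact (norm_nonneg _).trans (hT i)
  have hspan : ∀ x ∈ Submodule.span ℂ D, ∃ y, Filter.Tendsto (fun i => T i x) l (nhds y) := by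
    intro x hx
    induction hx using Submodule.span_induction with
    | mem x hx => exact hlim x hx
    | zero => exact ⟨0, by simp⟩
    | add x x' _ _ hx hx' =>
      obtain ⟨y, hy⟩ := hx
      obtain ⟨y', hy'⟩ := hx'
      exact ⟨y + y', by simpa using hy.add hy'⟩
    | smul z x _ hx =>
      obtain ⟨y, hy⟩ := hx
      exact ⟨z • y, by simpa using hy.const_smul z⟩
  have hall : ∀ x, ∃ y, Filter.Tendsto (fun i => T i x) l (nhds y) := by
    intro x
    refine cauchy_map_iff_exists_tendsto.mp ?_
    rw [Metric.cauchy_iff]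
    refine ⟨inferInstance, fun ε hε => ?_⟩
    have hx : x ∈ closure (Submodule.span ℂ D : Set H) := by
      rw [← Submodule.topologicalClosure_coe, hD]; trivial
    -- This distance makes `‖T i (x - x')‖ < ε/4` for all `i`; `M + 1` avoids dividing by zero.
    -- Together with convergence at `x'` within `ε/4`, the values `T i x` eventually lie in a ball
    -- of radius `ε/2`.
    obtain ⟨x', hx', hd⟩ := Metric.mem_closure_iff.mp hx (ε / (4 * (M + 1))) (by positivity)
    obtain ⟨y, hy⟩ := hspan x' hx'
    refine ⟨Metric.ball y (ε / 2), ?_, fun u hu w hw => ?_⟩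
    · rw [Filter.mem_map]
      filter_upwards [hy.eventually (Metric.ball_mem_nhds y (show 0 < ε / 4 by positivity))]
        with i hi
      have e1 : dist (T i x) (T i x') ≤ M * (ε / (4 * (M + 1))) := by
        rw [dist_eq_norm, ← map_sub]
        refine ((T i).le_of_opNorm_le (hT i) _).trans ?_
        rw [dist_eq_norm] at hd
        gcongr
      have e2 : M * (ε / (4 * (M + 1))) < ε / 4 := by
        rw [← mul_div_assoc, div_lt_div_iff₀ (by positivity) (by positivity)]
        nlinarith
      have e3 : dist (T i x') y < ε / 4 := hi
      have := dist_triangle (T i x) (T i x') y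
      simp only [Set.mem_preimage, Metric.mem_ball]
      linarith
    · have := dist_triangle_right u w y
      rw [Metric.mem_ball] at hu hw
      linarith
  choose R hR using hall
  refine ⟨LinearMap.mkContinuous
    { toFun := R
      map_add' := fun x y => tendsto_nhds_unique (hR (x + y)) (by simpa using (hR x).add (hR y))
      map_smul' := fun z x =>
        tendsto_nhds_unique (hR (z • x)) (by simpa using (hR x).const_smul z) } M
    fun x => ?_, LinearMap.mkContinuous_norm_le _ hM _, hR⟩
  exact le_of_tendsto (hR x).norm (Filter.Eventually.of_forall fun i =>
    (T i).le_of_opNorm_le (hT i) x)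

/-! ### Elementary tensors in the completed bundle. -/

namespace FellBundle.IsBundleNorm

variable {S : Type u} [InverseMonoid S] {𝒜 : FellBundle S}
variable {B : Type u} [NonUnitalCStarAlgebra B] {p : 𝒜.fibre 1 ⊗[ℂ] B → ℝ}
variable (hp : 𝒜.IsBundleNorm B p)

/-- Elementary tensors in the completed fibres. -/
def el {s : S} : 𝒜.fibre s →ₗ[ℂ] B →ₗ[ℂ] hp.tensor.fibre s :=
  (hp.tm (s := s)).compr₂
    (UniformSpace.Completion.toComplL (𝕜 := ℂ) (E := TensorFibre hp s)).toLinearMap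

/-- The squared norm is `p (a* a ⊗ b* b)`, so the cross-norm estimate on the unit fibre and the
`C*`-identities in both factors suffice. -/
theorem norm_el_le {s : S} (a : 𝒜.fibre s) (b : B) : ‖hp.el a b‖ ≤ ‖a‖ * ‖b‖ := by
  have h1 : ‖hp.el a b‖ = ‖hp.tm a b‖ := UniformSpace.Completion.norm_coe _
  rw [h1]
  refine le_of_sq_le_sq ?_ (by positivity)
  rw [hp.norm_sq, hp.ip_tm]
  refine (hp.tmul_le _ _).trans_eq ?_
  rw [𝒜.bundle.norm_ip_self, CStarRing.norm_star_mul_self]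
  ring

theorem mul_el {s t : S} (a : 𝒜.fibre s) (a' : 𝒜.fibre t) (b b' : B) :
    hp.tensor.bundle.mul s t (hp.el a b) (hp.el a' b') =
      hp.el (𝒜.bundle.mul s t a a') (b * b') :=
  hp.preBundle.mulC_coe s t _ _

theorem star_el {s : S} (a : 𝒜.fibre s) (b : B) :
    hp.tensor.bundle.star s (hp.el a b) = hp.el (𝒜.bundle.star s a) (star b) :=
  hp.preBundle.starC_coe s _

theorem incl_el {s t : S} (h : s ≤ t) (a : 𝒜.fibre s) (b : B) :
    hp.tensor.bundle.incl h (hp.el a b) = hp.el (𝒜.bundle.incl h a) b :=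
  hp.preBundle.inclC_coe h _

/-- A closed subspace which contains the elementary tensors is everything. -/
theorem mem_of_el_mem {s : S} (J : Submodule ℂ (hp.tensor.fibre s))
    (hJ : IsClosed (J : Set (hp.tensor.fibre s))) (h : ∀ a b, hp.el a b ∈ J)
    (x : hp.tensor.fibre s) : x ∈ J := by
  refine UniformSpace.Completion.induction_on (p := fun x => x ∈ J) x hJ fun x => ?_
  obtain ⟨n, a, b, rfl⟩ := hp.exists_sum_tm x
  have e : ((∑ i, hp.tm (a i) (b i) : TensorFibre hp s) :
      UniformSpace.Completion (TensorFibre hp s)) = ∑ i, hp.el (a i) (b i) :=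
    map_sum (UniformSpace.Completion.toComplL (𝕜 := ℂ) (E := TensorFibre hp s)) _ _
  rw [e]
  exact J.sum_mem fun i _ => h _ _

end FellBundle.IsBundleNorm

/-! ### Factorization of representations of the tensor product bundle. -/

namespace FellBundle.IsBundleNorm

variable {S : Type u} [InverseMonoid S] {𝒜 : FellBundle S}
variable {B : Type u} [NonUnitalCStarAlgebra B] {p : 𝒜.fibre 1 ⊗[ℂ] B → ℝ}
variable (hp : 𝒜.IsBundleNorm B p)

theorem mulTo_el {s t r : S} (h : s * t ≤ r) (a : 𝒜.fibre s) (a' : 𝒜.fibre t) (b b' : B) :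
    hp.tensor.bundle.mulTo h (hp.el a b) (hp.el a' b') =
      hp.el (𝒜.bundle.mulTo h a a') (b * b') := by
  rw [AlgBundle.mulTo, mul_el, incl_el]; rfl

theorem mul_el_one (c c' : 𝒜.fibre 1) (b b' : B) :
    hp.el c b * hp.el c' b' = hp.el (c * c') (b * b') :=
  hp.mulTo_el _ c c' b b'

theorem star_el_one (c : 𝒜.fibre 1) (b : B) : star (hp.el c b) = hp.el (star c) (star b) := by
  rw [star_def, AlgBundle.starOne, AlgBundle.starTo, star_el, incl_el]; rfl

theorem continuous_el_left {s : S} (b : B) : Continuous fun a : 𝒜.fibre s => hp.el a b :=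
  AddMonoidHomClass.continuous_of_bound ((hp.el (s := s)).flip b) ‖b‖ fun a =>
    (hp.norm_el_le a b).trans_eq (mul_comm _ _)

theorem continuous_el_right {s : S} (a : 𝒜.fibre s) : Continuous (hp.el a) :=
  AddMonoidHomClass.continuous_of_bound (hp.el a) ‖a‖ (hp.norm_el_le a)

variable {hp} {H : Type*} [NormedAddCommGroup H] [InnerProductSpace ℂ H] [CompleteSpace H]
  (σ : hp.tensor.HRep H)

/-- Bounded operators on a nondegenerate representation are therefore determined by their values on
the vectors `σ(c ⊗ b) v`, where both factors of the representation can be computed explicitly. -/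
theorem span_el_dense
    (hσ : (Submodule.span ℂ {w : H | ∃ c v, w = σ.π 1 c v}).topologicalClosure = ⊤) :
    (Submodule.span ℂ {w : H | ∃ (c : 𝒜.fibre 1) (b : B) (v : H),
      w = σ.π 1 (hp.el c b) v}).topologicalClosure = ⊤ := by
  let J := (Submodule.span ℂ {w : H | ∃ (c : 𝒜.fibre 1) (b : B) (v : H),
    w = σ.π 1 (hp.el c b) v}).topologicalClosure
  have hJc : IsClosed (J : Set H) := Submodule.isClosed_topologicalClosure _
  rw [eq_top_iff, ← hσ]
  refine Submodule.topologicalClosure_minimal _ (Submodule.span_le.mpr ?_) hJc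
  rintro _ ⟨c, v, rfl⟩
  let K : Submodule ℂ (hp.tensor.fibre 1) :=
    J.comap ((ContinuousLinearMap.apply ℂ H v).toLinearMap ∘ₗ σ.π 1)
  have hK : IsClosed (K : Set (hp.tensor.fibre 1)) :=
    hJc.preimage ((ContinuousLinearMap.apply ℂ H v).continuous.comp (σ.continuous_π 1))
  exact hp.mem_of_el_mem K hK (fun a b =>
    Submodule.le_topologicalClosure _ (Submodule.subset_span ⟨a, b, v, rfl⟩)) c

theorem tendsto_π_el {α : Type*} {l : Filter α} {s : S} {a : α → 𝒜.fibre s} {b : α → B}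
    {x : hp.tensor.fibre s} (h : Filter.Tendsto (fun i => hp.el (a i) (b i)) l (nhds x)) (v : H) :
    Filter.Tendsto (fun i => σ.π s (hp.el (a i) (b i)) v) l (nhds (σ.π s x v)) :=
  (((ContinuousLinearMap.apply ℂ H v).continuous.comp (σ.continuous_π s)).tendsto _).comp h

/-- A nondegenerate representation of the tensor product bundle is the product of a nondegenerate
representation of the bundle and a bounded family of operators, with the same units. -/
theorem exists_factor
    (hσ : (Submodule.span ℂ {w : H | ∃ c v, w = σ.π 1 c v}).topologicalClosure = ⊤) :
    ∃ (τ : 𝒜.HRep H) (R : B → H →L[ℂ] H),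
      (Submodule.span ℂ {w : H | ∃ c v, w = τ.π 1 c v}).topologicalClosure = ⊤ ∧
      (∀ b, ‖R b‖ ≤ ‖b‖) ∧ (∀ s (a : 𝒜.fibre s) b, σ.π s (hp.el a b) = τ.π s a * R b) ∧
      ∀ r, σ.unit r = τ.unit r := by
  classical
  have hD := span_el_dense σ hσ
  set D := {w : H | ∃ (c : 𝒜.fibre 1) (b : B) (v : H), w = σ.π 1 (hp.el c b) v}
  have hdense : Dense (Submodule.span ℂ D : Set H) := 
    Submodule.dense_iff_topologicalClosure_eq_top.mpr hD
  have hext : ∀ T T' : H →L[ℂ] H, (∀ (c : 𝒜.fibre 1) (b : B) (v : H),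
      T (σ.π 1 (hp.el c b) v) = T' (σ.π 1 (hp.el c b) v)) → T = T' := by
    intro T T' h
    refine ContinuousLinearMap.ext_on hdense ?_
    rintro _ ⟨c, b, v, rfl⟩
    exact h c b v
  obtain ⟨e, he_star, he_norm, he_left, -⟩ := exists_approximate_unit B
  obtain ⟨u, -, hu_norm, hu_left, -⟩ := exists_approximate_unit (𝒜.fibre 1)
  -- On the dense set of vectors `σ(x ⊗ b) v`, the operators `σ(a ⊗ e_j)` converge, because `σ(ax ⊗
  -- e_j b) v` tends to `σ(ax ⊗ b) v`. Uniform boundedness then gives the strong limit `L s a`, the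
  -- value of `τ` at `a`.
  have hleft : ∀ s t (a : 𝒜.fibre s) (x : 𝒜.fibre t) (b : B) (v : H), Filter.Tendsto
      (fun j => σ.π s (hp.el a (e j)) (σ.π t (hp.el x b) v)) Filter.atTop
      (nhds (σ.π (s * t) (hp.el (𝒜.bundle.mul s t a x) b) v)) := by
    intro s t a x b v
    have e1 : ∀ j, σ.π s (hp.el a (e j)) (σ.π t (hp.el x b) v) =
        σ.π (s * t) (hp.el (𝒜.bundle.mul s t a x) (e j * b)) v := fun j => by
      rw [← mul_apply_eq_comp, ← σ.map_mul, mul_el]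
    simp only [e1]
    exact tendsto_π_el σ (((hp.continuous_el_right _).tendsto _).comp (he_left b)) v
  have hL : ∀ s (a : 𝒜.fibre s), ∃ T : H →L[ℂ] H, ‖T‖ ≤ ‖a‖ ∧ ∀ x,
      Filter.Tendsto (fun j => σ.π s (hp.el a (e j)) x) Filter.atTop (nhds (T x)) := by
    intro s a
    refine exists_pointwise_limit (fun j => σ.π s (hp.el a (e j))) (fun j => ?_) D hD ?_
    · refine (σ.norm_le _ _).trans ((hp.norm_el_le _ _).trans ?_)
      exact mul_le_of_le_one_right (norm_nonneg _) (he_norm j)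
    · rintro _ ⟨c, b, v, rfl⟩
      exact ⟨_, hleft s 1 a c b v⟩
  choose L _ hLlim using hL
  have hLel : ∀ s t (a : 𝒜.fibre s) (x : 𝒜.fibre t) (b : B) (v : H),
      L s a (σ.π t (hp.el x b) v) = σ.π (s * t) (hp.el (𝒜.bundle.mul s t a x) b) v :=
    fun s t a x b v => tendsto_nhds_unique (hLlim s a _) (hleft s t a x b v)
  have hLincl : ∀ (s t : S) (h : s ≤ t) (a : 𝒜.fibre s), L t (𝒜.bundle.incl h a) = L s a := by
    intro s t h a
    ext x
    refine tendsto_nhds_unique (hLlim t _ x) ?_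
    simp only [← incl_el, σ.map_incl]
    exact hLlim s a x
  let τ : 𝒜.HRep H :=
    { π := fun s =>
        { toFun := L s
          map_add' := fun a a' => by
            ext x
            refine tendsto_nhds_unique (hLlim s _ x) ?_
            simpa using (hLlim s a x).add (hLlim s a' x)
          map_smul' := fun z a => by
            ext x
            refine tendsto_nhds_unique (hLlim s _ x) ?_
            simpa using (hLlim s a x).const_smul z }
      map_mul := fun s t a a' => hext _ _ fun c b v => by
        change L (s * t) _ _ = L s a (L t a' _)
        rw [hLel, hLel, hLel, ← 𝒜.bundle.mul_assoc s t 1 (le_of_eq (mul_assoc _ _ _)), ← incl_el,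
          σ.map_incl]
      map_star := fun s a => by
        change L s⁻¹ _ = star (L s a)
        rw [ContinuousLinearMap.star_eq_adjoint, ContinuousLinearMap.eq_adjoint_iff]
        intro x y
        -- The adjoint of `σ(a ⊗ e_j)` is `σ(a* ⊗ e_j)` because `e_j` is self-adjoint; hence strong
        -- limits suffice to identify the adjoint of `L s a`.
        refine tendsto_nhds_unique ((hLlim s⁻¹ _ x).inner tendsto_const_nhds)
          ((tendsto_const_nhds.inner (hLlim s a y)).congr fun j => ?_)
        rw [← σ.inner_left, ← σ.map_star, star_el, he_star]
      map_incl := hLincl }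
  -- The same construction with the roles exchanged: an approximate unit `u_j` of the unit fibre
  -- isolates the factor from `B`. Only boundedness of `R`, the factorization and commutation with
  -- the unit fibre are needed.
  have hRlim : ∀ (b : B) (c : 𝒜.fibre 1) (b' : B) (v : H), Filter.Tendsto
      (fun j => σ.π 1 (hp.el (u j) b) (σ.π 1 (hp.el c b') v)) Filter.atTop
      (nhds (σ.π 1 (hp.el c (b * b')) v)) := by
    intro b c b' v
    have e1 : ∀ j, σ.π 1 (hp.el (u j) b) (σ.π 1 (hp.el c b') v) =
        σ.π 1 (hp.el (u j * c) (b * b')) v := fun j => by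
      rw [← mul_apply_eq_comp, ← σ.map_mul_one, mul_el_one]
    simp only [e1]
    exact tendsto_π_el σ (((hp.continuous_el_left _).tendsto _).comp (hu_left c)) v
  have hR : ∀ b : B, ∃ T : H →L[ℂ] H, ‖T‖ ≤ ‖b‖ ∧ ∀ x,
      Filter.Tendsto (fun j => σ.π 1 (hp.el (u j) b) x) Filter.atTop (nhds (T x)) := by
    intro b
    refine exists_pointwise_limit (fun j => σ.π 1 (hp.el (u j) b)) (fun j => ?_) D hD ?_
    · refine (σ.norm_le _ _).trans ((hp.norm_el_le _ _).trans ?_)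
      exact mul_le_of_le_one_left (norm_nonneg _) (hu_norm j)
    · rintro _ ⟨c, b', v, rfl⟩
      exact ⟨_, hRlim b c b' v⟩
  choose R hRnorm hR using hR
  have hRel : ∀ (b : B) (c : 𝒜.fibre 1) (b' : B) (v : H),
      R b (σ.π 1 (hp.el c b') v) = σ.π 1 (hp.el c (b * b')) v :=
    fun b c b' v => tendsto_nhds_unique (hR b _) (hRlim b c b' v)
  have hfac : ∀ s (a : 𝒜.fibre s) b, σ.π s (hp.el a b) = τ.π s a * R b := by
    intro s a b
    refine hext _ _ fun c b' v => ?_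
    rw [mul_apply_eq_comp, hRel, ← mul_apply_eq_comp, ← σ.map_mul, mul_el]
    exact (hLel s 1 a c (b * b') v).symm
  have hLone : ∀ (a c : 𝒜.fibre 1) (b : B) (v : H),
      τ.π 1 a (σ.π 1 (hp.el c b) v) = σ.π 1 (hp.el (a * c) b) v := by
    intro a c b v
    refine (hLel 1 1 a c b v).trans ?_
    rw [← σ.map_incl _ _ (le_of_eq (one_mul 1)), incl_el]
    rfl
  have hcomm : ∀ (a : 𝒜.fibre 1) b, R b * τ.π 1 a = τ.π 1 a * R b := by
    intro a b
    refine hext _ _ fun c b' v => ?_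
    rw [mul_apply_eq_comp, mul_apply_eq_comp, hLone, hRel, hRel, hLone]
  refine ⟨τ, R, ?_, hRnorm, hfac, fun r => ?_⟩
  · rw [eq_top_iff, ← hD]
    refine Submodule.topologicalClosure_mono (Submodule.span_le.mpr ?_)
    rintro _ ⟨c, b, v, rfl⟩
    exact Submodule.subset_span ⟨c, R b v, by rw [hfac]; rfl⟩
  -- Equality of units reduces to equality of null spaces. If `τ(a) y = 0`, then `σ(a ⊗ b) y = R(b)
  -- τ(a) y = 0`; here an idempotent fibre is included in the unit fibre, where `R(b)` is known to
  -- commute. Conversely `τ(a) y` is the limit of `σ(a ⊗ e_j) y`.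
  · have h1 : ∀ y ∈ τ.null r, y ∈ σ.null r := by
      intro y hy f hf hr x
      let K : Submodule ℂ (hp.tensor.fibre f) :=
        LinearMap.ker ((ContinuousLinearMap.apply ℂ H y).toLinearMap ∘ₗ σ.π f)
      have hK : IsClosed (K : Set (hp.tensor.fibre f)) :=
        isClosed_singleton.preimage
          ((ContinuousLinearMap.apply ℂ H y).continuous.comp (σ.continuous_π f))
      refine hp.mem_of_el_mem K hK (fun a b => ?_) x
      change σ.π f (hp.el a b) y = 0
      rw [hfac, ← τ.map_incl f 1 ⟨f, hf, one_mul f⟩, ← hcomm, mul_apply_eq_comp, τ.map_incl,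
        hy f hf hr, map_zero]
    have h2 : ∀ y ∈ σ.null r, y ∈ τ.null r := by
      intro y hy f hf hr a
      refine tendsto_nhds_unique (hLlim f a y) ?_
      simp only [hy f hf hr]
      exact tendsto_const_nhds
    ext x
    have h3 : (ContinuousLinearMap.id ℂ H).adjoint = ContinuousLinearMap.id ℂ H :=
      star_one (H →L[ℂ] H)
    exact τ.unit_intertwine σ (ContinuousLinearMap.id ℂ H) h1 (by rw [h3]; exact h2) x

end FellBundle.IsBundleNorm

/-! ### The universal representation and its summands. -/

namespace FellBundle

variable {S : Type u} [InverseMonoid S] {𝒜 : FellBundle S}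

/-- A nondegenerate representation, regarded as a representation. -/
def Rep.toHRep (ρ : 𝒜.Rep) : 𝒜.HRep ρ.H := ⟨ρ.π, ρ.map_mul, ρ.map_star, ρ.map_incl⟩

theorem univ_apply (s : S) (a : 𝒜.fibre s) (f : 𝒜.univSpace) (ρ : 𝒜.Rep) :
    𝒜.univ s a f ρ = ρ.π s a (f ρ) := rfl

variable (𝒜) in
/-- The universal representation. -/
def univRep : 𝒜.HRep 𝒜.univSpace where
  π s :=
    { toFun := 𝒜.univ s
      map_add' := fun a b => by
        ext f ρ
        rw [univ_apply, map_add]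
        rfl
      map_smul' := fun z a => by
        ext f ρ
        rw [univ_apply, map_smul]
        rfl }
  map_mul s t a b := by
    ext f ρ
    change ρ.π (s * t) _ (f ρ) = ρ.π s a (ρ.π t b (f ρ))
    rw [ρ.map_mul]
    rfl
  map_star s a := by
    change 𝒜.univ s⁻¹ _ = star (𝒜.univ s a)
    rw [ContinuousLinearMap.star_eq_adjoint, ContinuousLinearMap.eq_adjoint_iff]
    intro f g
    rw [lp.inner_eq_tsum, lp.inner_eq_tsum]
    refine tsum_congr fun ρ => ?_
    rw [univ_apply, univ_apply, ρ.map_star, ContinuousLinearMap.star_eq_adjoint,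
      ContinuousLinearMap.adjoint_inner_left]
  map_incl s t h a := by
    ext f ρ
    change ρ.π t _ (f ρ) = ρ.π s a (f ρ)
    rw [ρ.map_incl]

/-- Coordinate evaluation intertwines the two representations, hence their units. The projection on
the direct sum is thus diagonal, although it is defined by a closed span in the whole sum. -/
theorem univ_unit_apply (r : S) (f : 𝒜.univSpace) (ρ : 𝒜.Rep) :
    𝒜.univRep.unit r f ρ = ρ.toHRep.unit r (f ρ) :=
  (𝒜.univRep.unit_intertwine_of_commute ρ.toHRep (lp.evalCLM ℂ (fun ρ : 𝒜.Rep => ρ.H) 2 ρ)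
    (fun _ _ _ => rfl) r f).symm

theorem univ_star_apply (c : 𝒜.fibre 1) (f : 𝒜.univSpace) (ρ : 𝒜.Rep) :
    star (𝒜.univRep.π 1 c) f ρ = star (ρ.toHRep.π 1 c) (f ρ) := by
  rw [← HRep.map_star_one, ← HRep.map_star_one]
  rfl

theorem univSpace_sum_apply {α : Type*} (F : Finset α) (f : α → 𝒜.univSpace) (ρ : 𝒜.Rep) :
    (∑ i ∈ F, f i) ρ = ∑ i ∈ F, f i ρ :=
  map_sum (lp.evalCLM ℂ (fun ρ : 𝒜.Rep => ρ.H) 2 ρ) f F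

theorem univ_gram_apply (F : Finset S) (ξ : S → 𝒜.fibre 1) (f : 𝒜.univSpace) (ρ : 𝒜.Rep) :
    𝒜.univRep.gram F ξ f ρ = ρ.toHRep.gram F ξ (f ρ) := by
  simp only [HRep.gram, _root_.sum_apply, univSpace_sum_apply, mul_apply_eq_comp,
    univ_star_apply]
  refine Finset.sum_congr rfl fun p _ => Finset.sum_congr rfl fun t _ => ?_
  rw [← univ_unit_apply]
  rfl

theorem univ_average_apply (F : Finset S) (ξ : S → 𝒜.fibre 1) {s : S} (a : 𝒜.fibre s)
    (f : 𝒜.univSpace) (ρ : 𝒜.Rep) :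
    𝒜.univRep.average F ξ s a f ρ = ρ.toHRep.average F ξ s a (f ρ) := by
  simp only [HRep.average, LinearMap.coe_mk, AddHom.coe_mk, _root_.sum_apply,
    univSpace_sum_apply, mul_apply_eq_comp, univ_unit_apply, univ_star_apply]
  rfl

theorem norm_le_of_components (T : 𝒜.univSpace →L[ℂ] 𝒜.univSpace)
    (T' : ∀ ρ : 𝒜.Rep, ρ.H →L[ℂ] ρ.H) (h : ∀ f ρ, T f ρ = T' ρ (f ρ)) {C : ℝ} (hC0 : 0 ≤ C)
    (hC : ∀ ρ, ‖T' ρ‖ ≤ C) : ‖T‖ ≤ C := by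
  have e : T = lp.mapCLM 2 T' hC0 hC := by
    ext f ρ
    exact h f ρ
  rw [e]
  exact lp.norm_mapCLM_le 2 T' hC0 hC

/-- The operator is tested on vectors supported in the single summand `ρ`. -/
theorem norm_component_le (T : 𝒜.univSpace →L[ℂ] 𝒜.univSpace) {ρ : 𝒜.Rep} (T' : ρ.H →L[ℂ] ρ.H)
    (h : ∀ f, T f ρ = T' (f ρ)) : ‖T'‖ ≤ ‖T‖ := by
  classical
  refine T'.opNorm_le_bound (norm_nonneg _) fun x => ?_
  have e := h (lp.single 2 ρ x)
  rw [lp.single_apply_self] at e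
  rw [← e]
  calc _ ≤ ‖T (lp.single 2 ρ x)‖ := lp.norm_apply_le_norm (by simp) _ _
    _ ≤ ‖T‖ * ‖lp.single 2 ρ x‖ := T.le_opNorm _
    _ = _ := by rw [lp.norm_single (by simp)]

/-! ### Transfer of the approximation property to the tensor product. -/

namespace IsBundleNorm

variable {B : Type u} [NonUnitalCStarAlgebra B] {p : 𝒜.fibre 1 ⊗[ℂ] B → ℝ}
  {hp : 𝒜.IsBundleNorm B p}

/-- After the factorization, `ξ(p)* ξ(t) ⊗ e* e` contributes the same right factor `R(e* e)` to
every summand, so it leaves the double sum. -/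
theorem gram_eq {H : Type*} [NormedAddCommGroup H] [InnerProductSpace ℂ H] [CompleteSpace H]
    {σ : hp.tensor.HRep H} {τ : 𝒜.HRep H} {R : B → H →L[ℂ] H}
    (hR : ∀ s (a : 𝒜.fibre s) b, σ.π s (hp.el a b) = τ.π s a * R b)
    (hu : ∀ r, σ.unit r = τ.unit r) (F : Finset S) (ξ : S → 𝒜.fibre 1) (e : B) :
    σ.gram F (fun s => hp.el (ξ s) e) = τ.gram F ξ * R (star e * e) := by
  simp only [HRep.gram, Finset.sum_mul]
  refine Finset.sum_congr rfl fun p _ => Finset.sum_congr rfl fun t _ => ?_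
  rw [← σ.map_star_one, star_el_one, ← σ.map_mul_one, mul_el_one, ← σ.unit_mul_π_one, hR, hu,
    ← mul_assoc, τ.unit_mul_π_one, τ.map_mul_one, τ.map_star_one]

theorem average_el_eq {H : Type*} [NormedAddCommGroup H] [InnerProductSpace ℂ H]
    [CompleteSpace H] {σ : hp.tensor.HRep H} {τ : 𝒜.HRep H} {R : B → H →L[ℂ] H}
    (hR : ∀ s (a : 𝒜.fibre s) b, σ.π s (hp.el a b) = τ.π s a * R b)
    (hu : ∀ r, σ.unit r = τ.unit r) (F : Finset S) (ξ : S → 𝒜.fibre 1) (e : B) {s : S}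
    (a : 𝒜.fibre s) (b : B) :
    σ.average F (fun s => hp.el (ξ s) e) s (hp.el a b) =
      τ.average F ξ s a * R (star e * b * e) := by
  simp only [HRep.average, LinearMap.coe_mk, AddHom.coe_mk, Finset.sum_mul]
  refine Finset.sum_congr rfl fun p _ => Finset.sum_congr rfl fun t _ => ?_
  have e1 : star (σ.π 1 (hp.el (ξ p) e)) * σ.π s (hp.el a b) * σ.π 1 (hp.el (ξ t) e) =
      star (τ.π 1 (ξ p)) * τ.π s a * τ.π 1 (ξ t) * R (star e * b * e) := by
    rw [← σ.map_star_one, star_el_one, ← σ.map_mulTo (le_of_eq (one_mul s)), mulTo_el,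
      ← σ.map_mulTo (le_of_eq (mul_one s)), mulTo_el, hR, τ.map_mulTo, τ.map_mulTo,
      τ.map_star_one]
  rw [mul_assoc (σ.unit _), mul_assoc (σ.unit _), e1, hu]
  simp only [mul_assoc]

theorem norm_gram_el_le (F : Finset S) (ξ : S → 𝒜.fibre 1) {e : B} (he : ‖e‖ ≤ 1) :
    ‖hp.tensor.univRep.gram F (fun s => hp.el (ξ s) e)‖ ≤ ‖𝒜.univRep.gram F ξ‖ := by
  refine norm_le_of_components _ _ (univ_gram_apply F _) (norm_nonneg _) fun ρ => ?_
  obtain ⟨τ, R, hτ, hRn, hR, hu⟩ := exists_factor ρ.toHRep ρ.nondegenerate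
  -- The factor `τ` is nondegenerate and acts on the same Hilbert space, so it is one of the
  -- summands of the universal representation of the original bundle. Its norms are controlled by
  -- the universal ones.
  let ρ' : 𝒜.Rep := ⟨ρ.H, τ.π, τ.map_mul, τ.map_star, τ.map_incl, hτ⟩
  rw [gram_eq hR hu]
  have h1 : ‖τ.gram F ξ‖ ≤ ‖𝒜.univRep.gram F ξ‖ :=
    norm_component_le (ρ := ρ') _ _ fun f => univ_gram_apply F ξ f ρ'
  have h2 : ‖R (star e * e)‖ ≤ 1 := by
    refine (hRn _).trans ?_
    rw [CStarRing.norm_star_mul_self]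
    exact mul_le_one₀ he (norm_nonneg _) he
  exact (norm_mul_le _ _).trans ((mul_le_of_le_one_right (norm_nonneg _) h2).trans h1)

theorem norm_average_el_sub_le (F : Finset S) (ξ : S → 𝒜.fibre 1) {e : B} (he : ‖e‖ ≤ 1) {s : S}
    (a : 𝒜.fibre s) (b : B) :
    ‖hp.tensor.univRep.average F (fun s => hp.el (ξ s) e) s (hp.el a b) -
      hp.tensor.univRep.π s (hp.el a b)‖ ≤
      ‖𝒜.univRep.average F ξ s a - 𝒜.univRep.π s a‖ * ‖b‖ + ‖a‖ * ‖star e * b * e - b‖ := by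
  refine norm_le_of_components _ (fun ρ => ρ.toHRep.average F (fun s => hp.el (ξ s) e) s
    (hp.el a b) - ρ.toHRep.π s (hp.el a b)) (fun f ρ => ?_) (by positivity) fun ρ => ?_
  · rw [_root_.sub_apply, _root_.sub_apply, ← univ_average_apply]
    rfl
  obtain ⟨τ, R, hτ, hRn, hR, hu⟩ := exists_factor ρ.toHRep ρ.nondegenerate
  let ρ' : 𝒜.Rep := ⟨ρ.H, τ.π, τ.map_mul, τ.map_star, τ.map_incl, hτ⟩
  have h1 : ‖τ.average F ξ s a - τ.π s a‖ ≤ ‖𝒜.univRep.average F ξ s a - 𝒜.univRep.π s a‖ :=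
    norm_component_le (ρ := ρ') _ _ fun f => by
      rw [_root_.sub_apply, _root_.sub_apply]
      exact congrArg₂ (· - ·) (univ_average_apply F ξ a f ρ') rfl
  have h2 : ‖R (star e * b * e)‖ ≤ ‖b‖ := by
    refine (hRn _).trans ((norm_mul_le _ _).trans ((mul_le_of_le_one_right (norm_nonneg _) he).trans
      ((norm_mul_le _ _).trans ?_)))
    rw [norm_star]
    exact mul_le_of_le_one_left (norm_nonneg _) he
  -- Insert `τ(a) R(e* b e) = σ(a ⊗ e* b e)`: one error comes from averaging `a`, the other from
  -- compressing `b` by `e`.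
  have e1 : ρ.toHRep.average F (fun s => hp.el (ξ s) e) s (hp.el a b) -
      ρ.toHRep.π s (hp.el a b) = (τ.average F ξ s a - τ.π s a) * R (star e * b * e) +
        ρ.toHRep.π s (hp.el a (star e * b * e - b)) := by
    rw [average_el_eq hR hu, map_sub, map_sub, hR, hR, sub_mul]
    abel
  rw [e1]
  refine (norm_add_le _ _).trans (add_le_add ((norm_mul_le _ _).trans ?_) ?_)
  · gcongr
  · exact (ρ.toHRep.norm_le _ _).trans (hp.norm_el_le _ _)

/-- Bounded linear maps on a completed fibre converge pointwise if they converge on elementary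
tensors. -/
theorem tendsto_of_tendsto_el {E α : Type*} [NormedAddCommGroup E] [NormedSpace ℂ E]
    {l : Filter α} {s : S} {T : α → hp.tensor.fibre s →ₗ[ℂ] E} {T₀ : hp.tensor.fibre s →ₗ[ℂ] E}
    {C : ℝ} (hC0 : 0 ≤ C) (hT : ∀ k x, ‖T k x‖ ≤ C * ‖x‖) (hT₀ : ∀ x, ‖T₀ x‖ ≤ ‖x‖)
    (h : ∀ a b, Filter.Tendsto (fun k => T k (hp.el a b)) l (nhds (T₀ (hp.el a b))))
    (x : hp.tensor.fibre s) : Filter.Tendsto (fun k => T k x) l (nhds (T₀ x)) := by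
  let J : Submodule ℂ (hp.tensor.fibre s) :=
    { carrier := {x | Filter.Tendsto (fun k => T k x) l (nhds (T₀ x))}
      zero_mem' := by simp [tendsto_const_nhds]
      add_mem' := fun hx hy => by simpa using Filter.Tendsto.add hx hy
      smul_mem' := fun z x hx => by simpa using Filter.Tendsto.const_smul hx z }
  have hJ : IsClosed (J : Set (hp.tensor.fibre s)) := by
    refine isClosed_of_closure_subset fun x hx => Metric.tendsto_nhds.mpr fun ε hε => ?_
    -- Replacing `x` by `y` costs at most `C ‖x - y‖` under `T k` and `‖x - y‖` under `T₀`, together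
    -- below `ε/2`.
    obtain ⟨y, hy, hxy⟩ := Metric.mem_closure_iff.mp hx (ε / (2 * (C + 1))) (by positivity)
    filter_upwards [(Metric.tendsto_nhds.mp hy) (ε / 2) (by positivity)] with k hk
    rw [dist_eq_norm] at hk hxy ⊢
    have e1 : T k x - T₀ x = T k (x - y) + (T k y - T₀ y) - T₀ (x - y) := by
      rw [map_sub, map_sub]; abel
    have e2 := hT k (x - y)
    have e3 := hT₀ (x - y)
    rw [lt_div_iff₀ (by positivity)] at hxy
    have e4 := norm_sub_le (T k (x - y) + (T k y - T₀ y)) (T₀ (x - y))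
    have e5 := norm_add_le (T k (x - y)) (T k y - T₀ y)
    rw [e1]
    linarith
  exact hp.mem_of_el_mem J hJ h x

/-- The completed tensor product bundle inherits the approximation property. -/
theorem approximationProperty_tensor (hp : 𝒜.IsBundleNorm B p) (h : 𝒜.ApproximationProperty) :
    hp.tensor.ApproximationProperty := by
  classical
  obtain ⟨ι, _, _, _, ξ, hξ, ⟨C, hC⟩, hlim⟩ := h
  obtain ⟨e, he_star, he_norm, he_left, he_right⟩ := exists_approximate_unit B
  let η : ι × (Finset B × ℕ) → S →₀ hp.tensor.fibre 1 := fun k =>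
    (ξ k.1).mapRange (fun c => hp.el c (e k.2)) (by simp)
  -- The supports can shrink under tensoring; the sums are rewritten over the support of `ξ`, where
  -- the factorization formulas apply.
  have hsub : ∀ k, (η k).support ⊆ (ξ k.1).support := fun k => Finsupp.support_mapRange
  have hη : ∀ k, ∀ s ∉ (η k).support, hp.el (ξ k.1 s) (e k.2) = 0 := fun k s hs =>
    Finsupp.notMem_support_iff.mp hs
  have hgram : ∀ k, hp.tensor.univRep.gram (η k).support (η k) =
      hp.tensor.univRep.gram (ξ k.1).support fun s => hp.el (ξ k.1 s) (e k.2) := fun k =>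
    hp.tensor.univRep.gram_subset (hsub k) (hη k)
  have haverage : ∀ k s, hp.tensor.univRep.average (η k).support (η k) s =
      hp.tensor.univRep.average (ξ k.1).support (fun s => hp.el (ξ k.1 s) (e k.2)) s := fun k s =>
    hp.tensor.univRep.average_subset (hsub k) (hη k) s
  have hbound : ∀ k : ι × (Finset B × ℕ), ‖hp.tensor.univRep.gram (ξ k.1).support
      fun s => hp.el (ξ k.1 s) (e k.2)‖ ≤ C := fun k =>
    (norm_gram_el_le _ _ (he_norm k.2)).trans (hC k.1)
  have hdir : IsDirectedOrder (ι × (Finset B × ℕ)) := ⟨fun k k' => by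
    obtain ⟨i, h1, h2⟩ := exists_ge_ge k.1 k'.1
    obtain ⟨j, h3, h4⟩ := exists_ge_ge k.2 k'.2
    exact ⟨(i, j), ⟨h1, h3⟩, ⟨h2, h4⟩⟩⟩
  refine ⟨ι × (Finset B × ℕ), inferInstance, hdir, inferInstance, η, fun k s => ?_,
    ⟨C, fun k => ?_⟩, fun s x => ?_⟩
  · obtain ⟨a, ha⟩ := hξ k.1 s
    refine ⟨hp.el a (e k.2), ?_⟩
    rw [incl_el, ← ha]
    rfl
  · exact (congrArg norm (hgram k)).trans_le (hbound k)
  -- The defining sum is by definition the averaging map of `univRep`. Its bound `C`, uniform in the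
  -- index, reduces convergence to elementary tensors.
  · change Filter.Tendsto (fun k => hp.tensor.univRep.average (η k).support (η k) s x)
      Filter.atTop (nhds (hp.tensor.univRep.π s x))
    simp only [haverage]
    have hC0 : 0 ≤ C := (norm_nonneg _).trans (hC (Classical.arbitrary ι))
    refine tendsto_of_tendsto_el hC0 (fun k x => hp.tensor.univRep.norm_average_le (hbound k) x)
      (hp.tensor.univRep.norm_le s) (fun a b => ?_) x
    refine tendsto_iff_norm_sub_tendsto_zero.mpr ?_
    refine squeeze_zero (fun _ => norm_nonneg _)
      (fun k => norm_average_el_sub_le (ξ k.1).support (ξ k.1) (he_norm k.2) a b) ?_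
    have hfst : Filter.Tendsto (Prod.fst : ι × (Finset B × ℕ) → ι) Filter.atTop Filter.atTop :=
      Filter.prod_atTop_atTop_eq (α := ι) (β := Finset B × ℕ) ▸ Filter.tendsto_fst
    have hsnd : Filter.Tendsto (Prod.snd : ι × (Finset B × ℕ) → _) Filter.atTop Filter.atTop :=
      Filter.prod_atTop_atTop_eq (α := ι) (β := Finset B × ℕ) ▸ Filter.tendsto_snd
    have h1 : Filter.Tendsto (fun i => ‖𝒜.univRep.average (ξ i).support (ξ i) s a -
        𝒜.univRep.π s a‖) Filter.atTop (nhds 0) :=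
      tendsto_iff_norm_sub_tendsto_zero.mp (hlim s a)
    have h2 : Filter.Tendsto (fun j => ‖star (e j) * b * e j - b‖) Filter.atTop (nhds 0) := by
      have h3 := tendsto_iff_norm_sub_tendsto_zero.mp (he_left b)
      have h4 := tendsto_iff_norm_sub_tendsto_zero.mp (he_right b)
      refine squeeze_zero (fun _ => norm_nonneg _) (fun j => ?_) (by simpa using h3.add h4)
      rw [he_star]
      -- The left and right approximation errors separate; the extra factor `e j` is a contraction.
      have e1 : e j * b * e j - b = (e j * b - b) * e j + (b * e j - b) := by
        rw [sub_mul]; abel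
      rw [e1]
      refine (norm_add_le _ _).trans (add_le_add_left ((norm_mul_le _ _).trans ?_) _)
      exact mul_le_of_le_one_right (norm_nonneg _) (he_norm j)
    simpa using ((h1.comp hfst).mul_const ‖b‖).add ((h2.comp hsnd).const_mul ‖a‖)

end IsBundleNorm
end FellBundle

end

/-- If a Fell bundle over an inverse semigroup (with unit) has the approximation property, then so
do its minimal and maximal tensor products with any `C*`-algebra `B`. -/
theorem proposition4p20 {S : Type u} [InverseMonoid S] (𝒜 : FellBundle S) (B : Type u)
    [NonUnitalCStarAlgebra B] (h : 𝒜.ApproximationProperty) :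
    (𝒜.minTensor B).ApproximationProperty ∧ (𝒜.maxTensor B).ApproximationProperty :=
  ⟨FellBundle.IsBundleNorm.approximationProperty_tensor _ h,
    FellBundle.IsBundleNorm.approximationProperty_tensor _ h⟩
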